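/- Let $\mathbb K$ be $\mathbb R$ or $\mathbb C$, let $n\ge 0$ be an integer and $d=n+1$. **Graphs.** For $N\ge1$, $\mathrm{Gra}_d(N)$ is spanned by directed multigraphs (loops and multiple edges allowed) with vertices $1,\dots,N$ and totally ordered edges, modulo: reversing an edge gives the sign $(-1)^d$, permuting the edges by $\sigma$ gives the sign $\mathrm{sgn}(\sigma)^{d+1}$. $S_N$ acts by relabelling vertices; $\gamma\circ_1\gamma'$ inserts $\gamma'$ in place of the first vertex of $\gamma$ and sums over all ways of reattaching the half-edges of $\gamma$ at that vertex to vertices of $\gamma'$ (edges of $\gamma$ come first). The full graph complex $\mathsf{fGC}_d$ consists of families $(\gamma_{N,k})_{N\ge1,k\ge0}$ where $\gamma_{N,k}$ is a combination of graphs with $N$ vertices and $k$ edges satisfying $\mathrm{sgn}(\sigma)^d\,(\gamma_{N,k}|\sigma)=\gamma_{N,k}$ for $\sigma\in S_N$; a graph with $N$ vertices and $k$ edges has degree $d(N-1)-(d-1)k$. The pre-Lie product is $\gamma\circ\gamma'=\sum_\sigma \mathrm{sgn}(\sigma)^{d}(\gamma\circ_1\gamma'|\sigma)$, over the unshuffles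 $\sigma$ of type $(N',N-1)$; $[\cdot,\cdot]$ is its graded commutator and the differential is $\delta=[\bullet\!\!\to\!\!\bullet,\cdot\,]$. $H^0(\mathsf{fGC}_d)$ is the cohomology in degree $0$. **NP-manifolds.** An NP-manifold of degree $n$ in Darboux coordinates has coordinates $x^\mu$, $p_\mu$, $\psi^\alpha_{(i)}$, $\chi^{(i)}_\alpha$ ($1\le i<n/2$) and, for $n$ even, $\xi^a$, of degrees $0,n,i,n-i,n/2$; the coordinates of degree $0$ range over an open set $U$. Its functions are polynomials in the graded-commuting coordinates of positive degree with coefficients in $C^\infty(U,\mathbb K)$. The symplectic form is $dx^\mu dp_\mu+\sum_i d\psi^\alpha_{(i)}d\chi^{(i)}_\alpha+\tfrac12\kappa_{ab}d\xi^ad\xi^b$, with $\kappa$ constant, invertible and $\kappa_{ab}=-(-1)^{n/2}\kappa_{ba}$. The Poisson bracket, of degree $-n$, is $$\{f,g\}=\sum_{a,b}(-1)^{|f||b|}\,w^{ab}\,\partial_af\,\partial_bg ,$$ where the nonzero entries of $w$ are $w^{x^\mu p_\mu}=1$, $w^{p_\mu x^\mu}=-(-1)^n$, $w^{\psi\chi}=1$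 and $w^{\chi\psi}=-(-1)^{n+i(n-i)}$ for conjugate $\psi=\psi_{(i)}^\alpha,\chi=\chi^{(i)}_\alpha$, and $w^{\xi^a\xi^b}=(\kappa^{-1})_{ab}$. A Hamiltonian function is a function $H$ of degree $n+1$ with $\{H,H\}=0$; then $Q=\{H,\cdot\}$ is a differential and $H^\bullet(C^\infty|Q)$ denotes its cohomology on functions. **Representation and flows.** $\mathrm{Rep}^{(d)}_N(\gamma)(f_1\otimes\cdots\otimes f_N)$ is obtained by applying, for the edges $(i,j)$ of $\gamma$ in order, the operators $\Delta_{ij}=\sum_{a,b}w^{ab}\,\partial_a^{(i)}\partial_b^{(j)}$ to $f_1\otimes\cdots\otimes f_N$ (with Koszul signs; $\partial^{(i)}$ acts on the $i$-th factor; the operators compose as in $\Delta_{e_1}\cdots\Delta_{e_k}$), and then multiplying the factors. This is well defined on $\mathrm{Gra}_d(N)$. A Hamiltonian flow assigns to every Hamiltonian function $H$, on every NP-manifold of degree $n$ as above, a class in $H^{d}(C^\infty|Q)$. It is universal if there is one finite family of elements $g_{N,k}$ of $\mathrm{Gra}_d$ such that, for all NP-manifolds and all $H$, the function $\sum_{N,k}\mathrm{Rep}^{(d)}_N(g_{N,k})(H^{\otimes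 N})$ is a $Q$-cocycle of degree $d$ representing this class. Universal Hamiltonian flows form a vector space $\mathsf{Hflow}$. **Proposition.** (1) For all $N\ge1$, $k\ge0$ there is a linear map $\Phi_{N,k}:H^0(\mathsf{fGC}_d)\to\mathsf{Hflow}$ such that, for each degree-$0$ cocycle $\gamma$, each NP-manifold of degree $n$ and each Hamiltonian function $H$ on it, the function $$\dot H=\mathrm{Rep}^{(d)}_N(\gamma_{N,k})(H^{\otimes N})$$ has degree $d$, satisfies $\{H,\dot H\}=0$, and represents the class $\Phi_{N,k}([\gamma])(H)\in H^{d}(C^\infty|Q)$. Moreover there is a linear map $\Psi$ to $\mathsf{Hflow}$, defined on the subspace of $H^0(\mathsf{fGC}_d)$ formed by the classes of cocycles with only finitely many nonzero components, with $\Psi([\gamma])=\sum_{N,k}\Phi_{N,k}([\gamma])$ for each such cocycle $\gamma$, the sum being over the $(N,k)$ with $\gamma_{N,k}\ne0$. In particular, a cocycle $\gamma$ all of whose graphs have $N$ vertices and $k$ edges is sent to the flow $H\mapsto[\mathrm{Rep}^{(d)}_N(\gamma)(H^{\otimes N})]$. (2) For $n=1$ (so $d=2$) these are flows on Poisson bivectors: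 $\pi\mapsto\tfrac12\pi^{\mu\nu}p_\mu p_\nu$ is a bijection from bivector fields on $U$ to functions of degree $2$, and $\tfrac12\pi^{\mu\nu}p_\mu p_\nu$ is Hamiltonian if and only if $\pi$ is Poisson. For every degree-$0$ cocycle $\gamma$ of $\mathsf{fGC}_2$, all $N,k$, and every Poisson bivector $\pi$ with $H=\tfrac12\pi^{\mu\nu}p_\mu p_\nu$, one has $\mathrm{Rep}^{(2)}_N(\gamma_{N,k})(H^{\otimes N})=\tfrac12\dot\pi^{\mu\nu}p_\mu p_\nu$ for a bivector field $\dot\pi$ with $[\pi,\dot\pi]_{\mathrm S}=0$ (Schouten bracket). These are Kontsevich's flows; the tetrahedral flow is the one given by the tetrahedron graph. -/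

import Mathlib

noncomputable section

namespace NPGraph

/-! ### Graphs and the graph operad -/

/-- Labelled multidigraphs with `N` vertices and `k` directed edges (loops and multiple edges
allowed): the edge with label `e` goes from `(γ e).1` to `(γ e).2`. -/
abbrev Multidigraph (N k : ℕ) : Type := Fin k → Fin N × Fin N

/-- Flip the direction of the edge `e`. -/
def flipEdge {N k : ℕ} (e : Fin k) (γ : Multidigraph N k) : Multidigraph N k :=
  Function.update γ e (γ e).swap

/-- The sign of a permutation as a scalar. -/
def sgn (K : Type*) [Field K] {k : ℕ} (σ : Equiv.Perm (Fin k)) : K :=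
  ((Equiv.Perm.sign σ : ℤ) : K)

/-- The class of a graph in the vector space spanned by all graphs. -/
def gr (K : Type*) [Field K] {N k : ℕ} (γ : Multidigraph N k) : Multidigraph N k →₀ K :=
  Finsupp.single γ 1

/-- The relations imposed in `Gra_d(N)`: flipping an edge gives the sign `(-1)^d`, and permuting
the labels of the edges gives the sign `sgn(σ)^(d+1)`. -/
def graRel (K : Type*) [Field K] (d N k : ℕ) : Submodule K (Multidigraph N k →₀ K) :=
  Submodule.span K
    ({z | ∃ (e : Fin k) (γ : Multidigraph N k), z = gr K (flipEdge e γ) - (-1 : K) ^ d • gr K γ} ∪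
     {z | ∃ (σ : Equiv.Perm (Fin k)) (γ : Multidigraph N k),
        z = gr K (γ ∘ σ) - sgn K σ ^ (d + 1) • gr K γ})

/-- The part of `Gra_d(N)` spanned by graphs with `k` edges: the coinvariants of the span of the
graphs under `S_k ⋉ S_2^k`, twisted by `sgn_k` for `d` even and by `sgn_2^{⊗ k}` for `d` odd. -/
def Gra (K : Type*) [Field K] (d N k : ℕ) : Type _ :=
  (Multidigraph N k →₀ K) ⧸ graRel K d N k

instance (K : Type*) [Field K] (d N k : ℕ) : AddCommGroup (Gra K d N k) :=
  inferInstanceAs (AddCommGroup ((Multidigraph N k →₀ K) ⧸ graRel K d N k))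

instance (K : Type*) [Field K] (d N k : ℕ) : Module K (Gra K d N k) :=
  inferInstanceAs (Module K ((Multidigraph N k →₀ K) ⧸ graRel K d N k))

/-- The quotient map onto `Gra_d(N)`. -/
def Gra.proj (K : Type*) [Field K] (d N k : ℕ) : (Multidigraph N k →₀ K) →ₗ[K] Gra K d N k :=
  (graRel K d N k).mkQ

/-- The class of a graph in `Gra_d(N)`. -/
def Gra.mk (K : Type*) [Field K] (d : ℕ) {N k : ℕ} (γ : Multidigraph N k) : Gra K d N k :=
  Gra.proj K d N k (gr K γ)

theorem Gra.mk_flipEdge {K : Type*} [Field K] {d : ℕ} {N k : ℕ} (e : Fin k) (γ : Multidigraph N k) :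
    Gra.mk K d (flipEdge e γ) = (-1 : K) ^ d • Gra.mk K d γ := by
  unfold Gra.mk
  rw [← map_smul, ← sub_eq_zero, ← map_sub]
  exact (Submodule.Quotient.mk_eq_zero _).2 <| Submodule.subset_span (Or.inl ⟨e, γ, rfl⟩)

theorem Gra.mk_comp_perm {K : Type*} [Field K] {d : ℕ} {N k : ℕ} (σ : Equiv.Perm (Fin k)) (γ : Multidigraph N k) :
    Gra.mk K d (γ ∘ σ) = sgn K σ ^ (d + 1) • Gra.mk K d γ := by
  unfold Gra.mk
  rw [← map_smul, ← sub_eq_zero, ← map_sub]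
  exact (Submodule.Quotient.mk_eq_zero _).2 <| Submodule.subset_span (Or.inr ⟨σ, γ, rfl⟩)

/-- A linear map on the span of graphs descends to `Gra_d(N)` as soon as it is compatible with
flips and with permutations of edges. -/
theorem graRel_le_ker {K : Type*} [Field K] {d : ℕ} {N k : ℕ} {W : Type*} [AddCommGroup W] [Module K W]
    (f : (Multidigraph N k →₀ K) →ₗ[K] W)
    (h₁ : ∀ e γ, f (gr K (flipEdge e γ)) = (-1 : K) ^ d • f (gr K γ))
    (h₂ : ∀ (σ : Equiv.Perm (Fin k)) γ, f (gr K (γ ∘ σ)) = sgn K σ ^ (d + 1) • f (gr K γ)) :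
    graRel K d N k ≤ LinearMap.ker f := by
  refine Submodule.span_le.2 ?_
  rintro z (⟨e, γ, rfl⟩ | ⟨σ, γ, rfl⟩)
  · simp [h₁]
  · simp [h₂]

/-- Replace every vertex `v` by `π v`. -/
def mapVert {N N' k : ℕ} (π : Fin N → Fin N') (γ : Multidigraph N k) : Multidigraph N' k :=
  fun e => Prod.map π π (γ e)

theorem mapVert_flipEdge {N N' k : ℕ} (π : Fin N → Fin N') (e : Fin k) (γ : Multidigraph N k) :
    mapVert π (flipEdge e γ) = flipEdge e (mapVert π γ) := by
  funext i
  by_cases h : i = e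
  · subst h; simp [mapVert, flipEdge, Prod.map, Prod.swap]
  · simp [mapVert, flipEdge, h]

/-- The right action of `S_N` on `Gra_d(N)`: the vertex with label `v` gets the label `σ⁻¹ v`. -/
def relabel (K : Type*) [Field K] (d : ℕ) {N k : ℕ} (σ : Equiv.Perm (Fin N)) :
    Gra K d N k →ₗ[K] Gra K d N k :=
  (graRel K d N k).liftQ
    (Finsupp.linearCombination K fun γ : Multidigraph N k => Gra.mk K d (mapVert (⇑σ⁻¹) γ))
    (graRel_le_ker _
      (fun e γ => by simp [gr, mapVert_flipEdge, Gra.mk_flipEdge])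
      (fun τ γ => by
        have : mapVert (⇑σ⁻¹) (γ ∘ τ) = mapVert (⇑σ⁻¹) γ ∘ τ := rfl
        simp only [gr, Finsupp.linearCombination_single, one_smul, this, Gra.mk_comp_perm]))

/-- The map of vertex sets that collapses the first `N'` vertices to the first vertex and shifts
the others down accordingly. -/
def collapse {M N' L : ℕ} (h : N' + M = L) (v : Fin L) : Fin (M + 1) :=
  if hv : (v : ℕ) < N' then 0 else ⟨v - N' + 1, by have := v.2; omega⟩

/-- Put the edges of `G` first, then those of `G'`. -/
def appendEdges {L j k l : ℕ} (h : j + k = l) (G : Multidigraph L j) (G' : Multidigraph L k) :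
    Multidigraph L l :=
  Fin.append G G' ∘ Fin.cast h.symm

theorem appendEdges_flip_left {L j k l : ℕ} (h : j + k = l) (G : Multidigraph L j)
    (G' : Multidigraph L k) (e : Fin j) :
    appendEdges h (flipEdge e G) G' =
      flipEdge (Fin.cast h (Fin.castAdd k e)) (appendEdges h G G') := by
  subst h
  funext i
  refine Fin.addCases (fun a => ?_) (fun b => ?_) i
  · by_cases ha : a = e
    · subst ha; simp [appendEdges, flipEdge]
    · simp [appendEdges, flipEdge, ha]
  · have : Fin.natAdd j b ≠ Fin.castAdd k e := by
      intro hh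
      have := congrArg Fin.val hh
      simp at this; omega
    simp [appendEdges, flipEdge, this]

theorem appendEdges_flip_right {L j k l : ℕ} (h : j + k = l) (G : Multidigraph L j)
    (G' : Multidigraph L k) (e : Fin k) :
    appendEdges h G (flipEdge e G') =
      flipEdge (Fin.cast h (Fin.natAdd j e)) (appendEdges h G G') := by
  subst h
  funext i
  refine Fin.addCases (fun a => ?_) (fun b => ?_) i
  · have : Fin.castAdd k a ≠ Fin.natAdd j e := by
      intro hh
      have := congrArg Fin.val hh
      simp at this; omega
    simp [appendEdges, flipEdge, this]
  · by_cases hb : b = e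
    · subst hb; simp [appendEdges, flipEdge]
    · simp [appendEdges, flipEdge, hb]

theorem mk_appendEdges_perm {K : Type*} [Field K] {d : ℕ} {L j k l : ℕ} (h : j + k = l) (G : Multidigraph L j)
    (G' : Multidigraph L k) (σ : Equiv.Perm (Fin j)) (τ : Equiv.Perm (Fin k)) :
    Gra.mk K d (appendEdges h (G ∘ σ) (G' ∘ τ)) =
      (sgn K σ * sgn K τ) ^ (d + 1) • Gra.mk K d (appendEdges h G G') := by
  subst h
  have key : appendEdges rfl (G ∘ σ) (G' ∘ τ) =
      appendEdges rfl G G' ∘ (finSumFinEquiv.permCongr (Equiv.Perm.sumCongr σ τ)) := by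
    funext i
    refine Fin.addCases (fun a => ?_) (fun b => ?_) i
    · simp [appendEdges, Equiv.permCongr_apply]
    · simp [appendEdges, Equiv.permCongr_apply]
  rw [key, Gra.mk_comp_perm]
  congr 2
  simp [sgn]

/-- The partial composition `γ ∘₁ γ'` of graphs: insert `γ'` in place of the first vertex of `γ` and
sum over all ways of reconnecting the half-edges of `γ` at that vertex to vertices of `γ'`.  A way of
reconnecting is the same as a graph `G` with the edges of `γ` on the new vertex set that becomes `γ`
when the vertices of `γ'` are collapsed to one.  The vertices of `γ'` come first, then the remaining
vertices of `γ`; the edges of `γ` come before the edges of `γ'`. -/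
def insertGraph (K : Type*) [Field K] (d : ℕ) {M N' L j k l : ℕ} (h : N' + M = L) (hl : j + k = l)
    (γ : Multidigraph (M + 1) j) (γ' : Multidigraph N' k) : Gra K d L l :=
  ∑ G ∈ Finset.univ.filter (fun G : Multidigraph L j => mapVert (collapse h) G = γ),
    Gra.mk K d (appendEdges hl G (mapVert (Fin.castLE (by omega)) γ'))

theorem flipEdge_flipEdge {N k : ℕ} (e : Fin k) (γ : Multidigraph N k) :
    flipEdge e (flipEdge e γ) = γ := by
  simp [flipEdge]

theorem insertGraph_flip_left {K : Type*} [Field K] {d : ℕ} {M N' L j k l : ℕ} (h : N' + M = L) (hl : j + k = l)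
    (γ : Multidigraph (M + 1) j) (γ' : Multidigraph N' k) (e : Fin j) :
    insertGraph K d h hl (flipEdge e γ) γ' = (-1 : K) ^ d • insertGraph K d h hl γ γ' := by
  unfold insertGraph
  rw [Finset.smul_sum]
  refine Finset.sum_bij' (fun G _ => flipEdge e G) (fun G _ => flipEdge e G) ?_ ?_ ?_ ?_ ?_
  · intro G hG
    simp only [Finset.mem_filter, Finset.mem_univ, true_and] at hG ⊢
    rw [mapVert_flipEdge, hG, flipEdge_flipEdge]
  · intro G hG
    simp only [Finset.mem_filter, Finset.mem_univ, true_and] at hG ⊢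
    rw [mapVert_flipEdge, hG]
  · intro G _; exact flipEdge_flipEdge e G
  · intro G _; exact flipEdge_flipEdge e G
  · intro G _
    rw [appendEdges_flip_left, Gra.mk_flipEdge, smul_smul, ← mul_pow]
    simp

theorem insertGraph_flip_right {K : Type*} [Field K] {d : ℕ} {M N' L j k l : ℕ} (h : N' + M = L) (hl : j + k = l)
    (γ : Multidigraph (M + 1) j) (γ' : Multidigraph N' k) (e : Fin k) :
    insertGraph K d h hl γ (flipEdge e γ') = (-1 : K) ^ d • insertGraph K d h hl γ γ' := by
  unfold insertGraph
  rw [Finset.smul_sum]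
  refine Finset.sum_congr rfl fun G _ => ?_
  rw [mapVert_flipEdge, appendEdges_flip_right, Gra.mk_flipEdge]

theorem insertGraph_perm_left {K : Type*} [Field K] {d : ℕ} {M N' L j k l : ℕ} (h : N' + M = L) (hl : j + k = l)
    (γ : Multidigraph (M + 1) j) (γ' : Multidigraph N' k) (σ : Equiv.Perm (Fin j)) :
    insertGraph K d h hl (γ ∘ σ) γ' = sgn K σ ^ (d + 1) • insertGraph K d h hl γ γ' := by
  unfold insertGraph
  rw [Finset.smul_sum]
  refine Finset.sum_bij' (fun G _ => G ∘ ⇑σ⁻¹) (fun G _ => G ∘ ⇑σ) ?_ ?_ ?_ ?_ ?_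
  · intro G hG
    simp only [Finset.mem_filter, Finset.mem_univ, true_and] at hG ⊢
    have : mapVert (collapse h) (G ∘ ⇑σ⁻¹) = mapVert (collapse h) G ∘ ⇑σ⁻¹ := rfl
    rw [this, hG]
    funext i; simp
  · intro G hG
    simp only [Finset.mem_filter, Finset.mem_univ, true_and] at hG ⊢
    rw [← hG]; rfl
  · intro G _; funext i; simp
  · intro G _; funext i; simp
  · intro G _
    have := mk_appendEdges_perm (K := K) (d := d) hl (G ∘ ⇑σ⁻¹)
      (mapVert (Fin.castLE (by omega : N' ≤ L)) γ') σ 1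
    have e1 : (G ∘ ⇑σ⁻¹) ∘ ⇑σ = G := by funext i; simp
    rw [e1] at this
    simpa [sgn] using this

theorem insertGraph_perm_right {K : Type*} [Field K] {d : ℕ} {M N' L j k l : ℕ} (h : N' + M = L) (hl : j + k = l)
    (γ : Multidigraph (M + 1) j) (γ' : Multidigraph N' k) (σ : Equiv.Perm (Fin k)) :
    insertGraph K d h hl γ (γ' ∘ σ) = sgn K σ ^ (d + 1) • insertGraph K d h hl γ γ' := by
  unfold insertGraph
  rw [Finset.smul_sum]
  refine Finset.sum_congr rfl fun G _ => ?_
  have := mk_appendEdges_perm (K := K) (d := d) hl G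
      (mapVert (Fin.castLE (by omega : N' ≤ L)) γ') 1 σ
  have e1 : mapVert (Fin.castLE (by omega : N' ≤ L)) (γ' ∘ ⇑σ) =
      mapVert (Fin.castLE (by omega : N' ≤ L)) γ' ∘ ⇑σ := rfl
  rw [e1]
  simpa [sgn] using this

/-- The partial composition `∘₁ : Gra_d(M+1) ⊗ Gra_d(N') → Gra_d(M+N')`. -/
def insertFirst (K : Type*) [Field K] (d : ℕ) {M N' L j k l : ℕ} (h : N' + M = L) (hl : j + k = l) :
    Gra K d (M + 1) j →ₗ[K] Gra K d N' k →ₗ[K] Gra K d L l :=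
  LinearMap.liftQ₂ _ _
    (Finsupp.linearCombination K fun γ : Multidigraph (M + 1) j =>
      Finsupp.linearCombination K fun γ' : Multidigraph N' k => insertGraph K d h hl γ γ')
    (graRel_le_ker _
      (fun e γ => by
        refine Finsupp.lhom_ext' fun γ' => LinearMap.ext_ring ?_
        simp [gr, insertGraph_flip_left])
      (fun σ γ => by
        refine Finsupp.lhom_ext' fun γ' => LinearMap.ext_ring ?_
        simp [gr, insertGraph_perm_left]))
    (graRel_le_ker _
      (fun e γ' => by
        refine Finsupp.lhom_ext' fun γ => LinearMap.ext_ring ?_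
        simp [gr, insertGraph_flip_right])
      (fun σ γ' => by
        refine Finsupp.lhom_ext' fun γ => LinearMap.ext_ring ?_
        simp [gr, insertGraph_perm_right]))

/-! ### The full graph complex -/

/-- Unshuffles of type `(p, N - p)`: `σ⁻¹` is increasing on the first `p` labels and on the
remaining ones. -/
def IsUnshuffle (p : ℕ) {N : ℕ} (σ : Equiv.Perm (Fin N)) : Prop :=
  ∀ a b : Fin N, a < b → ((b : ℕ) < p ∨ p ≤ (a : ℕ)) → σ⁻¹ a < σ⁻¹ b

open Classical in
/-- The pre-Lie product `γ ∘ γ'` of an element with `M+1` vertices and one with `M'+1` vertices: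
the sum of `(-1)^{d|σ|} Σ(γ ∘₁ γ' | σ)` over the unshuffles `σ` of type `(M'+1, M)`. -/
def preLie (K : Type*) [Field K] (d : ℕ) {M M' P j k l : ℕ} (hP : M + M' = P) (hl : j + k = l) :
    Gra K d (M + 1) j →ₗ[K] Gra K d (M' + 1) k →ₗ[K] Gra K d (P + 1) l :=
  ∑ σ ∈ Finset.univ.filter (fun σ : Equiv.Perm (Fin (P + 1)) => IsUnshuffle (M' + 1) σ),
    sgn K σ ^ d •
      (insertFirst K d (show M' + 1 + M = P + 1 by omega) hl).compr₂ (relabel K d σ)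

/-- The degree in `fGC_d` of a graph with `M+1` vertices and `k` edges. -/
def graphDegree (d M k : ℕ) : ℤ := (d : ℤ) * M + k * (1 - (d : ℤ))

/-- The graded commutator of the pre-Lie product. -/
def graphBracket (K : Type*) [Field K] (d : ℕ) {M M' P j k l : ℕ} (hP : M + M' = P)
    (hl : j + k = l) :
    Gra K d (M + 1) j →ₗ[K] Gra K d (M' + 1) k →ₗ[K] Gra K d (P + 1) l :=
  preLie K d hP hl -
    (((graphDegree d M j * graphDegree d M' k).negOnePow : ℤ) : K) •
      (preLie K d (show M' + M = P by omega) (show k + j = l by omega)).flip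

/-- The graph with two vertices and a single edge from the first to the second. -/
def edgeGraph (K : Type*) [Field K] (d : ℕ) : Gra K d (1 + 1) 1 :=
  Gra.mk K d (fun _ => (0, 1))

/-- Families of elements of `Gra_d(N)`, `N ≥ 1`: the entry with index `M`, `k` is the component with
`M + 1` vertices and `k` edges. -/
abbrev GraphSeries (K : Type*) [Field K] (d : ℕ) : Type _ := ∀ M k : ℕ, Gra K d (M + 1) k

/-- The differential `δ = [edge, ·]`; it adds one vertex and one edge. -/
def graphDiff (K : Type*) [Field K] (d : ℕ) : GraphSeries K d →ₗ[K] GraphSeries K d where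
  toFun γ M k :=
    match M, k with
    | M + 1, k + 1 =>
        graphBracket K d (Nat.add_comm 1 M) (Nat.add_comm 1 k) (edgeGraph K d) (γ M k)
    | _, _ => 0
  map_add' γ γ' := by
    funext M k
    rcases M with _ | M <;> rcases k with _ | k <;> simp
  map_smul' c γ := by
    funext M k
    rcases M with _ | M <;> rcases k with _ | k <;> simp

/-- The homogeneous part of degree `m` of `fGC_d`: families of invariants for the action of `S_N`
(twisted by `sgn_N` for `d` odd) whose components are concentrated in degree `m`. -/
def fGC (K : Type*) [Field K] (d : ℕ) (m : ℤ) : Submodule K (GraphSeries K d) where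
  carrier := {γ | ∀ M k, (graphDegree d M k ≠ m → γ M k = 0) ∧
    ∀ σ : Equiv.Perm (Fin (M + 1)), sgn K σ ^ d • relabel K d σ (γ M k) = γ M k}
  add_mem' {γ γ'} h h' M k := by
    refine ⟨fun hm => by simp [(h M k).1 hm, (h' M k).1 hm], fun σ => ?_⟩
    rw [Pi.add_apply, Pi.add_apply, map_add, smul_add, (h M k).2 σ, (h' M k).2 σ]
  zero_mem' M k := by simp
  smul_mem' c γ h M k := by
    refine ⟨fun hm => by simp [(h M k).1 hm], fun σ => ?_⟩
    rw [Pi.smul_apply, Pi.smul_apply, map_smul, smul_comm, (h M k).2 σ]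

/-- Cocycles of degree `m` of the full graph complex. -/
def graphCocycles (K : Type*) [Field K] (d : ℕ) (m : ℤ) : Submodule K (GraphSeries K d) :=
  fGC K d m ⊓ LinearMap.ker (graphDiff K d)

/-- Coboundaries of degree `m` of the full graph complex. -/
def graphCoboundaries (K : Type*) [Field K] (d : ℕ) (m : ℤ) : Submodule K (GraphSeries K d) :=
  (fGC K d (m - 1)).map (graphDiff K d)

/-- The cohomology `H^m(fGC_d)`. -/
abbrev GraphCohomology (K : Type*) [Field K] (d : ℕ) (m : ℤ) : Type _ :=
  graphCocycles K d m ⧸ (graphCoboundaries K d m).submoduleOf (graphCocycles K d m)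

/-- The cohomology class of a cocycle. -/
def graphClass (K : Type*) [Field K] (d : ℕ) (m : ℤ) :
    graphCocycles K d m →ₗ[K] GraphCohomology K d m :=
  Submodule.mkQ _

/-- A family of graphs only finitely many of whose components are nonzero. -/
def IsFinite {K : Type*} [Field K] {d : ℕ} (γ : GraphSeries K d) : Prop :=
  {q : ℕ × ℕ | γ q.1 q.2 ≠ 0}.Finite

/-- The classes in `H^m(fGC_d)` of the cocycles that are finite sums of graphs, that is, of finite
sums of cocycles with a fixed number of vertices. -/
def finiteClasses (K : Type*) [Field K] (d : ℕ) (m : ℤ) : Submodule K (GraphCohomology K d m) where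
  carrier := {c | ∃ γ : graphCocycles K d m, IsFinite γ.1 ∧ graphClass K d m γ = c}
  add_mem' := by
    rintro _ _ ⟨γ, h, rfl⟩ ⟨γ', h', rfl⟩
    refine ⟨γ + γ', (h.union h').subset fun q hq => ?_, map_add _ _ _⟩
    by_contra hc
    simp only [Set.mem_union, Set.mem_ofPred_eq, not_or, not_not] at hc
    exact hq (by simp [hc.1, hc.2])
  zero_mem' := ⟨0, by simp [IsFinite], map_zero _⟩
  smul_mem' := by
    rintro c _ ⟨γ, h, rfl⟩
    refine ⟨c • γ, h.subset fun q hq => ?_, map_smul _ _ _⟩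
    intro hc
    exact hq (by simp [hc])

end NPGraph

namespace NPGraph

/-! ### Graded symplectic charts -/

/-- Darboux coordinates of degree `n`: `x^μ` and `p_μ` for `μ < m`; `ψ^α` and `χ_α` for
`α < r i`, one family for each `i` with `1 ≤ i` and `2 i < n` (the index `i : Fin ((n-1)/2)` stands
for the degree `i + 1`); `ξ^a` for `a < s`. -/
inductive Coord (n m : ℕ) (r : Fin ((n - 1) / 2) → ℕ) (s : ℕ) : Type
  | x (μ : Fin m)
  | p (μ : Fin m)
  | psi (i : Fin ((n - 1) / 2)) (α : Fin (r i))
  | chi (i : Fin ((n - 1) / 2)) (α : Fin (r i))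
  | xi (a : Fin s)
  deriving DecidableEq, Fintype

/-- The degrees of the coordinates: `0`, `n`, `i`, `n - i` and `n / 2`. -/
def Coord.deg {n m : ℕ} {r : Fin ((n - 1) / 2) → ℕ} {s : ℕ} : Coord n m r s → ℕ
  | .x _ => 0
  | .p _ => n
  | .psi i _ => (i : ℕ) + 1
  | .chi i _ => n - ((i : ℕ) + 1)
  | .xi _ => n / 2

/-- An `NP`-manifold of degree `n` in Darboux coordinates: numbers of coordinates of each kind, an
open set `U` in the space of coordinates of degree zero, and the constant matrix `κ_{ab}` of the form
`½ κ_{ab} dξ^a dξ^b`, where coordinates `ξ^a` only occur for `n` even. The symplectic form is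
`dx^μ dp_μ + Σ_i dψ^α dχ_α + ½ κ_{ab} dξ^a dξ^b`. -/
structure NPChart (𝕜 : Type*) [RCLike 𝕜] (n : ℕ) where
  m : ℕ
  r : Fin ((n - 1) / 2) → ℕ
  s : ℕ
  s_eq_zero : Odd n → s = 0
  κ : Matrix (Fin s) (Fin s) 𝕜
  isUnit_κ : IsUnit κ
  κ_symm : ∀ a b, κ a b = -(-1) ^ (n / 2) * κ b a
  U : Set ({c : Coord n m r s // c.deg = 0} → ℝ)
  isOpen_U : IsOpen U

namespace NPChart

variable {𝕜 : Type*} [RCLike 𝕜] {n : ℕ} (V : NPChart 𝕜 n)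

/-- The coordinates of the chart. -/
abbrev Ix : Type := Coord n V.m V.r V.s

/-- Coordinates of degree zero. -/
abbrev BodyIx : Type := {c : V.Ix // c.deg = 0}

/-- Coordinates of even positive degree. -/
abbrev EvenIx : Type := {c : V.Ix // c.deg ≠ 0 ∧ Even c.deg}

/-- Coordinates of odd degree. -/
abbrev OddIx : Type := {c : V.Ix // Odd c.deg}

/-- Extension by zero of a function on `U`. -/
def ext (f : V.U → 𝕜) : (V.BodyIx → ℝ) → 𝕜 := Function.extend Subtype.val f 0

theorem ext_apply (f : V.U → 𝕜) (x : V.U) : V.ext f x = f x :=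
  Subtype.val_injective.extend_apply _ _ _

/-- The algebra of smooth functions on `U`. -/
def Smooth : Subalgebra 𝕜 (V.U → 𝕜) where
  carrier := {f | ContDiffOn ℝ (⊤ : ℕ∞) (V.ext f) V.U}
  mul_mem' {f g} hf hg := by
    refine (ContDiffOn.mul hf hg).congr fun x hx => ?_
    have h := fun f => V.ext_apply f ⟨x, hx⟩
    simp only at h
    simp [h]
  add_mem' {f g} hf hg := by
    refine (ContDiffOn.add hf hg).congr fun x hx => ?_
    have h := fun f => V.ext_apply f ⟨x, hx⟩
    simp only at h
    simp [h]
  algebraMap_mem' c := by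
    refine (contDiffOn_const (c := c)).congr fun x hx => ?_
    have h := fun f => V.ext_apply f ⟨x, hx⟩
    simp only at h
    simp [h]

theorem contDiffOn_ext (f : V.Smooth) : ContDiffOn ℝ (⊤ : ℕ∞) (V.ext f.1) V.U := f.2

theorem differentiableAt_ext (f : V.Smooth) (x : V.U) : DifferentiableAt ℝ (V.ext f.1) x :=
  ((V.contDiffOn_ext f).differentiableOn (by simp)).differentiableAt (V.isOpen_U.mem_nhds x.2)

theorem ext_eventuallyEq (f : V.U → 𝕜) (F : (V.BodyIx → ℝ) → 𝕜) (h : ∀ y : V.U, f y = F y)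
    (x : V.U) : V.ext f =ᶠ[nhds (x : V.BodyIx → ℝ)] F := by
  filter_upwards [V.isOpen_U.mem_nhds x.2] with y hy
  rw [← h ⟨y, hy⟩]
  exact V.ext_apply f ⟨y, hy⟩

/-- The partial derivative of a smooth function on `U` along a coordinate of degree zero. -/
def pd (c : V.BodyIx) : V.Smooth →ₗ[𝕜] V.Smooth where
  toFun f := ⟨fun x => fderiv ℝ (V.ext f.1) x (Pi.single c 1), by
    have h1 : ContDiffOn ℝ (⊤ : ℕ∞) (fun x => fderiv ℝ (V.ext f.1) x (Pi.single c 1)) V.U :=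
      ((V.contDiffOn_ext f).fderiv_of_isOpen V.isOpen_U (by simp)).clm_apply contDiffOn_const
    exact h1.congr fun x hx => V.ext_apply _ ⟨x, hx⟩⟩
  map_add' f g := by
    ext x
    have h : V.ext (f + g).1 =ᶠ[nhds (x : V.BodyIx → ℝ)] V.ext f.1 + V.ext g.1 :=
      V.ext_eventuallyEq _ _ (fun y => by simp [V.ext_apply]) x
    simp only [h.fderiv_eq]
    rw [fderiv_add (V.differentiableAt_ext f x) (V.differentiableAt_ext g x)]
    rfl
  map_smul' c f := by
    ext x
    have h : V.ext (c • f).1 =ᶠ[nhds (x : V.BodyIx → ℝ)] c • V.ext f.1 :=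
      V.ext_eventuallyEq _ _ (fun y => by simp [V.ext_apply]) x
    simp only [h.fderiv_eq]
    rw [fderiv_const_smul (V.differentiableAt_ext f x)]
    rfl

theorem pd_comm (c c' : V.BodyIx) (f : V.Smooth) : V.pd c (V.pd c' f) = V.pd c' (V.pd c f) := by
  ext x
  have hx := V.isOpen_U.mem_nhds x.2
  have hf : ContDiffAt ℝ (⊤ : ℕ∞) (V.ext f.1) x := (V.contDiffOn_ext f).contDiffAt hx
  have hd : DifferentiableAt ℝ (fderiv ℝ (V.ext f.1)) x :=
    ((hf.fderiv_right (m := 1) (by norm_cast)).differentiableAt (by simp))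
  have key : ∀ a b : V.BodyIx, (V.pd a (V.pd b f)).1 x =
      fderiv ℝ (fderiv ℝ (V.ext f.1)) x (Pi.single a 1) (Pi.single b 1) := by
    intro a b
    have h : V.ext (V.pd b f).1 =ᶠ[nhds (x : V.BodyIx → ℝ)]
        fun y => fderiv ℝ (V.ext f.1) y (Pi.single b 1) :=
      V.ext_eventuallyEq (V.pd b f).1 (fun y => fderiv ℝ (V.ext f.1) y (Pi.single b 1))
        (fun y => rfl) x
    change fderiv ℝ (V.ext (V.pd b f).1) x (Pi.single a 1) = _
    rw [h.fderiv_eq, fderiv_clm_apply hd (differentiableAt_const _)]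
    simp
  rw [key, key]
  have hs : IsSymmSndFDerivAt ℝ (V.ext f.1) x :=
    hf.isSymmSndFDerivAt (by simpa using (by exact_mod_cast le_top : ((2 : ℕ∞) : WithTop ℕ∞) ≤ ((⊤ : ℕ∞) : WithTop ℕ∞)))
  exact hs _ _

open TensorProduct

/-- Polynomials in the coordinates of even positive degree with coefficients smooth functions of the
coordinates of degree zero. -/
def EvenFun : Type _ := V.Smooth ⊗[𝕜] MvPolynomial V.EvenIx 𝕜

instance : CommRing V.EvenFun := inferInstanceAs (CommRing (V.Smooth ⊗[𝕜] MvPolynomial V.EvenIx 𝕜))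

instance : Algebra 𝕜 V.EvenFun :=
  inferInstanceAs (Algebra 𝕜 (V.Smooth ⊗[𝕜] MvPolynomial V.EvenIx 𝕜))

/-- The exterior algebra generated by the coordinates of odd degree. -/
abbrev OddFun : Type _ := ExteriorAlgebra 𝕜 (V.OddIx →₀ 𝕜)

/-- The algebra of functions on the chart: polynomials in the coordinates of even positive degree and
in the anticommuting coordinates of odd degree, with coefficients smooth functions of the coordinates
of degree zero. -/
def Fun : Type _ := V.EvenFun ⊗[𝕜] V.OddFun

instance : Ring V.Fun := inferInstanceAs (Ring (V.EvenFun ⊗[𝕜] V.OddFun))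

instance : Algebra 𝕜 V.Fun := inferInstanceAs (Algebra 𝕜 (V.EvenFun ⊗[𝕜] V.OddFun))

/-- The function `a ω` for `a` in the even part and `ω` in the odd part. -/
def tmul (a : V.EvenFun) (ω : V.OddFun) : V.Fun := a ⊗ₜ[𝕜] ω

/-- The linear map `a ω ↦ φ(a) ω` for `φ` acting on the even part. -/
def onEven (φ : V.EvenFun →ₗ[𝕜] V.EvenFun) : V.Fun →ₗ[𝕜] V.Fun :=
  (TensorProduct.map φ LinearMap.id : V.EvenFun ⊗[𝕜] V.OddFun →ₗ[𝕜] V.EvenFun ⊗[𝕜] V.OddFun)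

/-- The linear map `a ω ↦ a φ(ω)` for `φ` acting on the odd part. -/
def onOdd (φ : V.OddFun →ₗ[𝕜] V.OddFun) : V.Fun →ₗ[𝕜] V.Fun :=
  (TensorProduct.map LinearMap.id φ : V.EvenFun ⊗[𝕜] V.OddFun →ₗ[𝕜] V.EvenFun ⊗[𝕜] V.OddFun)

/-- The odd coordinate `θ_c` as an element of the exterior algebra. -/
def theta (c : V.OddIx) : V.OddFun := ExteriorAlgebra.ι 𝕜 (Finsupp.single c 1)

/-- The function `f(x) y^e` of the even coordinates. -/
def evenMono (f : V.Smooth) (e : V.EvenIx →₀ ℕ) : V.EvenFun :=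
  f ⊗ₜ[𝕜] MvPolynomial.monomial e (1 : 𝕜)

/-- The monomial function `f(x) y^e θ_{c₁} ⋯ θ_{c_l}`. -/
def mono (f : V.Smooth) (e : V.EvenIx →₀ ℕ) (l : List V.OddIx) : V.Fun :=
  V.tmul (V.evenMono f e) (l.map V.theta).prod

/-- Homogeneous functions of degree `k`. -/
def homog (k : ℕ) : Submodule 𝕜 V.Fun :=
  Submodule.span 𝕜 {F | ∃ f e l, F = V.mono f e l ∧
    (e.sum fun c i => i * c.1.deg) + (l.map fun c => c.1.deg).sum = k}

/-- The derivative of an even function along a coordinate of degree zero. -/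
def evenPd (c : V.BodyIx) : V.EvenFun →ₗ[𝕜] V.EvenFun :=
  (TensorProduct.map (V.pd c) LinearMap.id :
    V.Smooth ⊗[𝕜] MvPolynomial V.EvenIx 𝕜 →ₗ[𝕜] V.Smooth ⊗[𝕜] MvPolynomial V.EvenIx 𝕜)

/-- The derivative of an even function along a coordinate of even positive degree. -/
def evenPderiv (c : V.EvenIx) : V.EvenFun →ₗ[𝕜] V.EvenFun :=
  (TensorProduct.map LinearMap.id (MvPolynomial.pderiv c).toLinearMap :
    V.Smooth ⊗[𝕜] MvPolynomial V.EvenIx 𝕜 →ₗ[𝕜] V.Smooth ⊗[𝕜] MvPolynomial V.EvenIx 𝕜)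

/-- The left derivative `∂/∂θ_c` of the exterior algebra: the antiderivation that is given on
coordinates by `θ_b ↦ δ_{cb}`. -/
def oddPd (c : V.OddIx) : V.OddFun →ₗ[𝕜] V.OddFun :=
  CliffordAlgebra.contractLeft (Q := (0 : QuadraticForm 𝕜 (V.OddIx →₀ 𝕜))) (Finsupp.lapply c)

/-- The (left) partial derivative along the coordinate `c`. -/
def deriv (c : V.Ix) : V.Fun →ₗ[𝕜] V.Fun :=
  if h₀ : c.deg = 0 then V.onEven (V.evenPd ⟨c, h₀⟩)
  else if h₁ : Even c.deg then V.onEven (V.evenPderiv ⟨c, h₀, h₁⟩)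
  else V.onOdd (V.oddPd ⟨c, Nat.not_even_iff_odd.1 h₁⟩)

/-- The sign operator `f ↦ (-1)^{|f|} f`. -/
def parity : V.Fun →ₗ[𝕜] V.Fun :=
  V.onOdd (CliffordAlgebra.involute (Q := (0 : QuadraticForm 𝕜 (V.OddIx →₀ 𝕜)))).toLinearMap

/-- The components of the Poisson bivector: the coefficient of `∂/∂a ⊗ ∂/∂b`. -/
def w : V.Ix → V.Ix → 𝕜
  | .x μ, .p ν => if μ = ν then 1 else 0
  | .p μ, .x ν => if μ = ν then (if Odd n then 1 else -1) else 0
  | .psi i α, .chi j β => if (⟨i, α⟩ : Σ i, Fin (V.r i)) = ⟨j, β⟩ then 1 else 0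
  | .chi i α, .psi j β => if (⟨i, α⟩ : Σ i, Fin (V.r i)) = ⟨j, β⟩ then
      (if Odd n then 1 else -(-1) ^ ((i : ℕ) + 1)) else 0
  | .xi a, .xi b => V.κ⁻¹ a b
  | _, _ => 0

/-- The Poisson bracket `{f, g}_ω = Σ (-1)^{|f| |b|} w^{ab} ∂_a f ∂_b g` of degree `-n`. -/
def bracket (f g : V.Fun) : V.Fun :=
  ∑ a, ∑ b, V.w a b • (V.deriv a ((V.parity ^ b.deg) f) * V.deriv b g)

/-- Hamiltonian functions: homogeneous functions of degree `n + 1` with `{H, H}_ω = 0`. -/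
def Ham : Set V.Fun := {H | H ∈ V.homog (n + 1) ∧ V.bracket H H = 0}

/-- The vector field `{H, ·}_ω`. -/
def ham (H : V.Fun) : V.Fun →ₗ[𝕜] V.Fun :=
  ∑ a, ∑ b, V.w a b •
    (LinearMap.mulLeft 𝕜 (V.deriv a ((V.parity ^ b.deg) H)) ∘ₗ V.deriv b)

theorem ham_apply (H f : V.Fun) : V.ham H f = V.bracket H f := by
  simp [ham, bracket, LinearMap.sum_apply]

/-- Cocycles of degree `k` for `Q = {H, ·}_ω`. -/
def cocycles (H : V.Fun) (k : ℕ) : Submodule 𝕜 V.Fun := V.homog k ⊓ LinearMap.ker (V.ham H)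

/-- Coboundaries of degree `k + 1` for `Q = {H, ·}_ω`. -/
def coboundaries (H : V.Fun) (k : ℕ) : Submodule 𝕜 V.Fun := (V.homog k).map (V.ham H)

/-- The cohomology of degree `k + 1` of the functions on the chart with respect to
`Q = {H, ·}_ω`. -/
abbrev Cohomology (H : V.Fun) (k : ℕ) : Type _ :=
  V.cocycles H (k + 1) ⧸ (V.coboundaries H k).submoduleOf (V.cocycles H (k + 1))

/-! ### The representation of the graph operad -/

/-- The `N`-fold tensor power of the algebra of functions. -/
abbrev TFun (N : ℕ) : Type _ := ⨂[𝕜] _ : Fin N, V.Fun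

/-- The derivative along `c` acting on the factor `i` of a tensor product, with the Koszul sign
`(-1)^{|c| |f_j|}` for each factor `f_j` that stands before. -/
def derivAt {N : ℕ} (c : V.Ix) (i : Fin N) : Module.End 𝕜 (V.TFun N) :=
  PiTensorProduct.map fun j =>
    if j < i then V.parity ^ c.deg else if j = i then V.deriv c else LinearMap.id

/-- The operator `Δ_{ij} = Σ w^{ab} ∂_a^{(i)} ∂_b^{(j)}` attached to an edge. -/
def Delta {N : ℕ} (i j : Fin N) : Module.End 𝕜 (V.TFun N) :=
  ∑ a, ∑ b, V.w a b • (V.derivAt a i * V.derivAt b j)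

/-- The action of a graph: apply the operators `Δ_{ij}` of its edges, in the order of the edges, then
multiply the factors. -/
def repGraph {N k : ℕ} (γ : Multidigraph N k) : V.TFun N →ₗ[𝕜] V.Fun :=
  PiTensorProduct.lift (MultilinearMap.mkPiAlgebraFin 𝕜 N V.Fun) ∘ₗ
    (List.ofFn fun e => V.Delta (γ e).1 (γ e).2).prod


section Relations

theorem onEven_mul (φ φ' : V.EvenFun →ₗ[𝕜] V.EvenFun) :
    V.onEven φ * V.onEven φ' = V.onEven (φ ∘ₗ φ') :=
  (TensorProduct.map_comp φ LinearMap.id φ' LinearMap.id).symm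

theorem onOdd_mul (φ φ' : V.OddFun →ₗ[𝕜] V.OddFun) :
    V.onOdd φ * V.onOdd φ' = V.onOdd (φ ∘ₗ φ') :=
  (TensorProduct.map_comp LinearMap.id φ LinearMap.id φ').symm

theorem onEven_onOdd (φ : V.EvenFun →ₗ[𝕜] V.EvenFun) (φ' : V.OddFun →ₗ[𝕜] V.OddFun) :
    V.onEven φ * V.onOdd φ' = V.onOdd φ' * V.onEven φ :=
  ((TensorProduct.map_comp φ LinearMap.id LinearMap.id φ').symm).trans
    (TensorProduct.map_comp LinearMap.id φ' φ LinearMap.id)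

theorem onOdd_neg (φ : V.OddFun →ₗ[𝕜] V.OddFun) : V.onOdd (-φ) = -V.onOdd φ :=
  LinearMap.lTensor_neg (M := V.EvenFun) (f := φ)

theorem evenPd_comm (c c' : V.BodyIx) : V.evenPd c ∘ₗ V.evenPd c' = V.evenPd c' ∘ₗ V.evenPd c := by
  have h : V.pd c ∘ₗ V.pd c' = V.pd c' ∘ₗ V.pd c := LinearMap.ext fun f => V.pd_comm c c' f
  refine ((TensorProduct.map_comp (V.pd c) LinearMap.id (V.pd c') LinearMap.id).symm).trans ?_
  rw [h]
  exact TensorProduct.map_comp _ _ _ _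

theorem evenPd_evenPderiv (c : V.BodyIx) (c' : V.EvenIx) :
    V.evenPd c ∘ₗ V.evenPderiv c' = V.evenPderiv c' ∘ₗ V.evenPd c :=
  ((TensorProduct.map_comp (V.pd c) LinearMap.id LinearMap.id
      (MvPolynomial.pderiv c').toLinearMap).symm).trans
    (TensorProduct.map_comp LinearMap.id (MvPolynomial.pderiv c').toLinearMap
      (V.pd c) LinearMap.id)

theorem evenPderiv_comm (c c' : V.EvenIx) :
    V.evenPderiv c ∘ₗ V.evenPderiv c' = V.evenPderiv c' ∘ₗ V.evenPderiv c := by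
  have h : (MvPolynomial.pderiv (R := 𝕜) c).toLinearMap ∘ₗ
      (MvPolynomial.pderiv (R := 𝕜) c').toLinearMap =
      (MvPolynomial.pderiv (R := 𝕜) c').toLinearMap ∘ₗ
        (MvPolynomial.pderiv (R := 𝕜) c).toLinearMap := by
    have h0 : ⁅MvPolynomial.pderiv (R := 𝕜) c, MvPolynomial.pderiv (R := 𝕜) c'⁆ = 0 := by
      refine MvPolynomial.derivation_ext fun i => ?_
      classical
      simp [Derivation.commutator_apply, MvPolynomial.pderiv_X, Pi.single_apply, apply_ite]
    refine LinearMap.ext fun f => ?_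
    have h1 := congrArg (fun D : Derivation 𝕜 (MvPolynomial V.EvenIx 𝕜) _ => D f) h0
    simpa [Derivation.commutator_apply, sub_eq_zero] using h1
  refine ((TensorProduct.map_comp (LinearMap.id : V.Smooth →ₗ[𝕜] V.Smooth)
    (MvPolynomial.pderiv (R := 𝕜) c).toLinearMap LinearMap.id
    (MvPolynomial.pderiv (R := 𝕜) c').toLinearMap).symm).trans ?_
  rw [h]
  exact TensorProduct.map_comp _ _ _ _

theorem oddPd_comm (c c' : V.OddIx) : V.oddPd c ∘ₗ V.oddPd c' = -(V.oddPd c' ∘ₗ V.oddPd c) :=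
  LinearMap.ext fun x => CliffordAlgebra.contractLeft_comm _ _ x

theorem deriv_mul (c c' : V.Ix) :
    V.deriv c * V.deriv c' = (-1 : 𝕜) ^ (c.deg * c'.deg) • (V.deriv c' * V.deriv c) := by
  unfold deriv
  by_cases h₀ : c.deg = 0 <;> by_cases h₀' : c'.deg = 0
  · simp [h₀, h₀', onEven_mul, evenPd_comm V ⟨c, h₀⟩ ⟨c', h₀'⟩]
  · by_cases h₁' : Even c'.deg
    · simp [h₀, h₀', h₁', onEven_mul, evenPd_evenPderiv]
    · simp [h₀, h₀', h₁', onEven_onOdd]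
  · by_cases h₁ : Even c.deg
    · simp [h₀, h₀', h₁, onEven_mul, evenPd_evenPderiv]
    · simp [h₀, h₀', h₁, onEven_onOdd]
  · by_cases h₁ : Even c.deg <;> by_cases h₁' : Even c'.deg
    · simp [h₀, h₀', h₁, h₁', onEven_mul, (h₁.mul_right _).neg_one_pow,
        evenPderiv_comm V ⟨c, h₀, h₁⟩ ⟨c', h₀', h₁'⟩]
    · simp [h₀, h₀', h₁, h₁', onEven_onOdd, (h₁.mul_right _).neg_one_pow]
    · simp [h₀, h₀', h₁, h₁', onEven_onOdd, (h₁'.mul_left _).neg_one_pow]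
    · have h2 : Odd (c.deg * c'.deg) :=
        (Nat.not_even_iff_odd.1 h₁).mul (Nat.not_even_iff_odd.1 h₁')
      simp only [h₀, h₀', h₁, h₁', dite_false, onOdd_mul, h2.neg_one_pow]
      rw [oddPd_comm, onOdd_neg]
      exact (neg_one_smul 𝕜 _).symm

theorem deriv_parity (c : V.Ix) :
    V.deriv c * V.parity = (-1 : 𝕜) ^ c.deg • (V.parity * V.deriv c) := by
  unfold deriv parity
  by_cases h₀ : c.deg = 0
  · simp [h₀, onEven_onOdd]
  by_cases h₁ : Even c.deg
  · simp [h₀, h₁, onEven_onOdd, h₁.neg_one_pow]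
  · have h2 := Nat.not_even_iff_odd.1 h₁
    simp only [h₀, h₁, dite_false, onOdd_mul, h2.neg_one_pow]
    have : V.oddPd ⟨c, h2⟩ ∘ₗ (CliffordAlgebra.involute
        (Q := (0 : QuadraticForm 𝕜 (V.OddIx →₀ 𝕜)))).toLinearMap =
        -((CliffordAlgebra.involute
          (Q := (0 : QuadraticForm 𝕜 (V.OddIx →₀ 𝕜)))).toLinearMap ∘ₗ V.oddPd ⟨c, h2⟩) := by
      refine LinearMap.ext fun x => ?_
      induction x using CliffordAlgebra.left_induction with
      | algebraMap r => simp [oddPd, CliffordAlgebra.contractLeft_algebraMap]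
      | add x y hx hy => simp only [map_add, hx, hy]
      | ι_mul x v hx =>
        simp only [LinearMap.comp_apply, AlgHom.toLinearMap_apply, LinearMap.neg_apply, oddPd,
          map_mul, CliffordAlgebra.involute_ι, CliffordAlgebra.contractLeft_ι_mul, neg_mul,
          map_neg, map_sub, map_smul] at hx ⊢
        rw [hx]
        simp
    rw [this, onOdd_neg]
    exact (neg_one_smul 𝕜 _).symm

theorem deriv_parity_pow (c : V.Ix) (k : ℕ) :
    V.deriv c * V.parity ^ k = (-1 : 𝕜) ^ (c.deg * k) • (V.parity ^ k * V.deriv c) := by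
  induction k with
  | zero => simp
  | succ k ih =>
    rw [pow_succ, ← mul_assoc, ih, smul_mul_assoc, mul_assoc, deriv_parity, mul_smul_comm, smul_smul,
      ← mul_assoc, Nat.mul_succ, pow_add]

/-- A tensor product of operators that agree up to a scalar in one factor. -/
theorem map_smul_single {N : ℕ} (g f : Fin N → (V.Fun →ₗ[𝕜] V.Fun)) (i : Fin N) (z : 𝕜)
    (h : ∀ j, g j = if j = i then z • f j else f j) :
    (PiTensorProduct.map g : Module.End 𝕜 (V.TFun N)) = z • PiTensorProduct.map f := by
  have hg : g = Function.update f i (z • f i) := by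
    funext j
    by_cases hj : j = i
    · subst hj; simp [h]
    · simp [h, hj]
  rw [hg, PiTensorProduct.map_update_smul, Function.update_eq_self]

theorem derivAt_mul {N : ℕ} (a b : V.Ix) (i j : Fin N) :
    V.derivAt a i * V.derivAt b j =
      (-1 : 𝕜) ^ (a.deg * b.deg) • (V.derivAt b j * V.derivAt a i) := by
  unfold derivAt
  rw [← PiTensorProduct.map_mul, ← PiTensorProduct.map_mul]
  rcases lt_trichotomy i j with hij | hij | hij
  · refine V.map_smul_single _ _ i _ fun l => ?_
    rcases lt_trichotomy l i with h | h | h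
    · simp [h, h.trans hij, h.ne, ← pow_add, add_comm]
    · subst h; simp [hij, deriv_parity_pow]
    · simp [h.not_gt, h.ne', Module.End.mul_eq_comp]
  · subst hij
    refine V.map_smul_single _ _ i _ fun l => ?_
    rcases lt_trichotomy l i with h | h | h
    · simp [h, h.ne, ← pow_add, add_comm]
    · subst h; simp only [lt_irrefl, if_true, if_false]; exact V.deriv_mul a b
    · simp [h.not_gt, h.ne', Module.End.mul_eq_comp]
  · refine V.map_smul_single _ _ j _ fun l => ?_
    rcases lt_trichotomy l j with h | h | h
    · simp [h, h.trans hij, h.ne, ← pow_add, add_comm]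
    · subst h
      simp only [hij, lt_irrefl, if_true, if_false]
      rw [deriv_parity_pow, smul_smul, mul_comm b.deg, ← mul_pow]
      simp
    · simp [h.not_gt, h.ne', Module.End.mul_eq_comp]

theorem w_deg (a b : V.Ix) (h : V.w a b ≠ 0) : a.deg + b.deg = n := by
  rcases a with μ | μ | ⟨i, α⟩ | ⟨i, α⟩ | a <;> rcases b with ν | ν | ⟨j, β⟩ | ⟨j, β⟩ | b <;>
    simp only [w, ne_eq, not_true_eq_false, ite_eq_right_iff, not_forall] at h <;>
    simp only [Coord.deg]
  · simp
  · simp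
  · obtain ⟨h, -⟩ := h
    have : i = j := congrArg Sigma.fst h
    subst this
    have := i.2
    omega
  · obtain ⟨h, -⟩ := h
    have : i = j := congrArg Sigma.fst h
    subst this
    have := i.2
    omega
  · have hn : ¬ Odd n := fun hn => by
      have := V.s_eq_zero hn
      have := a.2
      omega
    obtain ⟨k, hk⟩ := Nat.not_odd_iff_even.1 hn
    omega

theorem κ_inv_symm (a b : Fin V.s) : V.κ⁻¹ b a = -(-1) ^ (n / 2) * V.κ⁻¹ a b := by
  set z : 𝕜 := -(-1) ^ (n / 2) with hz
  have hzz : z * z = 1 := by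
    rw [hz, neg_mul_neg, ← mul_pow]; simp
  have hdet : IsUnit V.κ.det := (Matrix.isUnit_iff_isUnit_det _).1 V.isUnit_κ
  have h1 : V.κ.transpose = z • V.κ := by
    ext i j
    rw [Matrix.transpose_apply, V.κ_symm j i, Matrix.smul_apply, smul_eq_mul]
  have h2 : V.κ⁻¹.transpose = z • V.κ⁻¹ := by
    rw [Matrix.transpose_nonsing_inv, h1]
    refine Matrix.inv_eq_left_inv ?_
    rw [Matrix.smul_mul, Matrix.mul_smul, smul_smul, hzz, one_smul,
      Matrix.nonsing_inv_mul _ hdet]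
  have h3 := congrFun (congrFun h2 a) b
  simpa using h3

theorem w_symm (a b : V.Ix) : V.w b a * (-1) ^ (a.deg * b.deg) = (-1) ^ (n + 1) * V.w a b := by
  have e1 : ∀ {k : ℕ}, Even k → (-1 : 𝕜) ^ k = 1 := fun h => h.neg_one_pow
  have e2 : ∀ {k : ℕ}, Odd k → (-1 : 𝕜) ^ k = -1 := fun h => h.neg_one_pow
  rcases a with μ | μ | ⟨i, α⟩ | ⟨i, α⟩ | a <;> rcases b with ν | ν | ⟨j, β⟩ | ⟨j, β⟩ | b <;>
    simp only [w, Coord.deg, mul_zero, zero_mul]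
  · by_cases h : μ = ν
    · subst h
      rcases Nat.even_or_odd n with hn | hn
      · simp [Nat.not_odd_iff_even.2 hn, e2 hn.add_one]
      · simp [hn, e1 hn.add_one]
    · simp [h, Ne.symm h]
  · by_cases h : μ = ν
    · subst h
      rcases Nat.even_or_odd n with hn | hn
      · simp [Nat.not_odd_iff_even.2 hn, e2 hn.add_one]
      · simp [hn, e1 hn.add_one]
    · simp [h, Ne.symm h]
  · by_cases h : (⟨i, α⟩ : Σ i, Fin (V.r i)) = ⟨j, β⟩
    · obtain ⟨rfl, h'⟩ := Sigma.mk.inj_iff.1 h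
      obtain rfl := eq_of_heq h'
      have hi := i.2
      have hle : (i : ℕ) + 1 ≤ n := by omega
      rcases Nat.even_or_odd n with hn | hn
      · have hp : (-1 : 𝕜) ^ (((i : ℕ) + 1) * (n - ((i : ℕ) + 1))) = (-1) ^ ((i : ℕ) + 1) := by
          rcases Nat.even_or_odd ((i : ℕ) + 1) with h2 | h2
          · rw [e1 h2, e1 (h2.mul_right _)]
          · rw [e2 h2, e2 (h2.mul (Nat.Even.sub_odd hle hn h2))]
        rw [hp]
        simp only [if_true, Nat.not_odd_iff_even.2 hn, if_false, e2 hn.add_one, neg_mul, mul_one]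
        rw [← mul_pow]; simp
      · have hp : (-1 : 𝕜) ^ (((i : ℕ) + 1) * (n - ((i : ℕ) + 1))) = 1 := by
          rcases Nat.even_or_odd ((i : ℕ) + 1) with h2 | h2
          · rw [e1 (h2.mul_right _)]
          · rw [e1 ((Nat.Odd.sub_odd hn h2).mul_left _)]
        rw [hp]
        simp [hn, e1 hn.add_one]
    · rw [if_neg h, if_neg (Ne.symm h)]; simp
  · by_cases h : (⟨i, α⟩ : Σ i, Fin (V.r i)) = ⟨j, β⟩
    · obtain ⟨rfl, h'⟩ := Sigma.mk.inj_iff.1 h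
      obtain rfl := eq_of_heq h'
      have hi := i.2
      have hle : (i : ℕ) + 1 ≤ n := by omega
      rcases Nat.even_or_odd n with hn | hn
      · have hp : (-1 : 𝕜) ^ ((n - ((i : ℕ) + 1)) * ((i : ℕ) + 1)) = (-1) ^ ((i : ℕ) + 1) := by
          rcases Nat.even_or_odd ((i : ℕ) + 1) with h2 | h2
          · rw [e1 h2, e1 (h2.mul_left _)]
          · rw [e2 h2, e2 (Odd.mul (Nat.Even.sub_odd hle hn h2) h2)]
        rw [hp]
        simp [Nat.not_odd_iff_even.2 hn, e2 hn.add_one]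
      · have hp : (-1 : 𝕜) ^ ((n - ((i : ℕ) + 1)) * ((i : ℕ) + 1)) = 1 := by
          rcases Nat.even_or_odd ((i : ℕ) + 1) with h2 | h2
          · rw [e1 (h2.mul_left _)]
          · rw [e1 ((Nat.Odd.sub_odd hn h2).mul_right _)]
        rw [hp]
        simp [hn, e1 hn.add_one]
    · rw [if_neg h, if_neg (Ne.symm h)]; simp
  · have hn : Even n := Nat.not_odd_iff_even.1 fun hn => by
      have := V.s_eq_zero hn
      have := a.2
      omega
    rw [κ_inv_symm V a b, e2 hn.add_one]
    have hp : (-1 : 𝕜) ^ (n / 2 * (n / 2)) = (-1) ^ (n / 2) := by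
      rcases Nat.even_or_odd (n / 2) with h2 | h2
      · rw [e1 h2, e1 (h2.mul_right _)]
      · rw [e2 h2, e2 (h2.mul h2)]
    rw [hp, neg_mul, neg_mul, mul_right_comm, ← mul_pow]
    simp

theorem Delta_swap {N : ℕ} (i j : Fin N) :
    V.Delta j i = (-1 : 𝕜) ^ (n + 1) • V.Delta i j := by
  unfold Delta
  rw [Finset.smul_sum, Finset.sum_comm]
  refine Finset.sum_congr rfl fun a _ => ?_
  rw [Finset.smul_sum]
  refine Finset.sum_congr rfl fun b _ => ?_
  rw [V.derivAt_mul b a j i, smul_smul, smul_smul, mul_comm b.deg, w_symm]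

theorem Delta_comm {N : ℕ} (i j k l : Fin N) :
    V.Delta i j * V.Delta k l = (-1 : 𝕜) ^ n • (V.Delta k l * V.Delta i j) := by
  have key : ∀ a b c e : V.Ix,
      (V.w a b • (V.derivAt a i * V.derivAt b j)) * (V.w c e • (V.derivAt c k * V.derivAt e l)) =
      (-1 : 𝕜) ^ n • ((V.w c e • (V.derivAt c k * V.derivAt e l)) *
        (V.w a b • (V.derivAt a i * V.derivAt b j))) := by
    intro a b c e
    by_cases h1 : V.w a b = 0
    · simp [h1]
    by_cases h2 : V.w c e = 0
    · simp [h2]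
    have d1 := V.w_deg a b h1
    have d2 := V.w_deg c e h2
    have hs : (-1 : 𝕜) ^ n = (-1) ^ (b.deg * c.deg) * (-1) ^ (b.deg * e.deg) *
        ((-1) ^ (a.deg * c.deg) * (-1) ^ (a.deg * e.deg)) := by
      have e3 : b.deg * c.deg + b.deg * e.deg + (a.deg * c.deg + a.deg * e.deg) = n * n := by
        calc _ = (a.deg + b.deg) * (c.deg + e.deg) := by ring
          _ = n * n := by rw [d1, d2]
      rw [← pow_add, ← pow_add, ← pow_add, e3]
      rcases Nat.even_or_odd n with hn | hn
      · rw [hn.neg_one_pow, (hn.mul_right _).neg_one_pow]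
      · rw [hn.neg_one_pow, (hn.mul hn).neg_one_pow]
    have hm : (V.derivAt a i * V.derivAt b j) * (V.derivAt c k * V.derivAt e l) =
        (-1 : 𝕜) ^ n • ((V.derivAt c k * V.derivAt e l) * (V.derivAt a i * V.derivAt b j)) := by
      calc (V.derivAt a i * V.derivAt b j) * (V.derivAt c k * V.derivAt e l)
          = V.derivAt a i * (V.derivAt b j * V.derivAt c k) * V.derivAt e l := by
            simp only [mul_assoc]
        _ = (-1 : 𝕜) ^ (b.deg * c.deg) •
            ((V.derivAt a i * V.derivAt c k) * (V.derivAt b j * V.derivAt e l)) := by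
            rw [V.derivAt_mul b c]
            simp only [mul_assoc, mul_smul_comm, smul_mul_assoc]
        _ = ((-1 : 𝕜) ^ (b.deg * c.deg) * (-1) ^ (b.deg * e.deg) * (-1) ^ (a.deg * c.deg)) •
            (V.derivAt c k * (V.derivAt a i * V.derivAt e l) * V.derivAt b j) := by
            rw [V.derivAt_mul b e, V.derivAt_mul a c]
            simp only [mul_assoc, mul_smul_comm, smul_mul_assoc, smul_smul]
        _ = _ := by
            rw [V.derivAt_mul a e, hs]
            simp only [mul_assoc, mul_smul_comm, smul_mul_assoc, smul_smul]
    rw [smul_mul_smul_comm, hm, smul_mul_smul_comm, smul_smul, smul_smul, mul_comm (V.w c e)]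
    congr 1
    ring
  have hD : ∀ i j : Fin N, V.Delta i j =
      ∑ c : V.Ix × V.Ix, V.w c.1 c.2 • (V.derivAt c.1 i * V.derivAt c.2 j) := fun i j => by
    rw [Delta, Fintype.sum_prod_type]
  rw [hD, hD, Finset.sum_mul_sum, Finset.sum_mul_sum, Finset.sum_comm, Finset.smul_sum]
  refine Finset.sum_congr rfl fun c _ => ?_
  rw [Finset.smul_sum]
  exact Finset.sum_congr rfl fun a _ => key _ _ _ _

theorem prod_ofFn_swap {E : Type*} [Ring E] [Algebra 𝕜 E] (z : 𝕜) {k : ℕ} (i : Fin k)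
    (f : Fin (k + 1) → E) (hf : ∀ a b, f a * f b = z • (f b * f a)) :
    (List.ofFn (f ∘ Equiv.swap i.castSucc i.succ)).prod = z • (List.ofFn f).prod := by
  induction k with
  | zero => exact i.elim0
  | succ k ih =>
    refine Fin.cases ?_ (fun i => ?_) i
    · have e : ∀ l : Fin k, Equiv.swap (0 : Fin (k + 2)) 1 l.succ.succ = l.succ.succ := fun l =>
        Equiv.swap_apply_of_ne_of_ne (Fin.succ_ne_zero _) (by
          rw [← Fin.succ_zero_eq_one, Ne, Fin.succ_inj]; exact Fin.succ_ne_zero _)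
      simp only [List.ofFn_succ, List.prod_cons, Function.comp_apply, Fin.castSucc_zero,
        Fin.succ_zero_eq_one, Equiv.swap_apply_left, Equiv.swap_apply_right, e]
      rw [← mul_assoc, hf 1 0, smul_mul_assoc, mul_assoc]
    · have e : ∀ l : Fin (k + 1), Equiv.swap i.succ.castSucc i.succ.succ l.succ =
          (Equiv.swap i.castSucc i.succ l).succ := fun l => by
        rw [← Fin.succ_castSucc]
        exact (Fin.succ_injective _).swap_apply _ _ _
      have e0 : Equiv.swap i.succ.castSucc i.succ.succ 0 = 0 :=
        Equiv.swap_apply_of_ne_of_ne (by rw [← Fin.succ_castSucc]; exact (Fin.succ_ne_zero _).symm)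
          (Fin.succ_ne_zero _).symm
      have := ih i (fun l => f l.succ) (fun a b => hf _ _)
      rw [List.ofFn_succ, List.ofFn_succ (f := f), List.prod_cons, List.prod_cons, ← mul_smul_comm,
        ← this]
      simp only [Function.comp_def, e, e0]

/-- A product of operators that commute up to a common sign, in a permuted order. -/
theorem prod_ofFn_perm {E : Type*} [Ring E] [Algebra 𝕜 E] (q : ℕ) {k : ℕ}
    (σ : Equiv.Perm (Fin k)) (f : Fin k → E)
    (hf : ∀ a b, f a * f b = (-1 : 𝕜) ^ q • (f b * f a)) :
    (List.ofFn (f ∘ σ)).prod = sgn 𝕜 σ ^ q • (List.ofFn f).prod := by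
  rcases k with _ | k
  · simp [sgn, Subsingleton.elim σ 1]
  have hσ : σ ∈ Submonoid.closure
      (Set.range fun i : Fin k => Equiv.swap i.castSucc i.succ) := by
    rw [Equiv.Perm.mclosure_swap_castSucc_succ]; trivial
  induction hσ using Submonoid.closure_induction generalizing f with
  | mem τ h =>
    obtain ⟨i, rfl⟩ := h
    simp only
    rw [prod_ofFn_swap _ i f hf]
    have : sgn 𝕜 (Equiv.swap i.castSucc i.succ) = -1 := by
      simp [sgn, Equiv.Perm.sign_swap (Fin.castSucc_lt_succ (i := i)).ne]
    rw [this]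
  | one => simp [sgn]
  | mul τ τ' _ _ h h' =>
    have e : f ∘ ⇑(τ * τ') = (f ∘ τ) ∘ τ' := rfl
    rw [e, h' (f ∘ τ) (fun a b => hf _ _), h f hf, smul_smul, ← mul_pow]
    simp [sgn, mul_comm]

theorem repGraph_comp_perm {N k : ℕ} (σ : Equiv.Perm (Fin k)) (γ : Multidigraph N k) :
    V.repGraph (γ ∘ σ) = sgn 𝕜 σ ^ (n + 1 + 1) • V.repGraph γ := by
  have h := prod_ofFn_perm (𝕜 := 𝕜) n σ (fun e => V.Delta (γ e).1 (γ e).2)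
    (fun a b => V.Delta_comm _ _ _ _)
  have hs : sgn 𝕜 σ ^ (n + 1 + 1) = sgn 𝕜 σ ^ n := by
    rcases Int.units_eq_one_or (Equiv.Perm.sign σ) with h | h <;> simp [sgn, h, pow_succ]
  unfold repGraph
  rw [hs, ← LinearMap.comp_smul, ← h]
  rfl

theorem prod_ofFn_update {E : Type*} [Ring E] [Algebra 𝕜 E] (z : 𝕜) {k : ℕ} (e : Fin k)
    (f g : Fin k → E) (h : ∀ i, g i = if i = e then z • f i else f i) :
    (List.ofFn g).prod = z • (List.ofFn f).prod := by
  induction k with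
  | zero => exact e.elim0
  | succ k ih =>
    rw [List.ofFn_succ, List.ofFn_succ (f := f), List.prod_cons, List.prod_cons]
    revert h
    refine Fin.cases (fun h => ?_) (fun e h => ?_) e
    · have h0 : g 0 = z • f 0 := by simpa using h 0
      have h1 : ∀ i : Fin k, g i.succ = f i.succ := fun i => by
        rw [h, if_neg (Fin.succ_ne_zero i)]
      simp only [h0, h1, smul_mul_assoc]
    · have h0 : g 0 = f 0 := by rw [h, if_neg (Fin.succ_ne_zero e).symm]
      rw [h0, ih e (fun i => f i.succ) (fun i => g i.succ) (fun i => by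
        rw [h]; simp only [Fin.succ_inj]), mul_smul_comm]

theorem repGraph_flipEdge {N k : ℕ} (e : Fin k) (γ : Multidigraph N k) :
    V.repGraph (flipEdge e γ) = (-1 : 𝕜) ^ (n + 1) • V.repGraph γ := by
  unfold repGraph
  rw [← LinearMap.comp_smul]
  congr 1
  refine prod_ofFn_update _ e _ _ fun i => ?_
  by_cases hi : i = e
  · subst hi
    simp only [flipEdge, Function.update_self, Prod.fst_swap, Prod.snd_swap, if_true]
    exact V.Delta_swap _ _
  · simp [flipEdge, hi]

end Relations

/-- The representation `Rep_N` of the graph operad `Gra_d`, `d = n + 1`, on the functions of the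
chart. -/
def Rep {N k : ℕ} : Gra 𝕜 (n + 1) N k →ₗ[𝕜] (V.TFun N →ₗ[𝕜] V.Fun) :=
  (graRel 𝕜 (n + 1) N k).liftQ
    (Finsupp.linearCombination 𝕜 fun γ : Multidigraph N k => V.repGraph γ)
    (graRel_le_ker _
      (fun e γ => by
        simp only [gr, Finsupp.linearCombination_single, one_smul]
        exact V.repGraph_flipEdge e γ)
      (fun σ γ => by
        simp only [gr, Finsupp.linearCombination_single, one_smul]
        exact V.repGraph_comp_perm σ γ))

/-- The element `Rep_N(γ)(f ⊗ ⋯ ⊗ f)`. -/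
def flowAt {N k : ℕ} (γ : Gra 𝕜 (n + 1) N k) (f : V.Fun) : V.Fun :=
  V.Rep γ (PiTensorProduct.tprod 𝕜 fun _ : Fin N => f)

/-- The element `Σ Rep_N(g_N)(f ⊗ ⋯ ⊗ f)` for a finite sum of graphs `g`; the entry with index
`(M, k)` of `g` is its component with `M + 1` vertices and `k` edges. -/
def evalFormula (f : V.Fun) :
    (DirectSum (ℕ × ℕ) fun q => Gra 𝕜 (n + 1) (q.1 + 1) q.2) →ₗ[𝕜] V.Fun :=
  DirectSum.toModule 𝕜 (ℕ × ℕ) V.Fun fun q =>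
    LinearMap.applyₗ (PiTensorProduct.tprod 𝕜 fun _ : Fin (q.1 + 1) => f) ∘ₗ V.Rep

/-- The class of a cocycle in the cohomology of `Q = {H, ·}_ω`. -/
def cohClass (H : V.Fun) (k : ℕ) : V.cocycles H (k + 1) →ₗ[𝕜] V.Cohomology H k :=
  Submodule.mkQ _

end NPChart

/-! ### Hamiltonian flows -/

/-- Hamiltonian flows on all charts of degree `n`: maps sending a Hamiltonian function `H` to a class
of degree `n + 1` in the cohomology of `Q = {H, ·}_ω`. -/
abbrev Flow (𝕜 : Type*) [RCLike 𝕜] (n : ℕ) : Type _ :=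
  ∀ (V : NPChart 𝕜 n) (H : V.Ham), V.Cohomology H.1 n

/-- Universal Hamiltonian flows: those given, on all charts at once, by one and the same formula
`H ↦ Σ Rep_N(g_N)(H ⊗ ⋯ ⊗ H)` for a finite sum `g` of elements of the graph operad `Gra_{n+1}`. -/
def HFlow (𝕜 : Type*) [RCLike 𝕜] (n : ℕ) : Submodule 𝕜 (Flow 𝕜 n) where
  carrier := {F | ∃ g : DirectSum (ℕ × ℕ) fun q => Gra 𝕜 (n + 1) (q.1 + 1) q.2,
    ∀ (V : NPChart 𝕜 n) (H : V.Ham), ∃ hc : V.evalFormula H.1 g ∈ V.cocycles H.1 (n + 1),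
      F V H = V.cohClass H.1 n ⟨V.evalFormula H.1 g, hc⟩}
  add_mem' := by
    rintro F F' ⟨g, hg⟩ ⟨g', hg'⟩
    refine ⟨g + g', fun V H => ?_⟩
    obtain ⟨hc, e⟩ := hg V H
    obtain ⟨hc', e'⟩ := hg' V H
    have h : V.evalFormula H.1 (g + g') = V.evalFormula H.1 g + V.evalFormula H.1 g' := map_add _ _ _
    refine ⟨h ▸ add_mem hc hc', ?_⟩
    rw [Pi.add_apply, Pi.add_apply, e, e', ← map_add]
    congr 1
    exact Subtype.ext h.symm
  zero_mem' := by
    refine ⟨0, fun V H => ?_⟩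
    have h : V.evalFormula H.1 0 = 0 := map_zero _
    refine ⟨h ▸ zero_mem _, ?_⟩
    rw [Pi.zero_apply, Pi.zero_apply, ← map_zero (V.cohClass H.1 n)]
    congr 1
  smul_mem' := by
    rintro z F ⟨g, hg⟩
    refine ⟨z • g, fun V H => ?_⟩
    obtain ⟨hc, e⟩ := hg V H
    have h : V.evalFormula H.1 (z • g) = z • V.evalFormula H.1 g := map_smul _ _ _
    refine ⟨h ▸ Submodule.smul_mem _ z hc, ?_⟩
    rw [Pi.smul_apply, Pi.smul_apply, e, ← map_smul]
    congr 1
    exact Subtype.ext h.symm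

/-! ### Bivector fields and functions of degree two on charts of degree one -/

section Bivector

variable {𝕜 : Type*} [RCLike 𝕜] (V : NPChart 𝕜 1)

/-- Bivector fields on `U`: antisymmetric matrices of smooth functions. -/
def IsBivector (π : Fin V.m → Fin V.m → V.Smooth) : Prop := ∀ μ ν, π ν μ = -π μ ν

/-- The function `½ π^{μν} p_μ p_ν`. -/
def bivectorFun (π : Fin V.m → Fin V.m → V.Smooth) : V.Fun :=
  (1 / 2 : 𝕜) • ∑ μ, ∑ ν, V.mono (π μ ν) 0 [⟨.p μ, odd_one⟩, ⟨.p ν, odd_one⟩]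

/-- The partial derivative `∂/∂x^ρ`. -/
def dx (ρ : Fin V.m) : V.Smooth →ₗ[𝕜] V.Smooth := V.pd ⟨.x ρ, rfl⟩

/-- The term `Σ_ρ (π^{ρλ} ∂_ρ π'^{μν} + π'^{ρλ} ∂_ρ π^{μν})`. -/
def schoutenTerm (π π' : Fin V.m → Fin V.m → V.Smooth) (l μ ν : Fin V.m) : V.Smooth :=
  ∑ ρ, (π ρ l * dx V ρ (π' μ ν) + π' ρ l * dx V ρ (π μ ν))

/-- The components of the Schouten bracket of two bivector fields (up to normalisation). -/
def schouten (π π' : Fin V.m → Fin V.m → V.Smooth) (l μ ν : Fin V.m) : V.Smooth :=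
  schoutenTerm V π π' l μ ν + schoutenTerm V π π' μ ν l + schoutenTerm V π π' ν l μ

/-- Poisson bivector fields: bivector fields with vanishing Schouten square, that is, the Jacobi
identity. -/
def IsPoisson (π : Fin V.m → Fin V.m → V.Smooth) : Prop :=
  IsBivector V π ∧ ∀ l μ ν, schouten V π π l μ ν = 0

end Bivector

end NPGraph

end

noncomputable section

/-!
`Rep` turns the insertion of graphs into the insertion of functions: the operators `Δ` are built
from derivations, so by the Leibniz rule applying the edges of `g` to a product is the same as
summing over all reattachments of their half-edges. Braids of tensor factors, that is, swaps
with their Koszul sign, commute with `Δ` and with the multiplication of the factors; since `H` has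
degree `n + 1 = d`, relabelling the vertices of `g` multiplies the flow of `g` at `H` by `sgn ^ d`.
Hence, in the flow of `[•→•, γ]` at `H`, the terms that insert the edge into `γ` contain the factor
`{H, H} = 0`, and the others add up to a nonzero multiple of `{H, γ(H)}`. So graph cocycles give
cocycles of `Q = {H, ·}` and graph coboundaries give coboundaries. In degree one, the bracket of two
functions of degree two is the cubic polynomial in `p` whose coefficients are the components of the
Schouten bracket.
-/

namespace NPGraph

/-! ### Twisted derivations and graded commutativity -/

section Twisted

open TensorProduct

variable {R A B : Type*} [CommRing R] [Ring A] [Algebra R A] [Ring B] [Algebra R B]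

/-- Derivations of an algebra twisted by `s`: `D (a b) = D a b + s(a) D b`.  Derivations are the
case `s = 1`, antiderivations the case where `s` is a grading automorphism. -/
def IsTwistedDerivation (s D : Module.End R A) : Prop :=
  ∀ a b, D (a * b) = D a * b + s a * D b

theorem IsTwistedDerivation.map_one {s D : Module.End R A} (hD : IsTwistedDerivation s D)
    (hs : s 1 = 1) : D 1 = 0 := by
  simpa [hs] using hD 1 1

theorem IsTwistedDerivation.rTensor {s D : Module.End R A} (hD : IsTwistedDerivation s D) :
    IsTwistedDerivation (A := A ⊗[R] B) (s.rTensor B) (D.rTensor B) := by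
  intro x y
  induction x with
  | zero => simp
  | add x x' hx hx' => simp only [add_mul, map_add, hx, hx']; abel
  | tmul a b =>
    induction y with
    | zero => simp
    | add y y' hy hy' => simp only [mul_add, map_add, hy, hy']; abel
    | tmul a' b' => simp [hD a a', TensorProduct.add_tmul]

theorem IsTwistedDerivation.lTensor {s D : Module.End R B} (hD : IsTwistedDerivation s D) :
    IsTwistedDerivation (A := A ⊗[R] B) (s.lTensor A) (D.lTensor A) := by
  intro x y
  induction x with
  | zero => simp
  | add x x' hx hx' => simp only [add_mul, map_add, hx, hx']; abel
  | tmul a b =>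
    induction y with
    | zero => simp
    | add y y' hy hy' => simp only [mul_add, map_add, hy, hy']; abel
    | tmul a' b' => simp [hD b b', TensorProduct.tmul_add]

/-- Graded commutativity of an algebra with grading automorphism `s`.  On homogeneous elements of
parities `p` and `q` the identity says `2 a b = 2 (-1)^{pq} b a`. -/
def IsGradedCommutative (s : Module.End R A) : Prop :=
  ∀ a b, a * b + a * b = (b + s b) * a + (b - s b) * s a

theorem IsGradedCommutative.lTensor {A : Type*} [CommRing A] [Algebra R A] {s : Module.End R B}
    (hs : IsGradedCommutative s) : IsGradedCommutative (A := A ⊗[R] B) (s.lTensor A) := by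
  intro x y
  induction x with
  | zero => simp
  | add x x' hx hx' =>
    rw [add_mul, add_add_add_comm, hx, hx', map_add, mul_add, mul_add]
    abel
  | tmul a b =>
    induction y with
    | zero => simp
    | add y y' hy hy' =>
      rw [mul_add, add_add_add_comm, hy, hy', map_add, add_sub_add_comm,
        add_add_add_comm y y' (s.lTensor A y), add_mul (y + _), add_mul (y - _)]
      abel
    | tmul a' b' =>
      simp only [LinearMap.lTensor_tmul, ← TensorProduct.tmul_add, ← TensorProduct.tmul_sub,
        Algebra.TensorProduct.tmul_mul_tmul, hs b b', mul_comm a a']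

end Twisted

section Clifford

open CliffordAlgebra

variable {R M : Type*} [CommRing R] [AddCommGroup M] [Module R M]

theorem isTwistedDerivation_contractLeft {Q : QuadraticForm R M} (d : Module.Dual R M) :
    IsTwistedDerivation (involute (Q := Q)).toLinearMap (contractLeft (Q := Q) d) := by
  intro x y
  induction x using left_induction with
  | algebraMap r => simp [contractLeft_algebraMap_mul, contractLeft_algebraMap]
  | add x x' hx hx' => simp only [add_mul, map_add, hx, hx']; abel
  | ι_mul x v hx =>
    simp only [AlgHom.toLinearMap_apply] at hx ⊢
    rw [mul_assoc, contractLeft_ι_mul, hx, contractLeft_ι_mul, map_mul, involute_ι, mul_add,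
      sub_mul, smul_mul_assoc]
    simp only [mul_assoc, neg_mul]
    abel

theorem ι_mul_eq_involute_mul_ι (v : M) (x : ExteriorAlgebra R M) :
    ExteriorAlgebra.ι R v * x =
      involute (Q := (0 : QuadraticForm R M)) x * ExteriorAlgebra.ι R v := by
  induction x using left_induction with
  | algebraMap r => simp only [AlgHom.commutes, ← Algebra.commutes r]
  | add x y hx hy => simp only [mul_add, map_add, add_mul, hx, hy]
  | ι_mul x u hx =>
    have anticomm : ExteriorAlgebra.ι R v * ExteriorAlgebra.ι R u =
        -(ExteriorAlgebra.ι R u * ExteriorAlgebra.ι R v) :=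
      eq_neg_of_add_eq_zero_left (ExteriorAlgebra.ι_add_mul_swap v u)
    rw [map_mul, involute_ι, ← mul_assoc, anticomm, neg_mul, mul_assoc, hx, neg_mul, neg_mul,
      mul_assoc]

theorem isGradedCommutative_involute :
    IsGradedCommutative (involute (Q := (0 : QuadraticForm R M))).toLinearMap := by
  intro x y
  induction x using left_induction generalizing y with
  | algebraMap r =>
    simp only [AlgHom.toLinearMap_apply, AlgHom.commutes, ← Algebra.commutes r, ← mul_add]
    rw [add_add_sub_cancel]
  | add x x' hx hx' =>
    rw [add_mul, add_add_add_comm, hx, hx', map_add, mul_add, mul_add]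
    abel
  | ι_mul x v hx =>
    simp only [AlgHom.toLinearMap_apply] at hx ⊢
    rw [map_mul, involute_ι, mul_assoc, ← mul_add, hx, mul_add, ← mul_assoc,
      ι_mul_eq_involute_mul_ι, ← mul_assoc, ι_mul_eq_involute_mul_ι v (y - _), map_add, map_sub,
      involute_involute]
    noncomm_ring

end Clifford

namespace NPChart

/-! ### The algebra of functions -/

variable {𝕜 : Type*} [RCLike 𝕜] {n : ℕ} (V : NPChart 𝕜 n)

open TensorProduct

theorem tmul_mul_tmul (a b : V.EvenFun) (ω η : V.OddFun) :
    V.tmul a ω * V.tmul b η = V.tmul (a * b) (ω * η) :=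
  Algebra.TensorProduct.tmul_mul_tmul _ _ _ _

theorem tmul_sub (a : V.EvenFun) (ω η : V.OddFun) :
    V.tmul a (ω - η) = V.tmul a ω - V.tmul a η :=
  TensorProduct.tmul_sub _ _ _

theorem tmul_smul (a : V.EvenFun) (z : 𝕜) (ω : V.OddFun) :
    V.tmul a (z • ω) = z • V.tmul a ω :=
  TensorProduct.tmul_smul _ _ _

theorem smul_tmul (a : V.EvenFun) (z : 𝕜) (ω : V.OddFun) :
    V.tmul (z • a) ω = z • V.tmul a ω :=
  TensorProduct.smul_tmul' _ _ _

theorem deriv_of_deg_eq_zero {c : V.Ix} (h : c.deg = 0) :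
    V.deriv c = V.onEven (V.evenPd ⟨c, h⟩) :=
  dif_pos h

theorem deriv_of_even {c : V.Ix} (h₀ : c.deg ≠ 0) (h : Even c.deg) :
    V.deriv c = V.onEven (V.evenPderiv ⟨c, h₀, h⟩) := by
  simp only [deriv, h₀, h, dite_true, dite_false]

theorem deriv_of_odd {c : V.Ix} (h : Odd c.deg) : V.deriv c = V.onOdd (V.oddPd ⟨c, h⟩) := by
  simp only [deriv, h.pos.ne', Nat.not_even_iff_odd.2 h, dite_false]

theorem isTwistedDerivation_pd (c : V.BodyIx) : IsTwistedDerivation 1 (V.pd c) := by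
  intro f g
  ext x
  have h : V.ext (f * g).1 =ᶠ[nhds (x : V.BodyIx → ℝ)] V.ext f.1 * V.ext g.1 :=
    V.ext_eventuallyEq _ _ (fun y => by simp [V.ext_apply]) x
  change fderiv ℝ (V.ext (f * g).1) x (Pi.single c 1) =
    fderiv ℝ (V.ext f.1) x (Pi.single c 1) * g.1 x + f.1 x * fderiv ℝ (V.ext g.1) x (Pi.single c 1)
  rw [h.fderiv_eq, fderiv_mul (V.differentiableAt_ext f x) (V.differentiableAt_ext g x)]
  simp only [add_apply, smul_apply, smul_eq_mul, V.ext_apply]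
  ring

theorem isTwistedDerivation_evenPd (c : V.BodyIx) : IsTwistedDerivation 1 (V.evenPd c) := by
  have h := (V.isTwistedDerivation_pd c).rTensor (B := MvPolynomial V.EvenIx 𝕜)
  rwa [Module.End.one_eq_id, LinearMap.rTensor_id] at h

theorem isTwistedDerivation_evenPderiv (c : V.EvenIx) :
    IsTwistedDerivation 1 (V.evenPderiv c) := by
  have leibniz : IsTwistedDerivation 1 (MvPolynomial.pderiv (R := 𝕜) c).toLinearMap := fun a b => by
    simp [mul_comm b, add_comm]
  have h := leibniz.lTensor (A := V.Smooth)
  rwa [Module.End.one_eq_id, LinearMap.lTensor_id] at h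

/-- The sign operator of the exterior algebra. -/
abbrev oddParity : V.OddFun →ₐ[𝕜] V.OddFun :=
  CliffordAlgebra.involute (Q := (0 : QuadraticForm 𝕜 (V.OddIx →₀ 𝕜)))

/-- The sign operator `parity`, which is an automorphism of algebras. -/
def parityHom : V.Fun →ₐ[𝕜] V.Fun :=
  Algebra.TensorProduct.map (AlgHom.id 𝕜 V.EvenFun) V.oddParity

theorem parity_tmul (a : V.EvenFun) (ω : V.OddFun) :
    V.parity (V.tmul a ω) = V.tmul a (V.oddParity ω) := rfl

theorem parity_mul_self : V.parity * V.parity = 1 := by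
  have h : V.oddParity.toLinearMap ∘ₗ V.oddParity.toLinearMap = LinearMap.id :=
    LinearMap.ext CliffordAlgebra.involute_involute
  exact (V.onOdd_mul _ _).trans (congrArg V.onOdd h |>.trans TensorProduct.map_id)

theorem parity_pow_of_even {k : ℕ} (h : Even k) : V.parity ^ k = 1 := by
  obtain ⟨r, rfl⟩ := h
  rw [← two_mul, pow_mul, pow_two, parity_mul_self, one_pow]

theorem parity_pow_of_odd {k : ℕ} (h : Odd k) : V.parity ^ k = V.parity := by
  obtain ⟨r, rfl⟩ := h
  rw [pow_succ, pow_mul, pow_two, parity_mul_self, one_pow, one_mul]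

theorem parityHom_pow_apply (k : ℕ) (f : V.Fun) : (V.parityHom ^ k) f = (V.parity ^ k) f := by
  induction k with
  | zero => rfl
  | succ k ih => rw [pow_succ', pow_succ', AlgHom.mul_apply, ih]; rfl

theorem parity_pow_mul (k : ℕ) (f g : V.Fun) :
    (V.parity ^ k) (f * g) = (V.parity ^ k) f * (V.parity ^ k) g := by
  simp only [← parityHom_pow_apply, map_mul]

theorem parity_pow_one (k : ℕ) : (V.parity ^ k) 1 = 1 := by
  rw [← parityHom_pow_apply, map_one]

theorem isGradedCommutative_parity : IsGradedCommutative V.parity :=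
  isGradedCommutative_involute.lTensor (A := V.EvenFun)

theorem mul_eq_parity (f g : V.Fun) :
    f * g = (1 / 2 : 𝕜) • (g * f + V.parity g * f + g * V.parity f - V.parity g * V.parity f) := by
  have key : (2 : 𝕜) • (f * g) =
      g * f + V.parity g * f + g * V.parity f - V.parity g * V.parity f := by
    rw [two_smul, V.isGradedCommutative_parity f g]
    noncomm_ring
  rw [← key, smul_smul]
  norm_num

theorem isTwistedDerivation_deriv (c : V.Ix) :
    IsTwistedDerivation (V.parity ^ c.deg) (V.deriv c) := by
  rcases Nat.even_or_odd c.deg with h | h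
  · rw [V.parity_pow_of_even h]
    have onEven {D : Module.End 𝕜 V.EvenFun} (hD : IsTwistedDerivation 1 D) :
        IsTwistedDerivation 1 (V.onEven D) := by
      have hD' := hD.rTensor (B := V.OddFun)
      rwa [Module.End.one_eq_id, LinearMap.rTensor_id] at hD'
    by_cases h₀ : c.deg = 0
    · rw [V.deriv_of_deg_eq_zero h₀]
      exact onEven (V.isTwistedDerivation_evenPd _)
    · rw [V.deriv_of_even h₀ h]
      exact onEven (V.isTwistedDerivation_evenPderiv _)
  · rw [V.parity_pow_of_odd h, V.deriv_of_odd h]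
    exact (isTwistedDerivation_contractLeft _).lTensor (A := V.EvenFun)

theorem deriv_one (c : V.Ix) : V.deriv c 1 = 0 :=
  (V.isTwistedDerivation_deriv c).map_one (V.parity_pow_one _)

/-! ### Degrees -/

/-- The degree of the monomial `f(x) y^e θ_{c₁} ⋯ θ_{c_l}`. -/
def monoDeg (e : V.EvenIx →₀ ℕ) (l : List V.OddIx) : ℕ :=
  (e.sum fun c i => i * c.1.deg) + (l.map fun c => c.1.deg).sum

theorem monoDeg_add_append (e e' : V.EvenIx →₀ ℕ) (l l' : List V.OddIx) :
    V.monoDeg (e + e') (l ++ l') = V.monoDeg e l + V.monoDeg e' l' := by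
  rw [monoDeg, Finsupp.sum_add_index' (by simp) (by intros; ring), List.map_append,
    List.sum_append, add_add_add_comm]
  rfl

theorem monoDeg_cons (e : V.EvenIx →₀ ℕ) (c : V.OddIx) (l : List V.OddIx) :
    V.monoDeg e (c :: l) = c.1.deg + V.monoDeg e l := by
  rw [monoDeg, List.map_cons, List.sum_cons, add_left_comm]
  rfl

/-- Homogeneous functions of an integral degree, so that degrees can be subtracted. -/
def homogInt (z : ℤ) : Submodule 𝕜 V.Fun :=
  Submodule.span 𝕜 {F | ∃ f e l, F = V.mono f e l ∧ (V.monoDeg e l : ℤ) = z}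

theorem homogInt_natCast (k : ℕ) : V.homogInt k = V.homog k := by
  simp only [homogInt, homog, Nat.cast_inj, monoDeg]

theorem mono_mem_homogInt (f : V.Smooth) (e : V.EvenIx →₀ ℕ) (l : List V.OddIx) :
    V.mono f e l ∈ V.homogInt (V.monoDeg e l) :=
  Submodule.subset_span ⟨f, e, l, rfl, rfl⟩

theorem mono_mul_mono (f f' : V.Smooth) (e e' : V.EvenIx →₀ ℕ) (l l' : List V.OddIx) :
    V.mono f e l * V.mono f' e' l' = V.mono (f * f') (e + e') (l ++ l') := by
  have h : V.evenMono f e * V.evenMono f' e' = V.evenMono (f * f') (e + e') := by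
    refine (Algebra.TensorProduct.tmul_mul_tmul _ _ _ _).trans ?_
    rw [MvPolynomial.monomial_mul, one_mul]
    rfl
  unfold mono
  rw [tmul_mul_tmul, h, List.map_append, List.prod_append]

theorem one_mem_homogInt : (1 : V.Fun) ∈ V.homogInt 0 :=
  V.mono_mem_homogInt 1 0 []

theorem mul_mem_homogInt {y z : ℤ} {f g : V.Fun} (hf : f ∈ V.homogInt y) (hg : g ∈ V.homogInt z) :
    f * g ∈ V.homogInt (y + z) := by
  induction hf, hg using Submodule.span_induction₂ with
  | mem_mem _ _ h h' =>
    obtain ⟨f, e, l, rfl, rfl⟩ := h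
    obtain ⟨f', e', l', rfl, rfl⟩ := h'
    rw [mono_mul_mono, ← Nat.cast_add, ← monoDeg_add_append]
    exact V.mono_mem_homogInt _ _ _
  | zero_left => rw [zero_mul]; exact zero_mem _
  | zero_right => rw [mul_zero]; exact zero_mem _
  | add_left _ _ _ _ _ _ h h' => rw [add_mul]; exact add_mem h h'
  | add_right _ _ _ _ _ _ h h' => rw [mul_add]; exact add_mem h h'
  | smul_left r _ _ _ _ h => rw [smul_mul_assoc]; exact Submodule.smul_mem _ r h
  | smul_right r _ _ _ _ h => rw [mul_smul_comm]; exact Submodule.smul_mem _ r h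

theorem oddParity_theta_prod (l : List V.OddIx) :
    V.oddParity (l.map V.theta).prod =
      (-1 : 𝕜) ^ (l.map fun c => c.1.deg).sum • (l.map V.theta).prod := by
  induction l with
  | nil => simp
  | cons c l ih =>
    have h : V.oddParity (V.theta c) = (-1 : 𝕜) ^ c.1.deg • V.theta c := by
      rw [c.2.neg_one_pow, neg_one_smul]
      exact CliffordAlgebra.involute_ι _
    rw [List.map_cons, List.prod_cons, map_mul, ih, h, smul_mul_smul_comm, List.map_cons,
      List.sum_cons, pow_add]

theorem parity_mono (f : V.Smooth) (e : V.EvenIx →₀ ℕ) (l : List V.OddIx) :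
    V.parity (V.mono f e l) = (-1 : 𝕜) ^ V.monoDeg e l • V.mono f e l := by
  have he : Even (e.sum fun c i => i * c.1.deg) :=
    Finset.even_sum _ fun c _ => c.2.2.mul_left _
  rw [mono, parity_tmul, oddParity_theta_prod, tmul_smul, monoDeg, pow_add, he.neg_one_pow,
    one_mul]

theorem parity_of_mem_homog {k : ℕ} {f : V.Fun} (hf : f ∈ V.homog k) :
    V.parity f = (-1 : 𝕜) ^ k • f := by
  induction hf using Submodule.span_induction with
  | mem x h => obtain ⟨f, e, l, rfl, rfl⟩ := h; exact V.parity_mono f e l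
  | zero => simp
  | add x y _ _ hx hy => rw [map_add, hx, hy, smul_add]
  | smul r x _ hx => rw [map_smul, hx, smul_comm]

theorem parity_mem_homogInt {z : ℤ} {f : V.Fun} (hf : f ∈ V.homogInt z) :
    V.parity f ∈ V.homogInt z := by
  induction hf using Submodule.span_induction with
  | mem x h =>
    obtain ⟨f, e, l, rfl, rfl⟩ := h
    rw [parity_mono]
    exact Submodule.smul_mem _ _ (V.mono_mem_homogInt f e l)
  | zero => rw [map_zero]; exact zero_mem _
  | add x y _ _ hx hy => rw [map_add]; exact add_mem hx hy
  | smul r x _ hx => rw [map_smul]; exact Submodule.smul_mem _ _ hx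

theorem parity_pow_mem_homogInt (k : ℕ) {z : ℤ} {f : V.Fun} (hf : f ∈ V.homogInt z) :
    (V.parity ^ k) f ∈ V.homogInt z := by
  induction k with
  | zero => exact hf
  | succ k ih => rw [pow_succ']; exact V.parity_mem_homogInt ih

theorem evenPderiv_evenMono (c : V.EvenIx) (f : V.Smooth) (e : V.EvenIx →₀ ℕ) :
    V.evenPderiv c (V.evenMono f e) = (e c : 𝕜) • V.evenMono f (e - Finsupp.single c 1) := by
  have h : MvPolynomial.pderiv c (MvPolynomial.monomial e (1 : 𝕜)) =
      (e c : 𝕜) • MvPolynomial.monomial (e - Finsupp.single c 1) (1 : 𝕜) := by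
    rw [MvPolynomial.pderiv_monomial, MvPolynomial.smul_monomial, one_mul, smul_eq_mul, mul_one]
  exact (congrArg (f ⊗ₜ[𝕜] ·) h).trans (TensorProduct.tmul_smul _ _ _)

theorem deriv_mono_nil_of_odd {c : V.Ix} (hc : Odd c.deg) (f : V.Smooth) (e : V.EvenIx →₀ ℕ) :
    V.deriv c (V.mono f e []) = 0 := by
  rw [V.deriv_of_odd hc]
  exact (congrArg (V.tmul _) (CliffordAlgebra.contractLeft_one _ _)).trans
    (TensorProduct.tmul_zero _ _)

theorem deriv_mono_cons_of_odd {c : V.Ix} (hc : Odd c.deg) (f : V.Smooth) (e : V.EvenIx →₀ ℕ)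
    (b : V.OddIx) (l : List V.OddIx) :
    V.deriv c (V.mono f e (b :: l)) =
      (if b.1 = c then V.mono f e l else 0) - V.mono 1 0 [b] * V.deriv c (V.mono f e l) := by
  have contract : V.oddPd ⟨c, hc⟩ (V.theta b * (l.map V.theta).prod) =
      (Finsupp.single b (1 : 𝕜) ⟨c, hc⟩) • (l.map V.theta).prod -
        V.theta b * V.oddPd ⟨c, hc⟩ (l.map V.theta).prod :=
    CliffordAlgebra.contractLeft_ι_mul _ _ _
  have coeff : Finsupp.single b (1 : 𝕜) ⟨c, hc⟩ = if b.1 = c then 1 else 0 := by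
    simp only [Finsupp.single_apply, Subtype.ext_iff]
  have factor (ω : V.OddFun) :
      V.tmul (V.evenMono f e) (V.theta b * ω) = V.mono 1 0 [b] * V.tmul (V.evenMono f e) ω := by
    rw [mono, tmul_mul_tmul, List.map_singleton, List.prod_singleton,
      show V.evenMono 1 0 = 1 from rfl, one_mul]
  rw [V.deriv_of_odd hc]
  refine (congrArg (V.tmul (V.evenMono f e)) contract).trans ?_
  rw [tmul_sub, tmul_smul, factor, coeff, ite_smul, one_smul, zero_smul]
  rfl

theorem deriv_mono_mem_of_even {c : V.Ix} (h₀ : c.deg ≠ 0) (hc : Even c.deg) (f : V.Smooth)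
    (e : V.EvenIx →₀ ℕ) (l : List V.OddIx) :
    V.deriv c (V.mono f e l) ∈ V.homogInt (V.monoDeg e l - c.deg) := by
  set c' : V.EvenIx := ⟨c, h₀, hc⟩ with hc'
  have hderiv : V.deriv c (V.mono f e l) =
      (e c' : 𝕜) • V.mono f (e - Finsupp.single c' 1) l := by
    rw [V.deriv_of_even h₀ hc, mono, mono, ← smul_tmul, ← evenPderiv_evenMono]
    rfl
  rw [hderiv]
  by_cases he : e c' = 0
  · rw [he, Nat.cast_zero, zero_smul]
    exact zero_mem _
  · have hsplit : e - Finsupp.single c' 1 + Finsupp.single c' 1 = e :=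
      tsub_add_cancel_of_le (Finsupp.single_le_iff.2 (Nat.one_le_iff_ne_zero.2 he))
    have hdeg := V.monoDeg_add_append (e - Finsupp.single c' 1) (Finsupp.single c' 1) l []
    have hsingle : V.monoDeg (Finsupp.single c' 1) [] = c.deg := by simp [monoDeg, hc']
    rw [hsplit, List.append_nil, hsingle] at hdeg
    rw [hdeg, Nat.cast_add, add_sub_cancel_right]
    exact Submodule.smul_mem _ _ (V.mono_mem_homogInt _ _ _)

theorem deriv_mono_mem_of_odd {c : V.Ix} (hc : Odd c.deg) (f : V.Smooth)
    (e : V.EvenIx →₀ ℕ) (l : List V.OddIx) :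
    V.deriv c (V.mono f e l) ∈ V.homogInt (V.monoDeg e l - c.deg) := by
  induction l with
  | nil => rw [V.deriv_mono_nil_of_odd hc]; exact zero_mem _
  | cons b l ih =>
    rw [V.deriv_mono_cons_of_odd hc, monoDeg_cons, Nat.cast_add]
    refine sub_mem ?_ ?_
    · split_ifs with hb
      · rw [hb, add_sub_cancel_left]
        exact V.mono_mem_homogInt f e l
      · exact zero_mem _
    · rw [add_sub_assoc]
      have hθ : V.mono 1 0 [b] ∈ V.homogInt b.1.deg := by
        simpa [monoDeg] using V.mono_mem_homogInt 1 0 [b]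
      exact V.mul_mem_homogInt hθ ih

theorem deriv_mem_homogInt (c : V.Ix) {z : ℤ} {f : V.Fun} (hf : f ∈ V.homogInt z) :
    V.deriv c f ∈ V.homogInt (z - c.deg) := by
  induction hf using Submodule.span_induction with
  | zero => rw [map_zero]; exact zero_mem _
  | add x y _ _ hx hy => rw [map_add]; exact add_mem hx hy
  | smul r x _ hx => rw [map_smul]; exact Submodule.smul_mem _ _ hx
  | mem x h =>
    obtain ⟨f, e, l, rfl, rfl⟩ := h
    by_cases h₀ : c.deg = 0
    · rw [V.deriv_of_deg_eq_zero h₀, h₀, Nat.cast_zero, sub_zero]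
      exact V.mono_mem_homogInt (V.pd ⟨c, h₀⟩ f) e l
    rcases Nat.even_or_odd c.deg with hc | hc
    · exact V.deriv_mono_mem_of_even h₀ hc f e l
    · exact V.deriv_mono_mem_of_odd hc f e l

end NPChart

/-! ### Products of several factors -/

theorem exists_prod_ofFn_eq_mul_mul {E : Type*} [Monoid E] {k : ℕ} (i : Fin k)
    (f : Fin (k + 1) → E) :
    ∃ a b : E, ∀ g : Fin (k + 1) → E, (∀ l, l ≠ i.castSucc → l ≠ i.succ → g l = f l) →
      (List.ofFn g).prod = a * (g i.castSucc * g i.succ) * b := by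
  induction k with
  | zero => exact i.elim0
  | succ k ih =>
    cases i using Fin.cases with
    | zero =>
      refine ⟨1, (List.ofFn fun l : Fin k => f l.succ.succ).prod, fun g hg => ?_⟩
      have h (l : Fin k) : g l.succ.succ = f l.succ.succ :=
        hg _ (Fin.succ_ne_zero _) (Fin.succ_injective _ |>.ne (Fin.succ_ne_zero _))
      simp only [List.ofFn_succ, List.prod_cons, one_mul, ← mul_assoc, h]
      rfl
    | succ i =>
      obtain ⟨a, b, h⟩ := ih i fun l => f l.succ
      refine ⟨f 0 * a, b, fun g hg => ?_⟩
      have h₀ : g 0 = f 0 := hg 0 (Fin.succ_ne_zero i.castSucc).symm (Fin.succ_ne_zero _).symm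
      have h₁ := h (fun l => g l.succ) fun l hl hl' =>
        hg _ ((Fin.succ_injective _).ne hl) ((Fin.succ_injective _).ne hl')
      rw [List.ofFn_succ, List.prod_cons, h₀, h₁]
      simp only [mul_assoc]
      rfl

theorem prod_ofFn_comp {R E F : Type*} [CommSemiring R] [AddCommMonoid E] [Module R E]
    [AddCommMonoid F] [Module R F] {k : ℕ} (C : E →ₗ[R] F) (X : Fin k → Module.End R F)
    (Y : Fin k → Module.End R E) (h : ∀ i, X i ∘ₗ C = C ∘ₗ Y i) :
    (List.ofFn X).prod ∘ₗ C = C ∘ₗ (List.ofFn Y).prod := by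
  induction k with
  | zero => simp [Module.End.one_eq_id]
  | succ k ih =>
    simp only [List.ofFn_succ, List.prod_cons, Module.End.mul_eq_comp]
    rw [LinearMap.comp_assoc, ih _ _ fun i => h _, ← LinearMap.comp_assoc, h, LinearMap.comp_assoc]

/-- The operator applied to the factor `j` in the `i`-th term of the Leibniz rule for a derivation
`D` twisted by `s`. -/
def leibnizFactor {R A : Type*} [Semiring R] [AddCommMonoid A] [Module R A]
    (s D : Module.End R A) {N : ℕ} (i j : Fin N) : Module.End R A :=
  if j < i then s else if j = i then D else LinearMap.id

section LeibnizFactor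

variable {R A : Type*} [Semiring R] [AddCommMonoid A] [Module R A] (s D : Module.End R A)
variable {N : ℕ}

theorem leibnizFactor_self (i : Fin N) : leibnizFactor s D i i = D := by
  simp [leibnizFactor]

theorem leibnizFactor_of_lt {i j : Fin N} (h : j < i) : leibnizFactor s D i j = s :=
  if_pos h

theorem leibnizFactor_of_gt {i j : Fin N} (h : i < j) : leibnizFactor s D i j = 1 := by
  simp only [leibnizFactor, h.not_gt, h.ne', if_false, Module.End.one_eq_id]

theorem leibnizFactor_congr {N' : ℕ} {i j : Fin N} {i' j' : Fin N'} (hlt : j < i ↔ j' < i')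
    (heq : j = i ↔ j' = i') : leibnizFactor s D i j = leibnizFactor s D i' j' := by
  simp only [leibnizFactor, hlt, heq]

theorem leibnizFactor_apply_apply {N' : ℕ} {φ : Fin N → Fin N'} (hφ : StrictMono φ) (i j : Fin N) :
    leibnizFactor s D (φ i) (φ j) = leibnizFactor s D i j :=
  leibnizFactor_congr s D hφ.lt_iff_lt hφ.injective.eq_iff

theorem leibnizFactor_succ_succ (i j : Fin N) :
    leibnizFactor s D i.succ j.succ = leibnizFactor s D i j :=
  leibnizFactor_apply_apply s D Fin.strictMono_succ i j

theorem leibnizFactor_castSucc_of_ne (i : Fin N) {j : Fin (N + 1)} (h : j ≠ i.castSucc)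
    (h' : j ≠ i.succ) : leibnizFactor s D i.castSucc j = leibnizFactor s D i.succ j := by
  refine leibnizFactor_congr s D ?_ (iff_of_false h h')
  simp only [ne_eq, Fin.ext_iff, Fin.lt_def, Fin.val_castSucc, Fin.val_succ] at h h' ⊢
  omega

theorem leibnizFactor_castSucc_swap (hs : s * s = 1) (i : Fin N) (j : Fin (N + 1)) :
    leibnizFactor s D i.castSucc (Equiv.swap i.castSucc i.succ j) =
      (if j = i.castSucc then s else 1) * leibnizFactor s D i.succ j := by
  have hlt : i.castSucc < i.succ := Fin.castSucc_lt_succ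
  rcases eq_or_ne j i.castSucc with rfl | h
  · rw [Equiv.swap_apply_left, leibnizFactor_of_gt s D hlt, leibnizFactor_of_lt s D hlt,
      if_pos rfl, hs]
  rw [if_neg h, one_mul]
  rcases eq_or_ne j i.succ with rfl | h'
  · rw [Equiv.swap_apply_right, leibnizFactor_self, leibnizFactor_self]
  · rw [Equiv.swap_apply_of_ne_of_ne h h', leibnizFactor_castSucc_of_ne s D i h h']

theorem leibnizFactor_succ_swap (i : Fin N) (j : Fin (N + 1)) :
    leibnizFactor s D i.succ (Equiv.swap i.castSucc i.succ j) =
      (if j = i.succ then s else 1) * leibnizFactor s D i.castSucc j := by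
  have hlt : i.castSucc < i.succ := Fin.castSucc_lt_succ
  rcases eq_or_ne j i.succ with rfl | h'
  · rw [Equiv.swap_apply_right, leibnizFactor_of_lt s D hlt, leibnizFactor_of_gt s D hlt,
      if_pos rfl, mul_one]
  rw [if_neg h', one_mul]
  rcases eq_or_ne j i.castSucc with rfl | h
  · rw [Equiv.swap_apply_left, leibnizFactor_self, leibnizFactor_self]
  · rw [Equiv.swap_apply_of_ne_of_ne h h', leibnizFactor_castSucc_of_ne s D i h h']

theorem leibnizFactor_swap_of_ne (i : Fin N) {l : Fin (N + 1)} (h : l ≠ i.castSucc)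
    (h' : l ≠ i.succ) (j : Fin (N + 1)) :
    leibnizFactor s D l (Equiv.swap i.castSucc i.succ j) = leibnizFactor s D l j := by
  refine leibnizFactor_congr s D ?_ ?_
  · rw [Equiv.swap_apply_def]
    simp only [ne_eq, Fin.ext_iff, Fin.lt_def, Fin.val_castSucc, Fin.val_succ] at h h' ⊢
    split_ifs <;> simp only [Fin.val_castSucc, Fin.val_succ] <;> omega
  · rw [← Equiv.eq_symm_apply, Equiv.symm_swap, Equiv.swap_apply_of_ne_of_ne h h']

end LeibnizFactor

theorem IsTwistedDerivation.map_prod_ofFn {R A : Type*} [CommRing R] [Ring A] [Algebra R A]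
    {s D : Module.End R A} (hD : IsTwistedDerivation s D) (h₁ : D 1 = 0) {N : ℕ} (f : Fin N → A) :
    D (List.ofFn f).prod = ∑ i, (List.ofFn fun j => leibnizFactor s D i j (f j)).prod := by
  induction N with
  | zero => simpa using h₁
  | succ N ih =>
    rw [List.ofFn_succ, List.prod_cons, hD, ih, Fin.sum_univ_succ, Finset.mul_sum]
    simp only [List.ofFn_succ, List.prod_cons, leibnizFactor_self, leibnizFactor_succ_succ,
      leibnizFactor_of_lt _ _ (Fin.succ_pos _), leibnizFactor_of_gt _ _ (Fin.succ_pos _),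
      Module.End.one_apply]

theorem koszul_mul_pow_mul {R E : Type*} [CommRing R] [Ring E] [Algebra R E] {P Q D : E} {m : ℕ}
    (hP : P * P = 1) (hPQ : Commute P Q) (hPD : Commute P D)
    (hQD : Q * D = (-1 : R) ^ m • (D * Q)) :
    (1 + P + Q - P * Q) * (P ^ m * D) = D * (1 + P + Q - P * Q) := by
  rcases Nat.even_or_odd' m with ⟨r, rfl | rfl⟩
  · rw [(even_two_mul r).neg_one_pow, one_smul] at hQD
    have hcomm : Commute (1 + P + Q - P * Q) D :=
      (((Commute.one_left D).add_left hPD).add_left hQD).sub_left (hPD.mul_left hQD)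
    rw [pow_mul, pow_two, hP, one_pow, one_mul, hcomm.eq]
  · rw [(odd_two_mul_add_one r).neg_one_pow, neg_smul, one_smul] at hQD
    have hmulP : (1 + P + Q - P * Q) * P = 1 + P - Q + P * Q := by
      simp only [add_mul, sub_mul, mul_assoc, ← hPQ.eq, one_mul, hP]
      rw [← mul_assoc P P Q, hP, one_mul]
      abel
    rw [pow_succ, pow_mul, pow_two, hP, one_pow, one_mul, ← mul_assoc, hmulP]
    simp only [add_mul, sub_mul, mul_assoc, hQD, one_mul, mul_neg, hPD.eq, hPD.left_comm]
    noncomm_ring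

namespace NPChart

/-! ### Exchange of neighbouring factors of a tensor -/

variable {𝕜 : Type*} [RCLike 𝕜] {n : ℕ} (V : NPChart 𝕜 n)

open PiTensorProduct

/-- The multiplication `f₁ ⊗ ⋯ ⊗ f_N ↦ f₁ ⋯ f_N`. -/
def mulAll (N : ℕ) : V.TFun N →ₗ[𝕜] V.Fun :=
  PiTensorProduct.lift (MultilinearMap.mkPiAlgebraFin 𝕜 N V.Fun)

theorem mulAll_tprod {N : ℕ} (f : Fin N → V.Fun) :
    V.mulAll N (tprod 𝕜 f) = (List.ofFn f).prod := by
  rw [mulAll, lift.tprod, MultilinearMap.mkPiAlgebraFin_apply]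

theorem repGraph_eq {N k : ℕ} (γ : Multidigraph N k) :
    V.repGraph γ = V.mulAll N ∘ₗ (List.ofFn fun e => V.Delta (γ e).1 (γ e).2).prod := rfl

theorem derivAt_eq_map {N : ℕ} (c : V.Ix) (i : Fin N) :
    V.derivAt c i = PiTensorProduct.map (leibnizFactor (V.parity ^ c.deg) (V.deriv c) i) := rfl

theorem derivAt_tprod {N : ℕ} (c : V.Ix) (i : Fin N) (f : Fin N → V.Fun) :
    V.derivAt c i (tprod 𝕜 f) =
      tprod 𝕜 fun j => leibnizFactor (V.parity ^ c.deg) (V.deriv c) i j (f j) := by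
  rw [derivAt_eq_map, map_tprod]

/-- The operator `φ` on the factor `i` of a tensor product. -/
def onFactor {N : ℕ} (i : Fin N) (φ : Module.End 𝕜 V.Fun) : Module.End 𝕜 (V.TFun N) :=
  PiTensorProduct.map fun j => if j = i then φ else 1

/-- The sign operator of one factor of a tensor product. -/
def parityAt {N : ℕ} (i : Fin N) : Module.End 𝕜 (V.TFun N) :=
  V.onFactor i V.parity

/-- Permutation of the factors of a tensor product, without signs. -/
def permute {N : ℕ} (σ : Equiv.Perm (Fin N)) : Module.End 𝕜 (V.TFun N) :=
  PiTensorProduct.lift ((PiTensorProduct.tprod 𝕜).domDomCongr σ)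

theorem permute_tprod {N : ℕ} (σ : Equiv.Perm (Fin N)) (f : Fin N → V.Fun) :
    V.permute σ (tprod 𝕜 f) = tprod 𝕜 fun i => f (σ i) := by
  rw [permute, lift.tprod, MultilinearMap.domDomCongr_apply]

theorem permute_mul_map {N : ℕ} (σ : Equiv.Perm (Fin N)) (g : Fin N → V.Fun →ₗ[𝕜] V.Fun) :
    V.permute σ * (PiTensorProduct.map g : Module.End 𝕜 (V.TFun N)) =
      (PiTensorProduct.map fun i => g (σ i) : Module.End 𝕜 (V.TFun N)) * V.permute σ := by
  refine PiTensorProduct.ext (MultilinearMap.ext fun f => ?_)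
  simp [permute_tprod]

theorem parityAt_tprod {N : ℕ} (i : Fin N) (f : Fin N → V.Fun) :
    V.parityAt i (tprod 𝕜 f) = tprod 𝕜 (Function.update f i (V.parity (f i))) := by
  rw [parityAt, onFactor, map_tprod]
  congr 1
  funext j
  rcases eq_or_ne j i with rfl | h
  · simp
  · simp [h]

theorem onFactor_pow {N : ℕ} (i : Fin N) (φ : Module.End 𝕜 V.Fun) (k : ℕ) :
    V.onFactor i φ ^ k = V.onFactor i (φ ^ k) := by
  rw [onFactor, ← PiTensorProduct.map_pow]
  congr 1
  funext j
  simp only [Pi.pow_apply, ite_pow, one_pow]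

theorem parityAt_mul_self {N : ℕ} (i : Fin N) : V.parityAt i * V.parityAt i = 1 := by
  rw [← pow_two, parityAt, onFactor_pow, pow_two, parity_mul_self, onFactor]
  simp only [ite_self]
  exact PiTensorProduct.map_one

theorem commute_parityAt {N : ℕ} (i j : Fin N) : Commute (V.parityAt i) (V.parityAt j) := by
  unfold Commute SemiconjBy parityAt onFactor
  rw [← PiTensorProduct.map_mul, ← PiTensorProduct.map_mul]
  congr 1
  funext l
  split_ifs <;> rfl

theorem parityAt_mul_derivAt_self {N : ℕ} (c : V.Ix) (i : Fin N) :
    V.parityAt i * V.derivAt c i = (-1 : 𝕜) ^ c.deg • (V.derivAt c i * V.parityAt i) := by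
  have h : V.derivAt c i * V.parityAt i = (-1 : 𝕜) ^ c.deg • (V.parityAt i * V.derivAt c i) := by
    rw [parityAt, onFactor, derivAt_eq_map, ← PiTensorProduct.map_mul, ← PiTensorProduct.map_mul]
    refine V.map_smul_single _ _ i _ fun j => ?_
    rcases eq_or_ne j i with rfl | hj
    · simp only [leibnizFactor_self, if_true, deriv_parity]
    · simp only [hj, if_false, one_mul, mul_one]
  rw [h, smul_smul, ← mul_pow]
  simp

theorem commute_parityAt_derivAt {N : ℕ} (c : V.Ix) {i j : Fin N} (hij : i ≠ j) :
    Commute (V.parityAt i) (V.derivAt c j) := by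
  unfold Commute SemiconjBy parityAt onFactor
  rw [derivAt_eq_map, ← PiTensorProduct.map_mul, ← PiTensorProduct.map_mul]
  congr 1
  funext l
  rcases eq_or_ne l i with rfl | hl
  · rcases lt_or_gt_of_ne hij with h | h
    · simp only [leibnizFactor_of_lt _ _ h, if_true]
      exact ((Commute.refl V.parity).pow_right _).eq
    · simp only [leibnizFactor_of_gt _ _ h, if_true, one_mul, mul_one]
  · simp only [hl, if_false, one_mul, mul_one]

/-- The sign `(-1)^{|f_i| |f_j|}` as an operator on tensors. -/
def koszulAt {N : ℕ} (i j : Fin N) : Module.End 𝕜 (V.TFun N) :=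
  (1 / 2 : 𝕜) • (1 + V.parityAt i + V.parityAt j - V.parityAt i * V.parityAt j)

theorem koszulAt_comm {N : ℕ} (i j : Fin N) : V.koszulAt i j = V.koszulAt j i := by
  unfold koszulAt
  rw [(V.commute_parityAt i j).eq, add_right_comm]

theorem koszulAt_mul_derivAt {N : ℕ} (c : V.Ix) {i j : Fin N} (hij : i ≠ j) :
    V.koszulAt i j * (V.parityAt i ^ c.deg * V.derivAt c j) = V.derivAt c j * V.koszulAt i j := by
  unfold koszulAt
  rw [smul_mul_assoc, mul_smul_comm, koszul_mul_pow_mul (V.parityAt_mul_self i)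
    (V.commute_parityAt i j) (V.commute_parityAt_derivAt c hij) (V.parityAt_mul_derivAt_self c j)]

theorem commute_koszulAt_derivAt {N : ℕ} (c : V.Ix) {i j l : Fin N} (hi : i ≠ l) (hj : j ≠ l) :
    Commute (V.koszulAt i j) (V.derivAt c l) := by
  have hi' := V.commute_parityAt_derivAt c hi
  have hj' := V.commute_parityAt_derivAt c hj
  exact ((((Commute.one_left _).add_left hi').add_left hj').sub_left
    (hi'.mul_left hj')).smul_left _

/-- The exchange of the factors `i` and `i + 1`, with the Koszul sign. -/
def braid {N : ℕ} (i : Fin N) : Module.End 𝕜 (V.TFun (N + 1)) :=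
  V.koszulAt i.castSucc i.succ * V.permute (Equiv.swap i.castSucc i.succ)

theorem parityAt_pow_mul_derivAt {N : ℕ} (c : V.Ix) (i j : Fin N) :
    V.parityAt i ^ c.deg * V.derivAt c j = PiTensorProduct.map fun l =>
      (if l = i then V.parity ^ c.deg else 1) *
        leibnizFactor (V.parity ^ c.deg) (V.deriv c) j l := by
  rw [parityAt, onFactor_pow, onFactor, derivAt_eq_map, ← PiTensorProduct.map_mul]

theorem permute_mul_derivAt_castSucc {N : ℕ} (c : V.Ix) (i : Fin N) :
    V.permute (Equiv.swap i.castSucc i.succ) * V.derivAt c i.castSucc =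
      V.parityAt i.castSucc ^ c.deg * V.derivAt c i.succ *
        V.permute (Equiv.swap i.castSucc i.succ) := by
  have hs : V.parity ^ c.deg * V.parity ^ c.deg = 1 := by
    rw [← pow_add, V.parity_pow_of_even (Even.add_self _)]
  rw [derivAt_eq_map, permute_mul_map, parityAt_pow_mul_derivAt]
  simp only [leibnizFactor_castSucc_swap _ _ hs]

theorem permute_mul_derivAt_succ {N : ℕ} (c : V.Ix) (i : Fin N) :
    V.permute (Equiv.swap i.castSucc i.succ) * V.derivAt c i.succ =
      V.parityAt i.succ ^ c.deg * V.derivAt c i.castSucc *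
        V.permute (Equiv.swap i.castSucc i.succ) := by
  rw [derivAt_eq_map, permute_mul_map, parityAt_pow_mul_derivAt]
  simp only [leibnizFactor_succ_swap]

theorem permute_mul_derivAt_of_ne {N : ℕ} (c : V.Ix) (i : Fin N) {l : Fin (N + 1)}
    (h : l ≠ i.castSucc) (h' : l ≠ i.succ) :
    V.permute (Equiv.swap i.castSucc i.succ) * V.derivAt c l =
      V.derivAt c l * V.permute (Equiv.swap i.castSucc i.succ) := by
  rw [derivAt_eq_map, permute_mul_map]
  simp only [leibnizFactor_swap_of_ne _ _ i h h']

theorem semiconjBy_braid_derivAt {N : ℕ} (i : Fin N) (c : V.Ix) (l : Fin (N + 1)) :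
    SemiconjBy (V.braid i) (V.derivAt c l)
      (V.derivAt c (Equiv.swap i.castSucc i.succ l)) := by
  have hlt : i.castSucc < i.succ := Fin.castSucc_lt_succ
  unfold SemiconjBy braid
  rcases eq_or_ne l i.castSucc with rfl | h
  · rw [mul_assoc, permute_mul_derivAt_castSucc, ← mul_assoc, koszulAt_mul_derivAt _ _ hlt.ne,
      mul_assoc, Equiv.swap_apply_left]
  rcases eq_or_ne l i.succ with rfl | h'
  · rw [mul_assoc, permute_mul_derivAt_succ, ← mul_assoc, koszulAt_comm,
      koszulAt_mul_derivAt _ _ hlt.ne', mul_assoc, Equiv.swap_apply_right]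
  · rw [mul_assoc, permute_mul_derivAt_of_ne _ _ _ h h', ← mul_assoc,
      (V.commute_koszulAt_derivAt c h.symm h'.symm).eq, mul_assoc,
      Equiv.swap_apply_of_ne_of_ne h h']

theorem semiconjBy_braid_Delta {N : ℕ} (i : Fin N) (j l : Fin (N + 1)) :
    SemiconjBy (V.braid i) (V.Delta j l) (V.Delta (Equiv.swap i.castSucc i.succ j)
      (Equiv.swap i.castSucc i.succ l)) := by
  unfold SemiconjBy Delta
  simp only [Finset.mul_sum, Finset.sum_mul, mul_smul_comm, smul_mul_assoc]
  refine Finset.sum_congr rfl fun a _ => Finset.sum_congr rfl fun b _ => ?_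
  rw [((V.semiconjBy_braid_derivAt i a j).mul_right (V.semiconjBy_braid_derivAt i b l)).eq]

theorem mulAll_comp_braid {N : ℕ} (i : Fin N) :
    V.mulAll (N + 1) ∘ₗ V.braid i = V.mulAll (N + 1) := by
  refine PiTensorProduct.ext (MultilinearMap.ext fun f => ?_)
  have hlt : i.castSucc < i.succ := Fin.castSucc_lt_succ
  obtain ⟨a, b, hab⟩ := exists_prod_ofFn_eq_mul_mul i f
  simp only [LinearMap.compMultilinearMap_apply, LinearMap.comp_apply, braid, koszulAt,
    Module.End.mul_apply, permute_tprod, LinearMap.smul_apply, LinearMap.sub_apply,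
    LinearMap.add_apply, Module.End.one_apply, parityAt_tprod, map_smul, map_sub, map_add,
    mulAll_tprod, hab f fun _ _ _ => rfl]
  rw [hab, hab, hab, hab, V.mul_eq_parity (f i.castSucc)]
  · simp only [Function.update_self, Function.update_of_ne hlt.ne, Function.update_of_ne hlt.ne',
      Equiv.swap_apply_left, Equiv.swap_apply_right, mul_smul_comm, smul_mul_assoc]
    congr 1
    noncomm_ring
  all_goals
    intro l h h'
    simp [h, h', Equiv.swap_apply_of_ne_of_ne h h']

theorem repGraph_mapVert_swap {N k : ℕ} (i : Fin N) (γ : Multidigraph (N + 1) k) :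
    V.repGraph (mapVert (Equiv.swap i.castSucc i.succ) γ) ∘ₗ V.braid i = V.repGraph γ := by
  have h := prod_ofFn_comp (V.braid i)
    (fun e => V.Delta (Equiv.swap i.castSucc i.succ (γ e).1) (Equiv.swap i.castSucc i.succ (γ e).2))
    (fun e => V.Delta (γ e).1 (γ e).2) fun e => (V.semiconjBy_braid_Delta i _ _).eq.symm
  rw [repGraph_eq, repGraph_eq, LinearMap.comp_assoc]
  refine (congrArg _ h).trans ?_
  rw [← LinearMap.comp_assoc, mulAll_comp_braid]

theorem parityAt_tprod_of_parity {N : ℕ} {f : Fin N → V.Fun} {i : Fin N} {p : ℕ}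
    (h : V.parity (f i) = (-1 : 𝕜) ^ p • f i) :
    V.parityAt i (tprod 𝕜 f) = (-1 : 𝕜) ^ p • tprod 𝕜 f := by
  rw [parityAt_tprod, h, MultilinearMap.map_update_smul, Function.update_eq_self]

theorem koszulAt_tprod {N : ℕ} {f : Fin N → V.Fun} {i j : Fin N} {p q : ℕ}
    (hp : V.parity (f i) = (-1 : 𝕜) ^ p • f i) (hq : V.parity (f j) = (-1 : 𝕜) ^ q • f j) :
    V.koszulAt i j (tprod 𝕜 f) = (-1 : 𝕜) ^ (p * q) • tprod 𝕜 f := by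
  have sign : (1 / 2 : 𝕜) * (1 + (-1) ^ p + (-1) ^ q - (-1) ^ q * (-1) ^ p) = (-1) ^ (p * q) := by
    rw [pow_mul]
    rcases neg_one_pow_eq_or 𝕜 p with hp | hp <;> rcases neg_one_pow_eq_or 𝕜 q with hq | hq <;>
      rw [hp, hq] <;> norm_num
  rw [← sign]
  simp only [koszulAt, LinearMap.smul_apply, LinearMap.sub_apply, LinearMap.add_apply,
    Module.End.one_apply, Module.End.mul_apply, V.parityAt_tprod_of_parity hp,
    V.parityAt_tprod_of_parity hq, map_smul]
  module

theorem braid_tprod {N : ℕ} (i : Fin N) {f : Fin (N + 1) → V.Fun} {p q : ℕ}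
    (hp : V.parity (f i.castSucc) = (-1 : 𝕜) ^ p • f i.castSucc)
    (hq : V.parity (f i.succ) = (-1 : 𝕜) ^ q • f i.succ) :
    V.braid i (tprod 𝕜 f) =
      (-1 : 𝕜) ^ (p * q) • tprod 𝕜 fun l => f (Equiv.swap i.castSucc i.succ l) := by
  rw [braid, Module.End.mul_apply, permute_tprod, mul_comm p]
  refine V.koszulAt_tprod ?_ ?_
  · simpa only [Equiv.swap_apply_left] using hq
  · simpa only [Equiv.swap_apply_right] using hp

end NPChart

theorem Gra.induction {K : Type*} [Field K] {d N k : ℕ} {P : Gra K d N k → Prop} (g : Gra K d N k)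
    (zero : P 0) (add : ∀ x y, P x → P y → P (x + y))
    (smul_mk : ∀ (c : K) γ, P (c • Gra.mk K d γ)) : P g := by
  obtain ⟨z, rfl⟩ := Submodule.mkQ_surjective (graRel K d N k) g
  induction z using Finsupp.induction_linear with
  | zero => rw [map_zero]; exact zero
  | add x y hx hy => rw [map_add]; exact add _ _ hx hy
  | single γ c =>
    have hsingle : Finsupp.single γ c = c • gr K γ := by
      rw [gr, Finsupp.smul_single, smul_eq_mul, mul_one]
    rw [hsingle, map_smul]
    exact smul_mk c γ

namespace NPChart

/-! ### Degrees of flows -/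

variable {𝕜 : Type*} [RCLike 𝕜] {n : ℕ} (V : NPChart 𝕜 n)

open PiTensorProduct

/-- Homogeneous tensors of integral degree `z`. -/
def tensorHomog (N : ℕ) (z : ℤ) : Submodule 𝕜 (V.TFun N) :=
  Submodule.span 𝕜 {t | ∃ (f : Fin N → V.Fun) (y : Fin N → ℤ), (∀ i, f i ∈ V.homogInt (y i)) ∧
    ∑ i, y i = z ∧ t = tprod 𝕜 f}

theorem leibnizFactor_mem_homogInt {N : ℕ} (c : V.Ix) (i j : Fin N) {z : ℤ} {f : V.Fun}
    (hf : f ∈ V.homogInt z) : leibnizFactor (V.parity ^ c.deg) (V.deriv c) i j f ∈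
      V.homogInt (z - (Pi.single i (c.deg : ℤ) : Fin N → ℤ) j) := by
  rcases lt_trichotomy j i with h | rfl | h
  · rw [leibnizFactor_of_lt _ _ h, Pi.single_eq_of_ne h.ne, sub_zero]
    exact V.parity_pow_mem_homogInt _ hf
  · rw [leibnizFactor_self, Pi.single_eq_same]
    exact V.deriv_mem_homogInt c hf
  · rw [leibnizFactor_of_gt _ _ h, Pi.single_eq_of_ne h.ne', sub_zero]
    exact hf

theorem derivAt_mem_tensorHomog {N : ℕ} (c : V.Ix) (i : Fin N) {z : ℤ} {t : V.TFun N}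
    (ht : t ∈ V.tensorHomog N z) : V.derivAt c i t ∈ V.tensorHomog N (z - c.deg) := by
  induction ht using Submodule.span_induction with
  | mem x h =>
    obtain ⟨f, y, hf, rfl, rfl⟩ := h
    rw [derivAt_tprod]
    refine Submodule.subset_span ⟨_, y - Pi.single i (c.deg : ℤ), fun j => ?_, ?_, rfl⟩
    · exact V.leibnizFactor_mem_homogInt c i j (hf j)
    · simp [Finset.sum_sub_distrib]
  | zero => rw [map_zero]; exact zero_mem _
  | add x y _ _ hx hy => rw [map_add]; exact add_mem hx hy
  | smul r x _ hx => rw [map_smul]; exact Submodule.smul_mem _ _ hx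

theorem Delta_mem_tensorHomog {N : ℕ} (i j : Fin N) {z : ℤ} {t : V.TFun N}
    (ht : t ∈ V.tensorHomog N z) : V.Delta i j t ∈ V.tensorHomog N (z - n) := by
  simp only [Delta, LinearMap.sum_apply, LinearMap.smul_apply, Module.End.mul_apply]
  refine Submodule.sum_mem _ fun a _ => Submodule.sum_mem _ fun b _ => ?_
  rcases eq_or_ne (V.w a b) 0 with hw | hw
  · rw [hw, zero_smul]
    exact zero_mem _
  · have hdeg : z - n = z - b.deg - a.deg := by
      have := V.w_deg a b hw
      omega
    rw [hdeg]
    exact Submodule.smul_mem _ _ (V.derivAt_mem_tensorHomog a i (V.derivAt_mem_tensorHomog b j ht))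

theorem prod_Delta_mem_tensorHomog {N k : ℕ} (γ : Multidigraph N k) {z : ℤ} {t : V.TFun N}
    (ht : t ∈ V.tensorHomog N z) :
    (List.ofFn fun e => V.Delta (γ e).1 (γ e).2).prod t ∈ V.tensorHomog N (z - k * n) := by
  induction k with
  | zero => simpa using ht
  | succ k ih =>
    rw [List.ofFn_succ, List.prod_cons, Module.End.mul_apply, Nat.cast_succ, add_mul, one_mul,
      ← sub_sub]
    exact V.Delta_mem_tensorHomog _ _ (ih fun e => γ e.succ)

theorem prod_ofFn_mem_homogInt {N : ℕ} {f : Fin N → V.Fun} {y : Fin N → ℤ}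
    (h : ∀ i, f i ∈ V.homogInt (y i)) : (List.ofFn f).prod ∈ V.homogInt (∑ i, y i) := by
  induction N with
  | zero => simpa using V.one_mem_homogInt
  | succ N ih =>
    rw [List.ofFn_succ, List.prod_cons, Fin.sum_univ_succ]
    exact V.mul_mem_homogInt (h 0) (ih fun i => h _)

theorem mulAll_mem_homogInt {N : ℕ} {z : ℤ} {t : V.TFun N} (ht : t ∈ V.tensorHomog N z) :
    V.mulAll N t ∈ V.homogInt z := by
  induction ht using Submodule.span_induction with
  | mem x h =>
    obtain ⟨f, y, hf, rfl, rfl⟩ := h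
    rw [mulAll_tprod]
    exact V.prod_ofFn_mem_homogInt hf
  | zero => rw [map_zero]; exact zero_mem _
  | add x y _ _ hx hy => rw [map_add]; exact add_mem hx hy
  | smul r x _ hx => rw [map_smul]; exact Submodule.smul_mem _ _ hx

theorem Rep_mk {N k : ℕ} (γ : Multidigraph N k) : V.Rep (Gra.mk 𝕜 (n + 1) γ) = V.repGraph γ := by
  have h : V.Rep (Gra.mk 𝕜 (n + 1) γ) =
      Finsupp.linearCombination 𝕜 (fun γ : Multidigraph N k => V.repGraph γ) (gr 𝕜 γ) := rfl
  rw [h, gr, Finsupp.linearCombination_single, one_smul]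

theorem flowAt_mem_homogInt {N k : ℕ} (γ : Gra 𝕜 (n + 1) N k) {f : V.Fun} {z : ℤ}
    (hf : f ∈ V.homogInt z) : V.flowAt γ f ∈ V.homogInt (N * z - k * n) := by
  unfold flowAt
  induction γ using Gra.induction with
  | zero => rw [map_zero]; exact zero_mem _
  | add x y hx hy => rw [map_add]; exact add_mem hx hy
  | smul_mk c γ =>
    rw [map_smul, Rep_mk, repGraph_eq]
    refine Submodule.smul_mem _ _ (V.mulAll_mem_homogInt (V.prod_Delta_mem_tensorHomog γ ?_))
    exact Submodule.subset_span ⟨_, fun _ => z, fun _ => hf, by simp, rfl⟩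

end NPChart

/-! ### Insertion of graphs -/

theorem sgn_mul_self {K : Type*} [Field K] {k : ℕ} (σ : Equiv.Perm (Fin k)) :
    sgn K σ * sgn K σ = 1 := by
  rcases Int.units_eq_one_or (Equiv.Perm.sign σ) with h | h <;> simp [sgn, h]

theorem relabel_mk {K : Type*} [Field K] {d N k : ℕ} (σ : Equiv.Perm (Fin N))
    (γ : Multidigraph N k) :
    relabel K d σ (Gra.mk K d γ) = Gra.mk K d (mapVert (⇑σ⁻¹) γ) := by
  have h : relabel K d σ (Gra.mk K d γ) = Finsupp.linearCombination K
    (fun γ : Multidigraph N k => Gra.mk K d (mapVert (⇑σ⁻¹) γ)) (gr K γ) := rfl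
  rw [h, gr, Finsupp.linearCombination_single, one_smul]

theorem insertFirst_mk {K : Type*} [Field K] {d M N' L j k l : ℕ} (h : N' + M = L) (hl : j + k = l)
    (γ : Multidigraph (M + 1) j) (γ' : Multidigraph N' k) :
    insertFirst K d h hl (Gra.mk K d γ) (Gra.mk K d γ') = insertGraph K d h hl γ γ' := by
  have h : insertFirst K d h hl (Gra.mk K d γ) (Gra.mk K d γ') =
    Finsupp.linearCombination K (fun γ : Multidigraph (M + 1) j =>
      Finsupp.linearCombination K fun γ' : Multidigraph N' k => insertGraph K d h hl γ γ')
      (gr K γ) (gr K γ') := rfl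
  rw [h, gr, Finsupp.linearCombination_single, one_smul, gr, Finsupp.linearCombination_single,
    one_smul]

theorem collapse_castAdd {N M : ℕ} (a : Fin N) :
    collapse (rfl : N + M = N + M) (Fin.castAdd M a) = 0 := by
  simp [collapse]

theorem collapse_natAdd {N M : ℕ} (b : Fin M) :
    collapse (rfl : N + M = N + M) (Fin.natAdd N b) = b.succ := by
  simp [collapse, Fin.ext_iff]

theorem castAdd_lt_natAdd {N M : ℕ} (a : Fin N) (b : Fin M) : Fin.castAdd M a < Fin.natAdd N b :=
  Fin.lt_def.2 (a.2.trans_le (Nat.le_add_right N b))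

section LeibnizFactor

variable {R A : Type*} [Semiring R] [AddCommMonoid A] [Module R A] (s D : Module.End R A)
variable {N M : ℕ}

theorem leibnizFactor_castAdd (i : Fin N) (f : Fin N → A) (h : Fin M → A) :
    (fun j => leibnizFactor s D (Fin.castAdd M i) j (Fin.append f h j)) =
      Fin.append (fun j => leibnizFactor s D i j (f j)) h := by
  funext j
  cases j using Fin.addCases with
  | left a =>
    rw [Fin.append_left, Fin.append_left, leibnizFactor_apply_apply s D (Fin.strictMono_castAdd M)]
  | right b =>
    rw [Fin.append_right, Fin.append_right, leibnizFactor_of_gt s D (castAdd_lt_natAdd i b),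
      Module.End.one_apply]

theorem leibnizFactor_natAdd (i : Fin M) (f : Fin N → A) (h : Fin M → A) :
    (fun j => leibnizFactor s D (Fin.natAdd N i) j (Fin.append f h j)) =
      Fin.append (fun j => s (f j)) fun j => leibnizFactor s D i j (h j) := by
  funext j
  cases j using Fin.addCases with
  | left a =>
    rw [Fin.append_left, Fin.append_left, leibnizFactor_of_lt s D (castAdd_lt_natAdd a i)]
  | right b =>
    rw [Fin.append_right, Fin.append_right, leibnizFactor_apply_apply s D (Fin.strictMono_natAdd N)]

theorem leibnizFactor_zero_cons (x : A) (h : Fin M → A) :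
    (fun j => leibnizFactor s D 0 j (Fin.cons (α := fun _ => A) x h j)) =
      Fin.cons (α := fun _ => A) (D x) h := by
  funext j
  cases j using Fin.cases with
  | zero => rw [Fin.cons_zero, Fin.cons_zero, leibnizFactor_self]
  | succ j =>
    rw [Fin.cons_succ, Fin.cons_succ, leibnizFactor_of_gt s D (Fin.succ_pos j),
      Module.End.one_apply]

theorem leibnizFactor_succ_cons (i : Fin M) (x : A) (h : Fin M → A) :
    (fun j => leibnizFactor s D i.succ j (Fin.cons (α := fun _ => A) x h j)) =
      Fin.cons (α := fun _ => A) (s x) fun j => leibnizFactor s D i j (h j) := by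
  funext j
  cases j using Fin.cases with
  | zero => rw [Fin.cons_zero, Fin.cons_zero, leibnizFactor_of_lt s D (Fin.succ_pos i)]
  | succ j => rw [Fin.cons_succ, Fin.cons_succ, leibnizFactor_succ_succ]

end LeibnizFactor

namespace NPChart

variable {𝕜 : Type*} [RCLike 𝕜] {n : ℕ} (V : NPChart 𝕜 n)

open PiTensorProduct

/-- The linear map `x ↦ x ⊗ h₁ ⊗ ⋯ ⊗ h_M`. -/
def consTensor {M : ℕ} (h : Fin M → V.Fun) : V.Fun →ₗ[𝕜] V.TFun (M + 1) where
  toFun x := PiTensorProduct.tprod 𝕜 (Fin.cons (α := fun _ => V.Fun) x h)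
  map_add' := MultilinearMap.cons_add (M := fun _ => V.Fun) _ h
  map_smul' := MultilinearMap.cons_smul (M := fun _ => V.Fun) _ h

theorem consTensor_apply {M : ℕ} (h : Fin M → V.Fun) (x : V.Fun) :
    V.consTensor h x = tprod 𝕜 (Fin.cons (α := fun _ => V.Fun) x h) := rfl

/-- The multiplication `f₁ ⊗ ⋯ ⊗ f_N ⊗ h₁ ⊗ ⋯ ⊗ h_M ↦ (f₁ ⋯ f_N) ⊗ h₁ ⊗ ⋯ ⊗ h_M`. -/
def mulFirst (N M : ℕ) : V.TFun (N + M) →ₗ[𝕜] V.TFun (M + 1) :=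
  PiTensorProduct.lift <| MultilinearMap.domDomCongr finSumFinEquiv <|
    MultilinearMap.uncurrySum (N := fun _ => V.Fun) <|
      (PiTensorProduct.tprod 𝕜 (s := fun _ : Fin (M + 1) => V.Fun)).curryLeft.compMultilinearMap
        (MultilinearMap.mkPiAlgebraFin 𝕜 N V.Fun)

theorem mulFirst_tprod {N M : ℕ} (f : Fin N → V.Fun) (h : Fin M → V.Fun) :
    V.mulFirst N M (tprod 𝕜 (Fin.append f h)) = V.consTensor h (List.ofFn f).prod := by
  rw [mulFirst, lift.tprod]
  simp [consTensor_apply]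

/-- The linear map `f₁ ⊗ ⋯ ⊗ f_N ↦ f₁ ⊗ ⋯ ⊗ f_N ⊗ h₁ ⊗ ⋯ ⊗ h_M`. -/
def appendTensor {N M : ℕ} (h : Fin M → V.Fun) : V.TFun N →ₗ[𝕜] V.TFun (N + M) :=
  TensorPower.mulEquiv.toLinearMap ∘ₗ (TensorProduct.mk 𝕜 (V.TFun N) (V.TFun M)).flip (tprod 𝕜 h)

theorem appendTensor_tprod {N M : ℕ} (h : Fin M → V.Fun) (f : Fin N → V.Fun) :
    V.appendTensor h (tprod 𝕜 f) = tprod 𝕜 (Fin.append f h) :=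
  TensorPower.tprod_mul_tprod 𝕜 f h

theorem mulFirst_comp_appendTensor {N M : ℕ} (h : Fin M → V.Fun) :
    V.mulFirst N M ∘ₗ V.appendTensor h = V.consTensor h ∘ₗ V.mulAll N := by
  refine PiTensorProduct.ext (MultilinearMap.ext fun f => ?_)
  simp only [LinearMap.compMultilinearMap_apply, LinearMap.comp_apply, appendTensor_tprod,
    mulFirst_tprod, mulAll_tprod]

theorem tprod_hom_ext_append {N M : ℕ} {E : Type*} [AddCommMonoid E] [Module 𝕜 E]
    {φ ψ : V.TFun (N + M) →ₗ[𝕜] E}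
    (h : ∀ (f : Fin N → V.Fun) (g : Fin M → V.Fun),
      φ (tprod 𝕜 (Fin.append f g)) = ψ (tprod 𝕜 (Fin.append f g))) : φ = ψ := by
  refine PiTensorProduct.ext (MultilinearMap.ext fun f => ?_)
  rw [← Fin.append_castAdd_natAdd (f := f)]
  exact h _ _

theorem mulAll_comp_mulFirst (N M : ℕ) :
    V.mulAll (M + 1) ∘ₗ V.mulFirst N M = V.mulAll (N + M) := by
  refine V.tprod_hom_ext_append fun f h => ?_
  rw [LinearMap.comp_apply, mulFirst_tprod, consTensor_apply, mulAll_tprod, mulAll_tprod,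
    List.ofFn_succ, List.prod_cons, List.ofFn_fin_append, List.prod_append]
  simp only [Fin.cons_zero, Fin.cons_succ]

theorem derivAt_castAdd_tprod {N M : ℕ} (c : V.Ix) (i : Fin N) (f : Fin N → V.Fun)
    (h : Fin M → V.Fun) : V.derivAt c (Fin.castAdd M i) (tprod 𝕜 (Fin.append f h)) =
      tprod 𝕜 (Fin.append
        (fun j => leibnizFactor (V.parity ^ c.deg) (V.deriv c) i j (f j)) h) := by
  rw [derivAt_tprod, leibnizFactor_castAdd]

theorem derivAt_natAdd_tprod {N M : ℕ} (c : V.Ix) (i : Fin M) (f : Fin N → V.Fun)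
    (h : Fin M → V.Fun) : V.derivAt c (Fin.natAdd N i) (tprod 𝕜 (Fin.append f h)) =
      tprod 𝕜 (Fin.append (fun j => (V.parity ^ c.deg) (f j))
        fun j => leibnizFactor (V.parity ^ c.deg) (V.deriv c) i j (h j)) := by
  rw [derivAt_tprod, leibnizFactor_natAdd]

theorem derivAt_comp_appendTensor {N M : ℕ} (h : Fin M → V.Fun) (c : V.Ix) (i : Fin N) :
    V.derivAt c (Fin.castAdd M i) ∘ₗ V.appendTensor h = V.appendTensor h ∘ₗ V.derivAt c i := by
  refine PiTensorProduct.ext (MultilinearMap.ext fun f => ?_)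
  simp only [LinearMap.compMultilinearMap_apply, LinearMap.comp_apply]
  rw [appendTensor_tprod, derivAt_castAdd_tprod, derivAt_tprod, appendTensor_tprod]

theorem parity_pow_prod_ofFn {N : ℕ} (m : ℕ) (f : Fin N → V.Fun) :
    (V.parity ^ m) (List.ofFn f).prod = (List.ofFn fun i => (V.parity ^ m) (f i)).prod := by
  induction N with
  | zero => simpa using V.parity_pow_one m
  | succ N ih => rw [List.ofFn_succ, List.prod_cons, parity_pow_mul, ih, List.ofFn_succ,
      List.prod_cons]

theorem derivAt_zero_comp_mulFirst {N M : ℕ} (c : V.Ix) :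
    V.derivAt c 0 ∘ₗ V.mulFirst N M =
      V.mulFirst N M ∘ₗ ∑ i, V.derivAt c (Fin.castAdd M i) := by
  refine V.tprod_hom_ext_append fun f h => ?_
  simp only [LinearMap.comp_apply, LinearMap.sum_apply, map_sum, derivAt_castAdd_tprod,
    mulFirst_tprod]
  rw [← map_sum, ← (V.isTwistedDerivation_deriv c).map_prod_ofFn (V.deriv_one c),
    consTensor_apply, derivAt_tprod, leibnizFactor_zero_cons, consTensor_apply]

theorem derivAt_succ_comp_mulFirst {N M : ℕ} (c : V.Ix) (i : Fin M) :
    V.derivAt c i.succ ∘ₗ V.mulFirst N M = V.mulFirst N M ∘ₗ V.derivAt c (Fin.natAdd N i) := by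
  refine V.tprod_hom_ext_append fun f h => ?_
  rw [LinearMap.comp_apply, LinearMap.comp_apply, derivAt_natAdd_tprod, mulFirst_tprod,
    mulFirst_tprod, consTensor_apply, derivAt_tprod, leibnizFactor_succ_cons, consTensor_apply,
    parity_pow_prod_ofFn]

theorem derivAt_comp_mulFirst {N M : ℕ} (c : V.Ix) (i : Fin (M + 1)) :
    V.derivAt c i ∘ₗ V.mulFirst N M = V.mulFirst N M ∘ₗ
      ∑ u with collapse (rfl : N + M = N + M) u = i, V.derivAt c u := by
  rw [Finset.sum_filter, Fin.sum_univ_add]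
  simp only [collapse_castAdd, collapse_natAdd]
  cases i using Fin.cases with
  | zero =>
    simp only [if_true, Fin.succ_ne_zero, if_false, Finset.sum_const_zero, add_zero,
      derivAt_zero_comp_mulFirst]
  | succ i =>
    simp only [(Fin.succ_ne_zero i).symm, if_false, Finset.sum_const_zero, zero_add, Fin.succ_inj,
      Finset.sum_ite_eq', Finset.mem_univ, if_true, derivAt_succ_comp_mulFirst]

theorem Delta_comp_of_derivAt_comp {N N' : ℕ} {C : V.TFun N →ₗ[𝕜] V.TFun N'} {i j : Fin N'}
    {A B : Finset (Fin N)} (hi : ∀ c, V.derivAt c i ∘ₗ C = C ∘ₗ ∑ u ∈ A, V.derivAt c u)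
    (hj : ∀ c, V.derivAt c j ∘ₗ C = C ∘ₗ ∑ u ∈ B, V.derivAt c u) :
    V.Delta i j ∘ₗ C = C ∘ₗ ∑ q ∈ A ×ˢ B, V.Delta q.1 q.2 := by
  have hij (a b : V.Ix) : (V.derivAt a i * V.derivAt b j) ∘ₗ C =
      C ∘ₗ ∑ q ∈ A ×ˢ B, V.derivAt a q.1 * V.derivAt b q.2 := by
    rw [Module.End.mul_eq_comp, LinearMap.comp_assoc, hj, ← LinearMap.comp_assoc, hi,
      LinearMap.comp_assoc, ← Module.End.mul_eq_comp, Finset.sum_mul_sum, Finset.sum_product]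
  have sum_Delta : ∑ q ∈ A ×ˢ B, V.Delta q.1 q.2 =
      ∑ a, ∑ b, V.w a b • ∑ q ∈ A ×ˢ B, V.derivAt a q.1 * V.derivAt b q.2 := by
    simp only [Delta, Finset.smul_sum]
    rw [Finset.sum_comm]
    exact Finset.sum_congr rfl fun a _ => Finset.sum_comm
  refine LinearMap.ext fun t => ?_
  have hij (a b : V.Ix) := LinearMap.congr_fun (hij a b) t
  rw [sum_Delta, Delta]
  simp only [LinearMap.comp_apply, LinearMap.sum_apply, map_sum] at hij ⊢
  simp only [LinearMap.smul_apply, map_smul, LinearMap.sum_apply, map_sum, hij]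

theorem Delta_comp_appendTensor {N M : ℕ} (h : Fin M → V.Fun) (i j : Fin N) :
    V.Delta (Fin.castAdd M i) (Fin.castAdd M j) ∘ₗ V.appendTensor h =
      V.appendTensor h ∘ₗ V.Delta i j := by
  have hi (i : Fin N) (c : V.Ix) : V.derivAt c (Fin.castAdd M i) ∘ₗ V.appendTensor h =
      V.appendTensor h ∘ₗ ∑ u ∈ {i}, V.derivAt c u := by
    rw [Finset.sum_singleton, derivAt_comp_appendTensor]
  simpa only [Finset.singleton_product_singleton, Finset.sum_singleton]
    using V.Delta_comp_of_derivAt_comp (hi i) (hi j)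

theorem Delta_comp_mulFirst {N M : ℕ} (p : Fin (M + 1) × Fin (M + 1)) :
    V.Delta p.1 p.2 ∘ₗ V.mulFirst N M = V.mulFirst N M ∘ₗ
      ∑ q : Fin (N + M) × Fin (N + M) with Prod.map (collapse rfl) (collapse rfl) q = p,
        V.Delta q.1 q.2 := by
  rw [V.Delta_comp_of_derivAt_comp (V.derivAt_comp_mulFirst · p.1)
    (V.derivAt_comp_mulFirst · p.2)]
  congr 1
  refine Finset.sum_congr ?_ fun _ _ => rfl
  ext q
  simp [Prod.ext_iff]

theorem prod_Delta_comp_mulFirst {N M k : ℕ} (γ : Multidigraph (M + 1) k) :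
    (List.ofFn fun e => V.Delta (γ e).1 (γ e).2).prod ∘ₗ V.mulFirst N M = V.mulFirst N M ∘ₗ
      ∑ G : Multidigraph (N + M) k with mapVert (collapse rfl) G = γ,
        (List.ofFn fun e => V.Delta (G e).1 (G e).2).prod := by
  rw [prod_ofFn_comp _ _ _ fun e => V.Delta_comp_mulFirst (γ e)]
  have distrib := (MultilinearMap.mkPiAlgebraFin 𝕜 k (Module.End 𝕜 (V.TFun (N + M)))).map_sum_finset
    (fun _ (q : Fin (N + M) × Fin (N + M)) => V.Delta q.1 q.2) fun e =>
      {q | Prod.map (collapse rfl) (collapse rfl) q = γ e}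
  simp only [MultilinearMap.mkPiAlgebraFin_apply] at distrib
  rw [distrib]
  congr 1
  refine Finset.sum_congr ?_ fun _ _ => rfl
  ext G
  simp only [Fintype.mem_piFinset, Finset.mem_filter, Finset.mem_univ, true_and, funext_iff]
  rfl

theorem prod_Delta_appendEdges {L j k : ℕ} (G : Multidigraph L j) (G' : Multidigraph L k) :
    (List.ofFn fun e => V.Delta (appendEdges rfl G G' e).1 (appendEdges rfl G G' e).2).prod =
      (List.ofFn fun e => V.Delta (G e).1 (G e).2).prod *
        (List.ofFn fun e => V.Delta (G' e).1 (G' e).2).prod := by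
  rw [← List.prod_append, ← List.ofFn_fin_append]
  congr 2
  funext e
  cases e using Fin.addCases <;> simp [appendEdges]

theorem sum_repGraph_appendEdges {M N j k : ℕ} (γ : Multidigraph (M + 1) j)
    (γ' : Multidigraph N k) (h : Fin M → V.Fun) :
    (∑ G : Multidigraph (N + M) j with mapVert (collapse rfl) G = γ,
      V.repGraph (appendEdges rfl G (mapVert (Fin.castAdd M) γ'))) ∘ₗ V.appendTensor h =
        V.repGraph γ ∘ₗ V.consTensor h ∘ₗ V.repGraph γ' := by
  have inner := prod_ofFn_comp (V.appendTensor h)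
    (fun e => V.Delta (Fin.castAdd M (γ' e).1) (Fin.castAdd M (γ' e).2))
    (fun e => V.Delta (γ' e).1 (γ' e).2) fun e => V.Delta_comp_appendTensor h _ _
  refine LinearMap.ext fun t => ?_
  have inner : (List.ofFn fun e => V.Delta (mapVert (Fin.castAdd M) γ' e).1
      (mapVert (Fin.castAdd M) γ' e).2).prod (V.appendTensor h t) =
      V.appendTensor h ((List.ofFn fun e => V.Delta (γ' e).1 (γ' e).2).prod t) :=
    LinearMap.congr_fun inner t
  simp only [repGraph_eq, LinearMap.comp_apply, LinearMap.sum_apply, prod_Delta_appendEdges,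
    Module.End.mul_apply]
  rw [inner]
  generalize (List.ofFn fun e => V.Delta (γ' e).1 (γ' e).2).prod t = u
  have outer := LinearMap.congr_fun (V.prod_Delta_comp_mulFirst (N := N) γ) (V.appendTensor h u)
  have first := LinearMap.congr_fun (V.mulFirst_comp_appendTensor h) u
  simp only [LinearMap.comp_apply] at outer first
  rw [← first, outer, ← LinearMap.comp_apply (V.mulAll _), mulAll_comp_mulFirst,
    LinearMap.sum_apply, map_sum]

end NPChart

/-! ### The flow of a bracket of graphs -/

theorem isUnshuffle_one (p N : ℕ) : IsUnshuffle p (1 : Equiv.Perm (Fin N)) := by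
  intro a b hab _
  rwa [inv_one, Equiv.Perm.one_apply, Equiv.Perm.one_apply]

namespace NPChart

variable {𝕜 : Type*} [RCLike 𝕜] {n : ℕ} (V : NPChart 𝕜 n)

open PiTensorProduct

theorem flowAt_zero {N k : ℕ} (H : V.Fun) : V.flowAt (0 : Gra 𝕜 (n + 1) N k) H = 0 := by
  rw [flowAt, map_zero, LinearMap.zero_apply]

theorem flowAt_add {N k : ℕ} (g g' : Gra 𝕜 (n + 1) N k) (H : V.Fun) :
    V.flowAt (g + g') H = V.flowAt g H + V.flowAt g' H := by
  rw [flowAt, map_add, LinearMap.add_apply, flowAt, flowAt]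

theorem flowAt_sub {N k : ℕ} (g g' : Gra 𝕜 (n + 1) N k) (H : V.Fun) :
    V.flowAt (g - g') H = V.flowAt g H - V.flowAt g' H := by
  rw [flowAt, map_sub, LinearMap.sub_apply, flowAt, flowAt]

theorem flowAt_smul {N k : ℕ} (c : 𝕜) (g : Gra 𝕜 (n + 1) N k) (H : V.Fun) :
    V.flowAt (c • g) H = c • V.flowAt g H := by
  rw [flowAt, map_smul, LinearMap.smul_apply, flowAt]

theorem flowAt_sum {ι : Type*} {N k : ℕ} (s : Finset ι) (g : ι → Gra 𝕜 (n + 1) N k) (H : V.Fun) :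
    V.flowAt (∑ i ∈ s, g i) H = ∑ i ∈ s, V.flowAt (g i) H := by
  simp only [flowAt, map_sum, LinearMap.sum_apply]

theorem flowAt_insertGraph {M N L j k l : ℕ} (h : N + M = L) (hl : j + k = l)
    (γ : Multidigraph (M + 1) j) (γ' : Multidigraph N k) (H : V.Fun) :
    V.flowAt (insertGraph 𝕜 (n + 1) h hl γ γ') H =
      V.repGraph γ (V.consTensor (fun _ => H) (V.flowAt (Gra.mk 𝕜 (n + 1) γ') H)) := by
  subst h hl
  have tprod_const : (tprod 𝕜 fun _ : Fin (N + M) => H) =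
      V.appendTensor (fun _ : Fin M => H) (tprod 𝕜 fun _ : Fin N => H) := by
    rw [appendTensor_tprod]
    congr 1
    funext i
    cases i using Fin.addCases <;> simp
  have h := LinearMap.congr_fun (V.sum_repGraph_appendEdges γ γ' fun _ => H)
    (tprod 𝕜 fun _ => H)
  rw [LinearMap.comp_apply, ← tprod_const, LinearMap.sum_apply] at h
  rw [insertGraph, flowAt_sum]
  simp only [flowAt, Rep_mk]
  exact h

theorem flowAt_insertFirst {M N L j k l : ℕ} (h : N + M = L) (hl : j + k = l)
    (g : Gra 𝕜 (n + 1) (M + 1) j) (g' : Gra 𝕜 (n + 1) N k) (H : V.Fun) :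
    V.flowAt (insertFirst 𝕜 (n + 1) h hl g g') H =
      V.Rep g (V.consTensor (fun _ => H) (V.flowAt g' H)) := by
  induction g using Gra.induction with
  | zero => simp only [map_zero, LinearMap.zero_apply, flowAt_zero]
  | add x y hx hy => simp only [map_add, LinearMap.add_apply, flowAt_add, hx, hy]
  | smul_mk c γ =>
    induction g' using Gra.induction with
    | zero => simp only [map_zero, flowAt_zero]
    | add x y hx hy => simp only [map_add, flowAt_add, hx, hy]
    | smul_mk c' γ' =>
      simp only [map_smul, LinearMap.smul_apply, flowAt_smul, insertFirst_mk, flowAt_insertGraph,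
        Rep_mk]

theorem repGraph_mapVert_perm {M k : ℕ} {H : V.Fun} (hH : H ∈ V.homog (n + 1))
    (σ : Equiv.Perm (Fin (M + 1))) (γ : Multidigraph (M + 1) k) :
    V.repGraph (mapVert σ γ) (tprod 𝕜 fun _ => H) =
      sgn 𝕜 σ ^ (n + 1) • V.repGraph γ (tprod 𝕜 fun _ => H) := by
  have hσ : σ ∈ Submonoid.closure
      (Set.range fun i : Fin M => Equiv.swap i.castSucc i.succ) := by
    rw [Equiv.Perm.mclosure_swap_castSucc_succ]
    trivial
  induction hσ using Submonoid.closure_induction generalizing γ with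
  | mem τ h =>
    obtain ⟨i, rfl⟩ := h
    have hp := V.parity_of_mem_homog hH
    have h := LinearMap.congr_fun (V.repGraph_mapVert_swap i γ) (tprod 𝕜 fun _ => H)
    rw [LinearMap.comp_apply, V.braid_tprod i hp hp, map_smul] at h
    have sgn_swap : sgn 𝕜 (Equiv.swap i.castSucc i.succ) = -1 := by
      simp [sgn, Equiv.Perm.sign_swap (Fin.castSucc_lt_succ (i := i)).ne]
    have sign : (-1 : 𝕜) ^ (n + 1) * (-1) ^ ((n + 1) * (n + 1)) = 1 := by
      rw [← pow_add, ← mul_one_add, add_comm 1, (Nat.even_mul_succ_self _).neg_one_pow]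
    rw [sgn_swap, ← h, smul_smul, sign, one_smul]
  | one =>
    have mapVert_one : mapVert (⇑(1 : Equiv.Perm (Fin (M + 1)))) γ = γ := rfl
    rw [mapVert_one]
    simp [sgn]
  | mul τ τ' _ _ h h' =>
    have mapVert_mul : mapVert ⇑(τ * τ') γ = mapVert τ (mapVert τ' γ) := rfl
    rw [mapVert_mul, h, h', smul_smul, ← mul_pow]
    simp [sgn]

theorem flowAt_relabel {M k : ℕ} {H : V.Fun} (hH : H ∈ V.homog (n + 1))
    (σ : Equiv.Perm (Fin (M + 1))) (g : Gra 𝕜 (n + 1) (M + 1) k) :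
    V.flowAt (relabel 𝕜 (n + 1) σ g) H = sgn 𝕜 σ ^ (n + 1) • V.flowAt g H := by
  have sgn_inv : sgn 𝕜 σ⁻¹ = sgn 𝕜 σ := by simp [sgn]
  induction g using Gra.induction with
  | zero => rw [map_zero, flowAt_zero, smul_zero]
  | add x y hx hy => rw [map_add, flowAt_add, hx, hy, flowAt_add, smul_add]
  | smul_mk c γ =>
    rw [map_smul, flowAt_smul, flowAt_smul, smul_comm, relabel_mk, flowAt, flowAt, Rep_mk, Rep_mk,
      V.repGraph_mapVert_perm hH, sgn_inv]

open Classical in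
theorem flowAt_preLie {M M' P j k l : ℕ} (hP : M + M' = P) (hl : j + k = l)
    (g : Gra 𝕜 (n + 1) (M + 1) j) (g' : Gra 𝕜 (n + 1) (M' + 1) k) {H : V.Fun}
    (hH : H ∈ V.homog (n + 1)) :
    V.flowAt (preLie 𝕜 (n + 1) hP hl g g') H =
      (Finset.card {σ : Equiv.Perm (Fin (P + 1)) | IsUnshuffle (M' + 1) σ} : 𝕜) •
        V.Rep g (V.consTensor (fun _ => H) (V.flowAt g' H)) := by
  have flowAt_summand (σ : Equiv.Perm (Fin (P + 1))) : V.flowAt ((sgn 𝕜 σ ^ (n + 1) •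
      (insertFirst 𝕜 (n + 1) (show M' + 1 + M = P + 1 by omega) hl).compr₂
        (relabel 𝕜 (n + 1) σ)) g g') H = V.Rep g (V.consTensor (fun _ => H) (V.flowAt g' H)) := by
    rw [LinearMap.smul_apply, LinearMap.smul_apply, flowAt_smul, LinearMap.compr₂_apply,
      V.flowAt_relabel hH, smul_smul, ← mul_pow, sgn_mul_self, one_pow, one_smul,
      flowAt_insertFirst]
  rw [preLie, LinearMap.sum_apply, LinearMap.sum_apply, flowAt_sum, Nat.cast_smul_eq_nsmul,
    ← Finset.sum_const]
  exact Finset.sum_congr rfl fun σ _ => flowAt_summand σ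

theorem repGraph_edge (f : Fin 2 → V.Fun) :
    V.repGraph (fun _ : Fin 1 => ((0 : Fin 2), (1 : Fin 2))) (tprod 𝕜 f) =
      V.bracket (f 0) (f 1) := by
  rw [repGraph_eq, LinearMap.comp_apply]
  simp only [List.ofFn_succ, List.ofFn_zero, List.prod_cons, List.prod_nil, mul_one, Delta,
    LinearMap.sum_apply, LinearMap.smul_apply, Module.End.mul_apply, derivAt_tprod, map_sum,
    map_smul, mulAll_tprod]
  simp [bracket, leibnizFactor]

theorem Rep_edgeGraph (f g : V.Fun) :
    V.Rep (edgeGraph 𝕜 (n + 1)) (V.consTensor (fun _ => g) f) = V.bracket f g := by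
  rw [edgeGraph, Rep_mk, consTensor_apply]
  exact V.repGraph_edge _

theorem flowAt_edgeGraph (H : V.Fun) : V.flowAt (edgeGraph 𝕜 (n + 1)) H = V.bracket H H := by
  rw [edgeGraph, flowAt, Rep_mk]
  exact V.repGraph_edge _

theorem bracket_comm {f g : V.Fun} {p q : ℕ} (hf : V.parity f = (-1 : 𝕜) ^ p • f)
    (hg : V.parity g = (-1 : 𝕜) ^ q • g) :
    V.bracket f g = ((-1 : 𝕜) ^ (n + 1) * (-1) ^ (p * q)) • V.bracket g f := by
  have mapVert_swap_edge : mapVert (Equiv.swap (Fin.castSucc (0 : Fin 1)) (Fin.succ 0))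
      (fun _ : Fin 1 => ((0 : Fin 2), (1 : Fin 2))) =
      flipEdge 0 (fun _ : Fin 1 => ((0 : Fin 2), (1 : Fin 2))) := by
    funext e
    fin_cases e
    simp [mapVert, flipEdge]
  have h := LinearMap.congr_fun (V.repGraph_mapVert_swap (0 : Fin 1)
    (fun _ : Fin 1 => ((0 : Fin 2), (1 : Fin 2)))) (tprod 𝕜 ![f, g])
  rw [mapVert_swap_edge, repGraph_flipEdge, LinearMap.comp_apply,
    V.braid_tprod 0 (f := ![f, g]) hf hg, LinearMap.smul_apply, map_smul, repGraph_edge,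
    repGraph_edge, smul_smul] at h
  exact h.symm

theorem exists_bracket_comm {f g : V.Fun} {p q : ℕ} (hf : f ∈ V.homog p) (hg : g ∈ V.homog q) :
    ∃ c : 𝕜, c ≠ 0 ∧ V.bracket f g = c • V.bracket g f :=
  ⟨_, by simp, V.bracket_comm (V.parity_of_mem_homog hf) (V.parity_of_mem_homog hg)⟩

theorem exists_flowAt_graphBracket_edgeGraph {M P k l : ℕ} (hP : 1 + M = P) (hl : 1 + k = l)
    (H : V.Ham) (g : Gra 𝕜 (n + 1) (M + 1) k) :
    ∃ c : 𝕜, c ≠ 0 ∧ V.flowAt (graphBracket 𝕜 (n + 1) hP hl (edgeGraph 𝕜 (n + 1)) g) H.1 =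
      c • V.bracket (V.flowAt g H.1) H.1 := by
  classical
  refine ⟨Finset.card {σ : Equiv.Perm (Fin (P + 1)) | IsUnshuffle (M + 1) σ}, ?_, ?_⟩
  · rw [Nat.cast_ne_zero, Finset.card_ne_zero]
    exact ⟨1, Finset.mem_filter_univ _ |>.2 (isUnshuffle_one _ _)⟩
  · obtain ⟨hH, hHH⟩ := H.2
    rw [graphBracket, LinearMap.sub_apply, LinearMap.sub_apply, LinearMap.smul_apply,
      LinearMap.smul_apply, LinearMap.flip_apply, flowAt_sub, flowAt_smul,
      V.flowAt_preLie _ _ _ _ hH, V.flowAt_preLie _ _ _ _ hH, flowAt_edgeGraph, hHH, Rep_edgeGraph]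
    -- Inserting the edge into `g` feeds `{H, H} = 0` into the first factor.
    rw [map_zero, map_zero, smul_zero, smul_zero, sub_zero]

end NPChart

/-! ### Graph cohomology classes act by universal flows -/

namespace NPChart

variable {𝕜 : Type*} [RCLike 𝕜] {n : ℕ} (V : NPChart 𝕜 n)

theorem flowAt_mem_homog {M k m : ℕ} {g : Gra 𝕜 (n + 1) (M + 1) k}
    (hg : graphDegree (n + 1) M k ≠ (m : ℤ) - (n + 1) → g = 0) (H : V.Ham) :
    V.flowAt g H.1 ∈ V.homog m := by
  by_cases hdeg : graphDegree (n + 1) M k = (m : ℤ) - (n + 1)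
  · have hH := H.2.1
    rw [← homogInt_natCast] at hH ⊢
    have degree_eq : ((M + 1 : ℕ) : ℤ) * ((n + 1 : ℕ) : ℤ) - k * n = m := by
      unfold graphDegree at hdeg
      push_cast at hdeg ⊢
      linarith
    exact degree_eq ▸ V.flowAt_mem_homogInt g hH
  · rw [hg hdeg, flowAt_zero]
    exact zero_mem _

theorem exists_flowAt_graphDiff {γ : GraphSeries 𝕜 (n + 1)} {M k m : ℕ} {H : V.Ham}
    (hγ : V.flowAt (γ M k) H.1 ∈ V.homog m) :
    ∃ c : 𝕜, c ≠ 0 ∧ V.flowAt (graphDiff 𝕜 (n + 1) γ (M + 1) (k + 1)) H.1 =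
      c • V.ham H.1 (V.flowAt (γ M k) H.1) := by
  obtain ⟨c, hc, hflow⟩ := V.exists_flowAt_graphBracket_edgeGraph (Nat.add_comm 1 M)
    (Nat.add_comm 1 k) H (γ M k)
  obtain ⟨c', hc', hcomm⟩ := V.exists_bracket_comm hγ H.2.1
  refine ⟨c * c', mul_ne_zero hc hc', ?_⟩
  rw [ham_apply, mul_smul, ← hcomm]
  exact hflow

theorem flowAt_mem_cocycles (γ : graphCocycles 𝕜 (n + 1) 0) (M k : ℕ) (H : V.Ham) :
    V.flowAt (γ.1 M k) H.1 ∈ V.cocycles H.1 (n + 1) := by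
  obtain ⟨γ, hγ, hδγ⟩ := γ
  have hhomog : V.flowAt (γ M k) H.1 ∈ V.homog (n + 1) :=
    V.flowAt_mem_homog (fun h => (hγ M k).1 (by simpa using h)) H
  obtain ⟨c, hc, hflow⟩ := V.exists_flowAt_graphDiff hhomog
  rw [LinearMap.mem_ker.1 hδγ, Pi.zero_apply, Pi.zero_apply, flowAt_zero] at hflow
  exact ⟨hhomog, (smul_eq_zero_iff_right hc).1 hflow.symm⟩

theorem bracket_flowAt_eq_zero (γ : graphCocycles 𝕜 (n + 1) 0) (M k : ℕ) (H : V.Ham) :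
    V.bracket H.1 (V.flowAt (γ.1 M k) H.1) = 0 :=
  (V.ham_apply _ _).symm.trans (LinearMap.mem_ker.1 (V.flowAt_mem_cocycles γ M k H).2)

theorem flowAt_mem_coboundaries {γ : GraphSeries 𝕜 (n + 1)}
    (hγ : γ ∈ graphCoboundaries 𝕜 (n + 1) 0) (M k : ℕ) (H : V.Ham) :
    V.flowAt (γ M k) H.1 ∈ V.coboundaries H.1 n := by
  obtain ⟨β, hβ, rfl⟩ := hγ
  match M, k with
  | 0, _ | _ + 1, 0 => exact (V.flowAt_zero H.1).symm ▸ zero_mem _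
  | M + 1, k + 1 =>
    have hhomog : V.flowAt (β M k) H.1 ∈ V.homog n :=
      V.flowAt_mem_homog (fun h => (hβ M k).1 (by simpa using h)) H
    obtain ⟨c, -, hflow⟩ := V.exists_flowAt_graphDiff hhomog
    rw [hflow]
    exact Submodule.smul_mem _ c ⟨_, hhomog, rfl⟩

/-- The action `γ ↦ Rep(γ_{M,k})(H ⊗ ⋯ ⊗ H)` of graph cocycles by cocycles of `Q = {H, ·}`. -/
def cocycleFlow (M k : ℕ) (H : V.Ham) :
    graphCocycles 𝕜 (n + 1) 0 →ₗ[𝕜] V.cocycles H.1 (n + 1) where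
  toFun γ := ⟨V.flowAt (γ.1 M k) H.1, V.flowAt_mem_cocycles γ M k H⟩
  map_add' γ γ' := Subtype.ext (V.flowAt_add (γ.1 M k) (γ'.1 M k) H.1)
  map_smul' c γ := Subtype.ext (V.flowAt_smul c (γ.1 M k) H.1)

/-- The map induced by `cocycleFlow` on cohomology. -/
def cohomologyFlow (M k : ℕ) (H : V.Ham) :
    GraphCohomology 𝕜 (n + 1) 0 →ₗ[𝕜] V.Cohomology H.1 n :=
  Submodule.mapQ _ _ (V.cocycleFlow M k H) fun _ hγ => V.flowAt_mem_coboundaries hγ M k H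

theorem evalFormula_lof (f : V.Fun) (M k : ℕ) (g : Gra 𝕜 (n + 1) (M + 1) k) :
    V.evalFormula f (DirectSum.lof 𝕜 (ℕ × ℕ) (fun q => Gra 𝕜 (n + 1) (q.1 + 1) q.2) (M, k) g) =
      V.flowAt g f := by
  rw [evalFormula, DirectSum.toModule_lof]
  rfl

end NPChart

section UniversalFlows

variable (𝕜 : Type*) [RCLike 𝕜] (n : ℕ)

/-- The universal flow given by the components with `M + 1` vertices and `k` edges of the cocycles
in a graph cohomology class: the map `Φ` of the theorem. -/
def classFlow (M k : ℕ) : GraphCohomology 𝕜 (n + 1) 0 →ₗ[𝕜] HFlow 𝕜 n :=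
  LinearMap.codRestrict (HFlow 𝕜 n)
    (LinearMap.pi fun V => LinearMap.pi fun H => V.cohomologyFlow M k H) fun c => by
      obtain ⟨γ, rfl⟩ := Submodule.mkQ_surjective _ c
      refine ⟨DirectSum.lof 𝕜 (ℕ × ℕ) (fun q => Gra 𝕜 (n + 1) (q.1 + 1) q.2) (M, k) (γ.1 M k),
        fun V H => ?_⟩
      have hformula := V.evalFormula_lof H.1 M k (γ.1 M k)
      exact ⟨hformula ▸ V.flowAt_mem_cocycles γ M k H,
        congrArg (V.cohClass H.1 n) (Subtype.ext hformula.symm)⟩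

theorem classFlow_graphClass_apply (M k : ℕ) (γ : graphCocycles 𝕜 (n + 1) 0) (V : NPChart 𝕜 n)
    (H : V.Ham) :
    (classFlow 𝕜 n M k (graphClass 𝕜 (n + 1) 0 γ)).1 V H =
      V.cohClass H.1 n ⟨V.flowAt (γ.1 M k) H.1, V.flowAt_mem_cocycles γ M k H⟩ :=
  rfl

theorem classFlow_graphClass_eq_zero {M k : ℕ} {γ : graphCocycles 𝕜 (n + 1) 0}
    (h : γ.1 M k = 0) : classFlow 𝕜 n M k (graphClass 𝕜 (n + 1) 0 γ) = 0 := by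
  have flowAt_eq_zero (V : NPChart 𝕜 n) (H : V.Ham) : V.cocycleFlow M k H γ = 0 :=
    Subtype.ext ((congrArg (V.flowAt · H.1) h).trans (V.flowAt_zero H.1))
  exact Subtype.ext (funext fun V => funext fun H =>
    (congrArg (V.cohClass H.1 n) (flowAt_eq_zero V H)).trans (map_zero _))

theorem finite_support_classFlow (c : finiteClasses 𝕜 (n + 1) 0) :
    (Function.support fun q : ℕ × ℕ => classFlow 𝕜 n q.1 q.2 c.1).Finite := by
  obtain ⟨_, γ, hγ, rfl⟩ := c
  exact hγ.subset fun q hq h => hq (classFlow_graphClass_eq_zero 𝕜 n h)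

/-- The sum of the universal flows `classFlow` over all `(M, k)`, on classes represented by a finite
sum of graphs: the map `Ψ` of the theorem. -/
def totalFlow : finiteClasses 𝕜 (n + 1) 0 →ₗ[𝕜] HFlow 𝕜 n where
  toFun c := ∑ᶠ q : ℕ × ℕ, classFlow 𝕜 n q.1 q.2 c.1
  map_add' c c' := by
    rw [← finsum_add_distrib (finite_support_classFlow 𝕜 n c) (finite_support_classFlow 𝕜 n c')]
    simp only [Submodule.coe_add, map_add]
  map_smul' z c := by
    rw [RingHom.id_apply, smul_finsum' _ (finite_support_classFlow 𝕜 n c)]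
    simp only [Submodule.coe_smul, map_smul]

theorem totalFlow_graphClass (γ : graphCocycles 𝕜 (n + 1) 0) (hγ : IsFinite γ.1) :
    totalFlow 𝕜 n ⟨graphClass 𝕜 (n + 1) 0 γ, γ, hγ, rfl⟩ =
      ∑ q ∈ hγ.toFinset, classFlow 𝕜 n q.1 q.2 (graphClass 𝕜 (n + 1) 0 γ) :=
  finsum_eq_sum_of_support_subset _ fun _ hq => Finset.mem_coe.2 (hγ.mem_toFinset.2 fun h =>
    hq (classFlow_graphClass_eq_zero 𝕜 n h))

end UniversalFlows

/-! ### Charts of degree one -/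

section Bivector

variable {𝕜 : Type*} [RCLike 𝕜] (V : NPChart 𝕜 1)

theorem bijective_elim_x_p : Function.Bijective (Sum.elim .x .p : Fin V.m ⊕ Fin V.m → V.Ix) := by
  refine ⟨Function.Injective.sumElim (fun _ _ => Coord.x.inj) (fun _ _ => Coord.p.inj)
    (fun _ _ => nofun), ?_⟩
  rintro (μ | μ | ⟨i, _⟩ | ⟨i, _⟩ | a)
  · exact ⟨.inl μ, rfl⟩
  · exact ⟨.inr μ, rfl⟩
  · exact i.elim0
  · exact i.elim0
  · exact (a.cast (V.s_eq_zero odd_one)).elim0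

theorem sum_ix {A : Type*} [AddCommMonoid A] (F : V.Ix → A) :
    ∑ a, F a = ∑ μ, F (.x μ) + ∑ μ, F (.p μ) := by
  rw [← (bijective_elim_x_p V).sum_comp, Fintype.sum_sum_type]
  rfl

/-- The coordinate `p_μ`, which is odd on charts of degree one. -/
abbrev pIx (μ : Fin V.m) : V.OddIx := ⟨.p μ, odd_one⟩

theorem pIx_surjective : Function.Surjective (pIx V) := by
  rintro ⟨c, hc⟩
  obtain ⟨μ | μ, rfl⟩ := (bijective_elim_x_p V).2 c
  · exact (Nat.not_odd_zero hc).elim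
  · exact ⟨μ, rfl⟩

theorem isEmpty_evenIx : IsEmpty V.EvenIx := by
  refine ⟨fun ⟨c, hc₀, hc⟩ => ?_⟩
  obtain ⟨μ | μ, rfl⟩ := (bijective_elim_x_p V).2 c
  · exact hc₀ rfl
  · exact Nat.not_even_one hc

/-- The function `f p_{μ₁} ⋯ p_{μ_k}`, as a linear function of its coefficient `f`. -/
def pMono (μs : List (Fin V.m)) : V.Smooth →ₗ[𝕜] V.Fun where
  toFun f := V.mono f 0 (μs.map (pIx V))
  map_add' _ _ := by
    simp only [NPChart.mono, NPChart.evenMono, TensorProduct.add_tmul, NPChart.tmul]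
    exact TensorProduct.add_tmul _ _ _
  map_smul' c f := (congrArg (V.tmul · _) (TensorProduct.smul_tmul' c f _).symm).trans
    (V.smul_tmul _ _ _)

theorem pMono_mul (μs νs : List (Fin V.m)) (f g : V.Smooth) :
    pMono V μs f * pMono V νs g = pMono V (μs ++ νs) (f * g) := by
  have h := V.mono_mul_mono f g 0 0 (μs.map (pIx V)) (νs.map (pIx V))
  rwa [add_zero, ← List.map_append] at h

theorem pMono_nil_injective : Function.Injective (pMono V []) :=
  (Algebra.TensorProduct.includeLeft_injective (S := 𝕜) (algebraMap 𝕜 V.OddFun).injective).comp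
    (Algebra.TensorProduct.includeLeft_injective (S := 𝕜)
      (algebraMap 𝕜 (MvPolynomial V.EvenIx 𝕜)).injective)

theorem pMono_swap (μ ν : Fin V.m) (f : V.Smooth) : pMono V [μ, ν] f = -pMono V [ν, μ] f := by
  have eval (μ ν : Fin V.m) :
      pMono V [μ, ν] f = V.tmul (V.evenMono f 0) (V.theta (pIx V μ) * V.theta (pIx V ν)) :=
    congrArg (V.tmul _ <| V.theta (pIx V μ) * ·) (mul_one _)
  have anticomm : V.theta (pIx V μ) * V.theta (pIx V ν) =
      (-1 : 𝕜) • (V.theta (pIx V ν) * V.theta (pIx V μ)) := by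
    rw [neg_one_smul]
    exact eq_neg_of_add_eq_zero_left (ExteriorAlgebra.ι_add_mul_swap _ _)
  rw [eval, eval, anticomm, V.tmul_smul, neg_one_smul]

theorem pMono_rotate (l μ ν : Fin V.m) (f : V.Smooth) :
    pMono V [μ, ν, l] f = pMono V [l, μ, ν] f := by
  have swap_left (f : V.Smooth) : pMono V [μ, l, ν] f = -pMono V [l, μ, ν] f := by
    have h := congrArg (· * pMono V [ν] f) (pMono_swap V μ l 1)
    simpa only [neg_mul, pMono_mul, one_mul, List.cons_append, List.nil_append] using h
  have swap_right : pMono V [μ, ν, l] f = -pMono V [μ, l, ν] f := by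
    have h := congrArg (pMono V [μ] 1 * ·) (pMono_swap V ν l f)
    simpa only [mul_neg, pMono_mul, one_mul, List.cons_append, List.nil_append] using h
  rw [swap_right, swap_left, neg_neg]

theorem deriv_p_pMono_nil (ρ : Fin V.m) (f : V.Smooth) : V.deriv (.p ρ) (pMono V [] f) = 0 :=
  V.deriv_mono_nil_of_odd odd_one f 0

theorem deriv_p_pMono_cons (ρ μ : Fin V.m) (μs : List (Fin V.m)) (f : V.Smooth) :
    V.deriv (.p ρ) (pMono V (μ :: μs) f) =
      (if μ = ρ then pMono V μs f else 0) - pMono V [μ] 1 * V.deriv (.p ρ) (pMono V μs f) := by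
  have h := V.deriv_mono_cons_of_odd (c := .p ρ) odd_one f 0 (pIx V μ) (μs.map (pIx V))
  simp only [Coord.p.injEq] at h
  exact h

theorem deriv_x_pMono (ρ : Fin V.m) (μs : List (Fin V.m)) (f : V.Smooth) :
    V.deriv (.x ρ) (pMono V μs f) = pMono V μs (dx V ρ f) := by
  rw [V.deriv_of_deg_eq_zero (c := .x ρ) rfl]
  rfl

/-- The function `C^μ p_μ`. -/
def linFun : (Fin V.m → V.Smooth) →ₗ[𝕜] V.Fun :=
  ∑ μ, pMono V [μ] ∘ₗ LinearMap.proj μ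

/-- The function `B^{μν} p_μ p_ν`. -/
def quadFun : (Fin V.m → Fin V.m → V.Smooth) →ₗ[𝕜] V.Fun :=
  ∑ μ, ∑ ν, pMono V [μ, ν] ∘ₗ LinearMap.proj ν ∘ₗ LinearMap.proj μ

/-- The function `A^{lμν} p_l p_μ p_ν`. -/
def cubFun : (Fin V.m → Fin V.m → Fin V.m → V.Smooth) →ₗ[𝕜] V.Fun :=
  ∑ l, ∑ μ, ∑ ν, pMono V [l, μ, ν] ∘ₗ LinearMap.proj ν ∘ₗ LinearMap.proj μ ∘ₗ LinearMap.proj l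

theorem linFun_apply (C : Fin V.m → V.Smooth) : linFun V C = ∑ μ, pMono V [μ] (C μ) := by
  simp [linFun]

theorem quadFun_apply (B : Fin V.m → Fin V.m → V.Smooth) :
    quadFun V B = ∑ μ, ∑ ν, pMono V [μ, ν] (B μ ν) := by
  simp [quadFun]

theorem cubFun_apply (A : Fin V.m → Fin V.m → Fin V.m → V.Smooth) :
    cubFun V A = ∑ l, ∑ μ, ∑ ν, pMono V [l, μ, ν] (A l μ ν) := by
  simp [cubFun]

theorem deriv_p_linFun (ρ : Fin V.m) (C : Fin V.m → V.Smooth) :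
    V.deriv (.p ρ) (linFun V C) = pMono V [] (C ρ) := by
  simp only [linFun_apply, map_sum, deriv_p_pMono_cons, deriv_p_pMono_nil, mul_zero, sub_zero,
    Finset.sum_ite_eq', Finset.mem_univ, if_true]

theorem deriv_p_quadFun (ρ : Fin V.m) (B : Fin V.m → Fin V.m → V.Smooth) :
    V.deriv (.p ρ) (quadFun V B) = linFun V fun μ => B ρ μ - B μ ρ := by
  simp only [quadFun_apply, linFun_apply, map_sum, map_sub, deriv_p_pMono_cons, deriv_p_pMono_nil,
    mul_zero, sub_zero, mul_ite, pMono_mul, one_mul, List.singleton_append,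
    Finset.sum_sub_distrib, Finset.sum_ite_irrel, Finset.sum_const_zero, Finset.sum_ite_eq',
    Finset.mem_univ, if_true]

theorem deriv_p_cubFun (ρ : Fin V.m) (A : Fin V.m → Fin V.m → Fin V.m → V.Smooth) :
    V.deriv (.p ρ) (cubFun V A) = quadFun V fun μ ν => A ρ μ ν - (A μ ρ ν - A μ ν ρ) := by
  simp only [cubFun_apply, quadFun_apply, map_sum, map_sub, deriv_p_pMono_cons, deriv_p_pMono_nil,
    mul_zero, sub_zero, mul_ite, mul_sub, pMono_mul, one_mul, List.singleton_append,
    Finset.sum_sub_distrib, Finset.sum_ite_irrel, Finset.sum_const_zero, Finset.sum_ite_eq',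
    Finset.mem_univ, if_true]

theorem deriv_x_quadFun (ρ : Fin V.m) (B : Fin V.m → Fin V.m → V.Smooth) :
    V.deriv (.x ρ) (quadFun V B) = quadFun V fun μ ν => dx V ρ (B μ ν) := by
  simp only [quadFun_apply, map_sum, deriv_x_pMono]

theorem linFun_mul_quadFun (C : Fin V.m → V.Smooth) (B : Fin V.m → Fin V.m → V.Smooth) :
    linFun V C * quadFun V B = cubFun V fun l μ ν => C l * B μ ν := by
  simp only [linFun_apply, quadFun_apply, cubFun_apply, Finset.sum_mul]
  simp only [Finset.mul_sum, pMono_mul, List.singleton_append]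

theorem quadFun_transpose (B : Fin V.m → Fin V.m → V.Smooth) :
    quadFun V (fun μ ν => B ν μ) = -quadFun V B := by
  rw [quadFun_apply, quadFun_apply, Finset.sum_comm, ← Finset.sum_neg_distrib]
  refine Finset.sum_congr rfl fun μ _ => ?_
  rw [← Finset.sum_neg_distrib]
  exact Finset.sum_congr rfl fun ν _ => pMono_swap V ν μ _

theorem cubFun_rotate (A : Fin V.m → Fin V.m → Fin V.m → V.Smooth) :
    cubFun V (fun l μ ν => A μ ν l) = cubFun V A := by
  rw [cubFun_apply, cubFun_apply, Finset.sum_comm]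
  refine Finset.sum_congr rfl fun μ _ => ?_
  rw [Finset.sum_comm]
  refine Finset.sum_congr rfl fun ν _ => Finset.sum_congr rfl fun l _ => ?_
  exact (pMono_rotate V _ _ _ _).symm

theorem quadFun_mul_linFun (C : Fin V.m → V.Smooth) (B : Fin V.m → Fin V.m → V.Smooth) :
    quadFun V B * linFun V C = cubFun V fun l μ ν => C l * B μ ν := by
  have h : quadFun V B * linFun V C = cubFun V fun μ ν l => B μ ν * C l := by
    simp only [linFun_apply, quadFun_apply, cubFun_apply, Finset.sum_mul]
    simp only [Finset.mul_sum, pMono_mul, List.cons_append, List.nil_append]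
  rw [h, ← cubFun_rotate]
  simp only [mul_comm]

theorem cubFun_eq_zero_iff {A : Fin V.m → Fin V.m → Fin V.m → V.Smooth}
    (hA : ∀ l μ ν, A l ν μ = -A l μ ν) :
    cubFun V A = 0 ↔ ∀ l μ ν, A l μ ν + A μ ν l + A ν l μ = 0 := by
  constructor <;> intro h
  · intro l μ ν
    have hcoeff : V.deriv (.p ν) (V.deriv (.p μ) (V.deriv (.p l) (cubFun V A))) =
        pMono V [] ((2 : 𝕜) • (A l μ ν + A μ ν l + A ν l μ)) := by
      rw [deriv_p_cubFun, deriv_p_quadFun, deriv_p_linFun, hA μ ν l, hA l μ ν, hA ν l μ, two_smul]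
      congr 1
      ring
    rw [h, map_zero, map_zero, map_zero] at hcoeff
    have htwo := pMono_nil_injective V (hcoeff.symm.trans (map_zero _).symm)
    exact (smul_eq_zero.1 htwo).resolve_left two_ne_zero
  · have hcyclic : A + (fun l μ ν => A μ ν l) + (fun l μ ν => A ν l μ) = 0 := by
      funext l μ ν
      exact h l μ ν
    have hrotate : cubFun V (fun l μ ν => A ν l μ) = cubFun V A :=
      (cubFun_rotate V fun l μ ν => A μ ν l).trans (cubFun_rotate V A)
    have hthree : (3 : 𝕜) • cubFun V A = 0 := by
      rw [← map_zero (cubFun V), ← hcyclic, map_add, map_add, cubFun_rotate V A,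
        hrotate]
      module
    exact (smul_eq_zero.1 hthree).resolve_left three_ne_zero

theorem bivectorFun_eq (π : Fin V.m → Fin V.m → V.Smooth) :
    bivectorFun V π = (1 / 2 : 𝕜) • quadFun V π :=
  congrArg _ (quadFun_apply V π).symm

variable {V} in
theorem deriv_p_bivectorFun {π : Fin V.m → Fin V.m → V.Smooth} (hπ : IsBivector V π)
    (ρ : Fin V.m) : V.deriv (.p ρ) (bivectorFun V π) = linFun V (π ρ) := by
  have antisymm : (fun μ => π ρ μ - π μ ρ) = (2 : 𝕜) • π ρ := by
    funext μ
    rw [hπ ρ μ, sub_neg_eq_add, Pi.smul_apply, two_smul]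
  rw [bivectorFun_eq, map_smul, deriv_p_quadFun, antisymm, map_smul, smul_smul]
  norm_num

theorem deriv_x_bivectorFun (π : Fin V.m → Fin V.m → V.Smooth) (ρ : Fin V.m) :
    V.deriv (.x ρ) (bivectorFun V π) = (1 / 2 : 𝕜) • quadFun V fun μ ν => dx V ρ (π μ ν) := by
  rw [bivectorFun_eq, map_smul, deriv_x_quadFun]

theorem injOn_bivectorFun : Set.InjOn (bivectorFun V) {π | IsBivector V π} := by
  intro π hπ π' hπ' h
  funext μ ν
  apply pMono_nil_injective V
  rw [← deriv_p_linFun, ← deriv_p_linFun, ← deriv_p_bivectorFun hπ, ← deriv_p_bivectorFun hπ', h]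

theorem bivectorFun_mem_homog (π : Fin V.m → Fin V.m → V.Smooth) :
    bivectorFun V π ∈ V.homog 2 :=
  Submodule.smul_mem _ _ <| Submodule.sum_mem _ fun _ _ => Submodule.sum_mem _ fun _ _ =>
    Submodule.subset_span ⟨_, _, _, rfl, by rw [Finsupp.sum_zero_index]; rfl⟩

theorem homog_two_le_range_quadFun : V.homog 2 ≤ LinearMap.range (quadFun V) := by
  refine Submodule.span_le.2 ?_
  rintro _ ⟨f, e, l, rfl, hdeg⟩
  have := isEmpty_evenIx V
  obtain rfl : e = 0 := Subsingleton.elim _ _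
  obtain ⟨μs, rfl⟩ := (List.map_surjective_iff.2 (pIx_surjective V)) l
  have hlength : μs.length = 2 := by simpa [Function.comp_def, Coord.deg] using hdeg
  obtain ⟨μ, ν, rfl⟩ := List.length_eq_two.1 hlength
  refine ⟨Pi.single μ (Pi.single ν f), ?_⟩
  rw [quadFun_apply, Finset.sum_eq_single μ, Finset.sum_eq_single ν, Pi.single_eq_same,
    Pi.single_eq_same]
  · rfl
  all_goals simp +contextual

theorem bijOn_bivectorFun :
    Set.BijOn (bivectorFun V) {π | IsBivector V π} (V.homog 2 : Set V.Fun) := by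
  refine ⟨fun π _ => bivectorFun_mem_homog V π, injOn_bivectorFun V, fun H hH => ?_⟩
  obtain ⟨B, rfl⟩ := homog_two_le_range_quadFun V hH
  refine ⟨B - fun μ ν => B ν μ, fun μ ν => (neg_sub _ _).symm, ?_⟩
  rw [bivectorFun_eq, map_sub, quadFun_transpose V B, sub_neg_eq_add, ← two_smul 𝕜, smul_smul]
  norm_num

variable {V} in
theorem bracket_of_parity {f : V.Fun} (hf : V.parity f = f) (g : V.Fun) :
    V.bracket f g = ∑ ρ, (V.deriv (.x ρ) f * V.deriv (.p ρ) g +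
      V.deriv (.p ρ) f * V.deriv (.x ρ) g) := by
  have hpow (k : ℕ) : (V.parity ^ k) f = f := by
    rw [Module.End.pow_apply]
    exact Function.iterate_fixed hf k
  simp only [NPChart.bracket, hpow, sum_ix]
  simp [NPChart.w, Finset.sum_add_distrib]

section Schouten

variable {V} {π π' : Fin V.m → Fin V.m → V.Smooth}

theorem bracket_bivectorFun (hπ : IsBivector V π) (hπ' : IsBivector V π') :
    V.bracket (bivectorFun V π) (bivectorFun V π') =
      (1 / 2 : 𝕜) • cubFun V (schoutenTerm V π π') := by
  have hparity : V.parity (bivectorFun V π) = bivectorFun V π := by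
    rw [V.parity_of_mem_homog (bivectorFun_mem_homog V π)]
    norm_num
  have hterm : schoutenTerm V π π' = ∑ ρ, ((fun l μ ν => π' ρ l * dx V ρ (π μ ν)) +
      fun l μ ν => π ρ l * dx V ρ (π' μ ν)) := by
    funext l μ ν
    simp only [schoutenTerm, Finset.sum_apply, Pi.add_apply, add_comm]
  simp only [bracket_of_parity hparity, deriv_p_bivectorFun hπ, deriv_p_bivectorFun hπ',
    deriv_x_bivectorFun, smul_mul_assoc, mul_smul_comm, linFun_mul_quadFun, quadFun_mul_linFun,
    hterm, map_sum, map_add, Finset.smul_sum, smul_add]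

theorem schoutenTerm_swap (hπ : IsBivector V π) (hπ' : IsBivector V π') (l μ ν : Fin V.m) :
    schoutenTerm V π π' l ν μ = -schoutenTerm V π π' l μ ν := by
  rw [schoutenTerm, schoutenTerm, ← Finset.sum_neg_distrib]
  refine Finset.sum_congr rfl fun ρ _ => ?_
  rw [hπ μ ν, hπ' μ ν, map_neg, map_neg]
  ring

theorem bracket_bivectorFun_eq_zero_iff (hπ : IsBivector V π) (hπ' : IsBivector V π') :
    V.bracket (bivectorFun V π) (bivectorFun V π') = 0 ↔ ∀ l μ ν, schouten V π π' l μ ν = 0 := by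
  rw [bracket_bivectorFun hπ hπ', smul_eq_zero_iff_right (by norm_num),
    cubFun_eq_zero_iff V (schoutenTerm_swap hπ hπ')]
  rfl

end Schouten

theorem bivectorFun_mem_Ham_iff {π : Fin V.m → Fin V.m → V.Smooth} (hπ : IsBivector V π) :
    bivectorFun V π ∈ V.Ham ↔ IsPoisson V π := by
  rw [IsPoisson, ← bracket_bivectorFun_eq_zero_iff hπ hπ]
  exact ⟨fun h => ⟨hπ, h.2⟩, fun h => ⟨bivectorFun_mem_homog V π, h.2⟩⟩

theorem exists_bivectorFun_eq_flowAt {π : Fin V.m → Fin V.m → V.Smooth} (hπ : IsPoisson V π)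
    (γ : graphCocycles 𝕜 (1 + 1) 0) (M k : ℕ) :
    ∃ π', IsBivector V π' ∧ V.flowAt (γ.1 M k) (bivectorFun V π) = bivectorFun V π' ∧
      ∀ l μ ν, schouten V π π' l μ ν = 0 := by
  have hHam := (bivectorFun_mem_Ham_iff V hπ.1).2 hπ
  obtain ⟨π', hπ', hflow⟩ :=
    (bijOn_bivectorFun V).surjOn (V.flowAt_mem_cocycles γ M k ⟨_, hHam⟩).1
  refine ⟨π', hπ', hflow.symm, (bracket_bivectorFun_eq_zero_iff hπ.1 hπ').1 ?_⟩
  rw [hflow]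
  exact V.bracket_flowAt_eq_zero γ M k ⟨_, hHam⟩

end Bivector

end NPGraph

end

open NPGraph in
theorem mainTheorem9 (𝕜 : Type*) [RCLike 𝕜] :
    (∀ n : ℕ,
      ∃ Φ : ℕ → ℕ → (GraphCohomology 𝕜 (n + 1) 0 →ₗ[𝕜] HFlow 𝕜 n),
        (∀ (M k : ℕ) (γ : graphCocycles 𝕜 (n + 1) 0) (V : NPChart 𝕜 n) (H : V.Ham),
          V.flowAt (γ.1 M k) H.1 ∈ V.homog (n + 1) ∧
          V.bracket H.1 (V.flowAt (γ.1 M k) H.1) = 0 ∧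
          ∃ hc : V.flowAt (γ.1 M k) H.1 ∈ V.cocycles H.1 (n + 1),
            (Φ M k (graphClass 𝕜 (n + 1) 0 γ)).1 V H =
              V.cohClass H.1 n ⟨V.flowAt (γ.1 M k) H.1, hc⟩) ∧
        ∃ Ψ : finiteClasses 𝕜 (n + 1) 0 →ₗ[𝕜] HFlow 𝕜 n,
          ∀ (γ : graphCocycles 𝕜 (n + 1) 0) (hγ : IsFinite γ.1),
            Ψ ⟨graphClass 𝕜 (n + 1) 0 γ, γ, hγ, rfl⟩ =
              ∑ q ∈ hγ.toFinset, Φ q.1 q.2 (graphClass 𝕜 (n + 1) 0 γ)) ∧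
    (∀ V : NPChart 𝕜 1,
      (∀ H ∈ V.homog 2, ∃! π : Fin V.m → Fin V.m → V.Smooth,
        IsBivector V π ∧ bivectorFun V π = H) ∧
      (∀ π, IsBivector V π → (bivectorFun V π ∈ V.Ham ↔ IsPoisson V π)) ∧
      ∀ (M k : ℕ) (γ : graphCocycles 𝕜 (1 + 1) 0) (π : Fin V.m → Fin V.m → V.Smooth),
        IsPoisson V π →
          ∃ π' : Fin V.m → Fin V.m → V.Smooth, IsBivector V π' ∧
            V.flowAt (γ.1 M k) (bivectorFun V π) = bivectorFun V π' ∧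
            ∀ l μ ν, schouten V π π' l μ ν = 0) := by
  refine ⟨fun n => ⟨classFlow 𝕜 n, fun M k γ V H => ?_, totalFlow 𝕜 n, totalFlow_graphClass 𝕜 n⟩,
    fun V => ⟨fun H hH => ?_, fun π => bivectorFun_mem_Ham_iff V,
      fun M k γ π hπ => exists_bivectorFun_eq_flowAt V hπ γ M k⟩⟩
  · have hcocycle := V.flowAt_mem_cocycles γ M k H
    exact ⟨hcocycle.1, V.bracket_flowAt_eq_zero γ M k H, hcocycle,
      classFlow_graphClass_apply 𝕜 n M k γ V H⟩
  · obtain ⟨π, hπ, rfl⟩ := (bijOn_bivectorFun V).surjOn hH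
    exact ⟨π, ⟨hπ, rfl⟩, fun π' h => injOn_bivectorFun V h.1 hπ h.2⟩
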